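/- **Theorem 3.6 (Local existence of the solution to the IVP).** *Setting.* Let $d\ge 1$, $L_1,\dots,L_d>0$, $\lambda_0,\lambda_1,\lambda_2\in\mathbb R$, $p\in\{0,1\}$, and let $N$ be a real polynomial with $N(0)=N'(0)=0$. Assume parabolicity and semilinearity: either $\lambda_2<0$, or $\lambda_2=0$, $\lambda_1>0$ and $p=0$. Consider, for functions of the form of a cosine series $\sum_{\mathbf k\ge0}\alpha_{\mathbf k}a_{\mathbf k}\prod_j\cos(k_jL_jx_j)$ (even, $2\pi/L_j$-periodic in $x_j$), the problem $$u_t=(\lambda_0+\lambda_1\Delta+\lambda_2\Delta^2)u+\Delta^pN(u),\qquad u(0,\cdot)=u_0 .\tag{IVP}$$ For $\mathbf k\in\mathbb Z_{\ge0}^d$ put $\alpha_{\mathbf k}=\prod_j 2^{1-\delta_{k_j,0}}$, $\omega_{\mathbf k}=\alpha_{\mathbf k}\nu^{k_1+\dots+k_d}$ with a fixed $\nu\ge1$, $(\mathbf{kL})^2=\sum_j(k_jL_j)^2$, $|\mathbf k|_\infty=\max(1,\max_jk_j)$, $q=2p$, $\mu_{\mathbf k}=\lambda_0-\lambda_1(\mathbf{kL})^2+\lambda_2(\mathbf{kL})^4$.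 Let $\ell^1_\omega$ be the space of real sequences with $\|a\|_\omega=\sum_{\mathbf k\ge0}|a_{\mathbf k}|\omega_{\mathbf k}<\infty$, and $\ell^1_{\omega,-q}$ the analogous space with weights $\omega_{\mathbf k}/|\mathbf k|_\infty^q$. Let $(\mathcal L\phi)_{\mathbf k}=\mu_{\mathbf k}\phi_{\mathbf k}$ with domain $D(\mathcal L)=\{\phi\in\ell^1_\omega:\mathcal L\phi\in\ell^1_\omega\}$, $(\mathcal Q\phi)_{\mathbf k}=\mathrm i^q(\mathbf{kL})^q\phi_{\mathbf k}$ ($\mathcal Q:\ell^1_\omega\to\ell^1_{\omega,-q}$), and let $\mathcal N:\ell^1_\omega\to\ell^1_\omega$ be $N$ evaluated with powers taken for the convolution $(a*b)_{\mathbf k}=\sum_{\mathbf k_1+\mathbf k_2=\mathbf k,\ \mathbf k_i\in\mathbb Z^d}a_{|\mathbf k_1|}b_{|\mathbf k_2|}$ ($|\cdot|$ taken component-wise). Let $\tau>0$, $J=(0,\tau]$, and let $X=C(J;\ell^1_\omega)$ be the Banach space of bounded continuous functions with $\|a\|=\sup_{t\in J}\|a(t)\|_\omega$. For $0\le s<\tau$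 let $\mathcal D_{(s,\tau]}=C((s,\tau];D(\mathcal L))\cap C^1((s,\tau);\ell^1_\omega)\cap C((s,\tau];\ell^1_\omega)$ ($D(\mathcal L)$ with the graph norm), and $\mathcal D=\mathcal D_J$. For $\varphi\in\ell^1_\omega$ and $a\in\mathcal D$ put $F(a)=(\dot a-\mathcal La-\mathcal Q\mathcal N(a),\,a(0)-\varphi)$, where for a function $a$ defined on $J$ the value $a(0)$ means $\lim_{t\to0+}a(t)$ in $\ell^1_\omega$. Let $\bar a$ be a Chebyshev–Fourier polynomial: for a size $\mathbf M\in\mathbb Z_{\ge0}^d$, an $n\in\mathbb Z_{\ge0}$ and real coefficients $\bar a_{\ell,\mathbf k}$, $\bar a_{\mathbf k}(t)=\bar a_{0,\mathbf k}+2\sum_{1\le\ell<n}\bar a_{\ell,\mathbf k}T_\ell(t)$ if $k_j<M_j$ for all $j$, and $\bar a_{\mathbf k}=0$ otherwise, where $T_\ell$ is the $\ell$-th Chebyshev polynomial of the first kind rescaled to $[0,\tau]$. For $0\le s<t\le\tau$ let $U(t,s)\chi=b(t)$, where $b\in\mathcal D_{(s,\tau]}$ is the solution of $\dot b=\mathcal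 Lb+\mathcal QD\mathcal N(\bar a)b$ on $(s,\tau)$ with $b(t)\to\chi\in\ell^1_{\omega,-q}$ in $\ell^1_{\omega,-q}$ as $t\to s+$. Put $B_J(\bar a,\varrho)=\{a\in X:\|a-\bar a\|\le\varrho\}$ and $$T(a)(t)=U(t,0)\varphi+\int_0^tU(t,s)\bigl(\mathcal Q\mathcal N(a(s))-\mathcal QD\mathcal N(\bar a(s))a(s)\bigr)\,ds,$$ which is $DF(\bar a)^{-1}(DF(\bar a)a-F(a))$, with $DF(\bar a)^{-1}(P,\phi)(t)=U(t,0)\phi+\int_0^tU(t,s)P(s)\,ds$. *Hypotheses.* Let $\gamma\in[0,1)$, $W,W_q>0$ be such that for all $0<s<t\le\tau$ and $\phi,\psi\in\ell^1_\omega$ $$\|U(t,s)\phi\|_\omega\le W\|\phi\|_\omega,\qquad (t-s)^\gamma\|U(t,s)\mathcal Q\psi\|_\omega\le W_q\|\psi\|_\omega .$$ Let $\|\dot{\bar a}-\mathcal L\bar a-\mathcal Q\mathcal N(\bar a)\|\le\delta$ and $\|\varphi-\bar a(0)\|_\omega\le\varepsilon$. Let $L_{\bar a}:(0,\infty)\to(0,\infty)$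 be non-decreasing with $$\|\mathcal N(a_1)-\mathcal N(a_2)-D\mathcal N(\bar a)(a_1-a_2)\|\le L_{\bar a}(\varrho)\|a_1-a_2\|\quad\text{for all }\varrho>0,\ a_1,a_2\in B_J(\bar a,\varrho).$$ Suppose that for some $\varrho_0>0$ $$p_\varepsilon(\varrho_0)=W(\varepsilon+\tau\delta)+\frac{\tau^{1-\gamma}W_q}{1-\gamma}L_{\bar a}(\varrho_0)\varrho_0\le\varrho_0 .$$ *Conclusion.* The integral defining $T(a)(t)$ converges for all $a\in X$ and $t\in J$, and $T$ maps $X$ into $X$ and $B_J(\bar a,\varrho_0)$ into itself. On this ball $T$ is Lipschitz with a constant $K\le1$, and $K<1$ (so $T$ is a contraction) if $\varepsilon+\tau\delta>0$. In all cases $T$ has exactly one fixed point $\tilde a$ in $B_J(\bar a,\varrho_0)$. It lies in $\mathcal D$, satisfies $F(\tilde a)=0$, and is the only zero of $F$ in $\mathcal D\cap B_J(\bar a,\varrho_0)$. Moreover $\tilde a\in C^1(J;\ell^1_\omega)$ and $\dot{\tilde a}=\mathcal L\tilde a+\mathcal Q\mathcal N(\tilde a)$ on all of $J$ (one-sided derivative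 at $\tau$). Hence $u(t,x)=\sum_{\mathbf k\ge0}\alpha_{\mathbf k}\tilde a_{\mathbf k}(t)\prod_j\cos(k_jL_jx_j)$ is a classical solution of (IVP) on $J$ with $u_0(x)=\sum_{\mathbf k\ge0}\alpha_{\mathbf k}\varphi_{\mathbf k}\prod_j\cos(k_jL_jx_j)$: it is $C^2$ in $x$ ($C^4$ if $\lambda_2\ne0$), even, periodic, satisfies the equation at every $t\in J$ and $x\in\mathbb R^d$ (one-sided time derivative at $\tau$), and $u(t,\cdot)\to u_0$ uniformly as $t\to0+$. -/

import Mathlib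

open Set Filter Topology

noncomputable section

namespace ParabolicIVP

/-! ### Weighted sequence spaces -/

section WeightedSpace

variable {ι : Type}

/-- The real sequences `a` with `∑ |a k| w k < ∞`, as a subspace of all sequences. -/
def ell1Submodule (w : ι → {x : ℝ // 0 < x}) : Submodule ℝ (ι → ℝ) where
  carrier := {a | Summable fun k => |a k| * (w k : ℝ)}
  zero_mem' := by simp [summable_zero]
  add_mem' := by
    intro a b ha hb
    refine Summable.of_nonneg_of_le (fun k => mul_nonneg (abs_nonneg _) (w k).2.le)
      (fun k => ?_) (Summable.add ha hb)
    rw [← add_mul]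
    exact mul_le_mul_of_nonneg_right (abs_add_le _ _) (w k).2.le
  smul_mem' := by
    intro c a ha
    have h : Summable fun k => |c| * (|a k| * (w k : ℝ)) := Summable.mul_left _ ha
    refine h.congr (fun k => ?_)
    simp [abs_mul, mul_assoc]

/-- The weighted space `ℓ¹_w`. -/
def Ell1 (w : ι → {x : ℝ // 0 < x}) : Type := ↥(ell1Submodule w)

variable {w : ι → {x : ℝ // 0 < x}}

instance : AddCommGroup (Ell1 w) := inferInstanceAs (AddCommGroup ↥(ell1Submodule w))

instance : Module ℝ (Ell1 w) := inferInstanceAs (Module ℝ ↥(ell1Submodule w))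

instance : CoeFun (Ell1 w) (fun _ => ι → ℝ) := ⟨fun a => a.1⟩

theorem Ell1.summable (a : Ell1 w) : Summable fun k => |a k| * (w k : ℝ) := a.2

/-- The norm `‖a‖ = ∑ |a k| w k`. -/
instance : Norm (Ell1 w) := ⟨fun a => ∑' k, |a k| * (w k : ℝ)⟩

theorem Ell1.norm_def (a : Ell1 w) : ‖a‖ = ∑' k, |a k| * (w k : ℝ) := rfl

@[ext] theorem Ell1.ext {a b : Ell1 w} (h : ∀ k, a k = b k) : a = b := Subtype.ext (funext h)

theorem Ell1.add_apply (a b : Ell1 w) (k : ι) : (a + b) k = a k + b k := rfl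

theorem Ell1.smul_apply (c : ℝ) (a : Ell1 w) (k : ι) : (c • a) k = c * a k := rfl

theorem Ell1.norm_core : NormedSpace.Core ℝ (Ell1 w) where
  norm_nonneg a := tsum_nonneg fun k => mul_nonneg (abs_nonneg _) (w k).2.le
  norm_smul c a := by
    simp only [Ell1.norm_def, Ell1.smul_apply, abs_mul, mul_assoc, Real.norm_eq_abs]
    exact tsum_mul_left
  norm_triangle a b := by
    simp only [Ell1.norm_def]
    rw [← Summable.tsum_add a.summable b.summable]
    refine Summable.tsum_le_tsum (fun k => ?_) (a + b).summable (a.summable.add b.summable)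
    rw [← add_mul]
    exact mul_le_mul_of_nonneg_right (abs_add_le _ _) (w k).2.le
  norm_eq_zero_iff a := by
    constructor
    · intro h
      ext k
      have h0 : ∀ k, 0 ≤ |a k| * (w k : ℝ) := fun k => mul_nonneg (abs_nonneg _) (w k).2.le
      have h1 := a.summable.hasSum
      rw [← Ell1.norm_def, h] at h1
      have h2 := congrFun ((hasSum_zero_iff_of_nonneg h0).1 h1) k
      rcases mul_eq_zero.1 h2 with h3 | h3
      · exact abs_eq_zero.1 h3
      · exact absurd h3 (w k).2.ne'
    · rintro rfl
      have : ∀ k, (0 : Ell1 w) k = 0 := fun _ => rfl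
      simp [Ell1.norm_def, this]

instance : NormedAddCommGroup (Ell1 w) := NormedAddCommGroup.ofCore Ell1.norm_core

instance : NormedSpace ℝ (Ell1 w) := NormedSpace.ofCore Ell1.norm_core

end WeightedSpace

/-! ### The equation, the weights and the linear operators -/

/-- The data of the scalar semilinear parabolic equation
`u_t = (λ₀ + λ₁ Δ + λ₂ Δ²) u + Δ^p N(u)` on the torus `∏ [-π / L_j, π / L_j]`,
with the geometric rate `ν` of the sequence space. -/
structure Setting (d : ℕ) where
  /-- the domain sizes -/
  L : Fin d → ℝ
  L_pos : ∀ i, 0 < L i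
  lam0 : ℝ
  lam1 : ℝ
  lam2 : ℝ
  /-- parabolicity -/
  parabolic : lam2 < 0 ∨ (lam2 = 0 ∧ 0 < lam1)
  /-- the power of the Laplacian in front of the nonlinearity -/
  p : ℕ
  p_le_one : p ≤ 1
  /-- semilinearity: `Δ^p` has lower order than the linear part -/
  semilinear : p = 1 → lam2 < 0
  /-- the nonlinearity -/
  N : Polynomial ℝ
  N_zero : N.eval 0 = 0
  N_deriv_zero : N.derivative.eval 0 = 0
  /-- the decay rate of the Fourier coefficients -/
  nu : ℝ
  one_le_nu : 1 ≤ nu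

/-- Component-wise absolute value of an integer multi-index. -/
def absIdx {d : ℕ} (j : Fin d → ℤ) : Fin d → ℕ := fun i => (j i).natAbs

/-- The multiplicity of the cosine mode `k`: the number of integer multi-indices `j` with
`|j| = k`. -/
def alpha {d : ℕ} (k : Fin d → ℕ) : ℝ := ∏ i, if k i = 0 then 1 else 2

theorem one_le_alpha {d : ℕ} (k : Fin d → ℕ) : 1 ≤ alpha k := by
  have h : ∏ _i : Fin d, (1 : ℝ) ≤ alpha k :=
    Finset.prod_le_prod (fun i _ => zero_le_one) (fun i _ => by split_ifs <;> norm_num)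
  simpa using h

theorem alpha_le {d : ℕ} (k : Fin d → ℕ) : alpha k ≤ 2 ^ d := by
  have h : alpha k ≤ ∏ _i : Fin d, (2 : ℝ) :=
    Finset.prod_le_prod (fun i _ => by split_ifs <;> norm_num)
      (fun i _ => by split_ifs <;> norm_num)
  simpa using h

/-- `|k|_∞ = max (1, max_j k_j)`. -/
def infNorm {d : ℕ} (k : Fin d → ℕ) : ℕ := max 1 (Finset.univ.sup k)

theorem one_le_infNorm {d : ℕ} (k : Fin d → ℕ) : (1 : ℝ) ≤ infNorm k := by
  exact_mod_cast le_max_left _ _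

namespace Setting

variable {d : ℕ} (D : Setting d)

theorem nu_pos : 0 < D.nu := lt_of_lt_of_le one_pos D.one_le_nu

/-- The weight `ω_k = α_k ν^(k_1 + ⋯ + k_d)`. -/
def omega (k : Fin d → ℕ) : {x : ℝ // 0 < x} :=
  ⟨alpha k * D.nu ^ (∑ i, k i),
    mul_pos (lt_of_lt_of_le one_pos (one_le_alpha k)) (pow_pos D.nu_pos _)⟩

/-- The weight `ω_k / |k|_∞^q`, `q = 2 p`. -/
def omegaNeg (k : Fin d → ℕ) : {x : ℝ // 0 < x} :=
  ⟨(D.omega k : ℝ) / (infNorm k : ℝ) ^ (2 * D.p),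
    div_pos (D.omega k).2 (pow_pos (lt_of_lt_of_le one_pos (one_le_infNorm k)) _)⟩

/-- The space `ℓ¹_ω`. -/
abbrev Ell : Type := Ell1 D.omega

/-- The space `ℓ¹_{ω,-q}`. -/
abbrev EllNeg : Type := Ell1 D.omegaNeg

/-- `(kL)² = (k_1 L_1)² + ⋯ + (k_d L_d)²`. -/
def kLsq (k : Fin d → ℕ) : ℝ := ∑ i, ((k i : ℝ) * D.L i) ^ 2

/-- The eigenvalue `μ_k = λ₀ - λ₁ (kL)² + λ₂ (kL)⁴`. -/
def mu (k : Fin d → ℕ) : ℝ := D.lam0 - D.lam1 * D.kLsq k + D.lam2 * D.kLsq k ^ 2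

/-- The operator `(ℒ φ)_k = μ_k φ_k` in `ℓ¹_ω` with domain `{φ | ℒ φ ∈ ℓ¹_ω}`. -/
def Lop : D.Ell →ₗ.[ℝ] D.Ell where
  domain :=
    { carrier := {a | (fun k => D.mu k * a k) ∈ ell1Submodule D.omega}
      zero_mem' := by
        have h : (fun k => D.mu k * (0 : D.Ell) k) = 0 := by
          funext k
          exact mul_zero _
        rw [Set.mem_ofPred_eq, h]
        exact Submodule.zero_mem _
      add_mem' := by
        intro a b ha hb
        have h : (fun k => D.mu k * (a + b) k)
            = (fun k => D.mu k * a k) + (fun k => D.mu k * b k) := by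
          funext k
          exact mul_add _ _ _
        rw [Set.mem_ofPred_eq, h]
        exact Submodule.add_mem _ ha hb
      smul_mem' := by
        intro c a ha
        have h : (fun k => D.mu k * (c • a) k) = c • (fun k => D.mu k * a k) := by
          funext k
          exact mul_left_comm _ _ _
        rw [Set.mem_ofPred_eq, h]
        exact Submodule.smul_mem _ c ha }
  toFun :=
    { toFun := fun a => (⟨fun k => D.mu k * a.1 k, a.2⟩ : D.Ell)
      map_add' := by
        intro a b
        ext k
        exact mul_add _ _ _
      map_smul' := by
        intro c a
        ext k
        exact mul_left_comm _ _ _ }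

/-- The inclusion `ℓ¹_ω ⊆ ℓ¹_{ω,-q}`. -/
def incl (a : D.Ell) : D.EllNeg :=
  ⟨a.1, Summable.of_nonneg_of_le
    (fun k => mul_nonneg (abs_nonneg _) (D.omegaNeg k).2.le)
    (fun k => mul_le_mul_of_nonneg_left
      (div_le_self (D.omega k).2.le (one_le_pow₀ (one_le_infNorm k))) (abs_nonneg _))
    a.summable⟩

theorem kLsq_nonneg (k : Fin d → ℕ) : 0 ≤ D.kLsq k :=
  Finset.sum_nonneg fun _ _ => sq_nonneg _

theorem kLsq_le (k : Fin d → ℕ) : D.kLsq k ≤ (∑ i, D.L i ^ 2) * (infNorm k : ℝ) ^ 2 := by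
  rw [Finset.sum_mul]
  refine Finset.sum_le_sum fun i _ => ?_
  have h1 : k i ≤ infNorm k :=
    le_trans (Finset.le_sup (f := k) (Finset.mem_univ i)) (le_max_right _ _)
  have h2 : (k i : ℝ) ≤ infNorm k := by exact_mod_cast h1
  rw [mul_pow, mul_comm]
  gcongr

/-- The operator `𝒬 : ℓ¹_ω → ℓ¹_{ω,-q}`, `(𝒬 φ)_k = i^q (kL)^q φ_k` with `q = 2 p`, that is
`(-(kL)²)^p φ_k`. -/
def Q (a : D.Ell) : D.EllNeg :=
  ⟨fun k => (-D.kLsq k) ^ D.p * a k, by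
    have hS : Summable fun k => (∑ i, D.L i ^ 2) ^ D.p * (|a k| * (D.omega k : ℝ)) :=
      Summable.mul_left _ a.summable
    refine Summable.of_nonneg_of_le
      (fun k => mul_nonneg (abs_nonneg _) (D.omegaNeg k).2.le) (fun k => ?_) hS
    have hpos : (0 : ℝ) < (infNorm k : ℝ) ^ (2 * D.p) :=
      pow_pos (lt_of_lt_of_le one_pos (one_le_infNorm k)) _
    have h1 : D.kLsq k ^ D.p ≤ (∑ i, D.L i ^ 2) ^ D.p * (infNorm k : ℝ) ^ (2 * D.p) := by
      rw [pow_mul, ← mul_pow]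
      exact pow_le_pow_left₀ (D.kLsq_nonneg k) (D.kLsq_le k) _
    have h2 : |(-D.kLsq k) ^ D.p * a k| = D.kLsq k ^ D.p * |a k| := by
      rw [abs_mul, abs_pow, abs_neg, abs_of_nonneg (D.kLsq_nonneg k)]
    change |(-D.kLsq k) ^ D.p * a k| * ((D.omega k : ℝ) / (infNorm k : ℝ) ^ (2 * D.p)) ≤ _
    rw [h2, ← mul_div_assoc, div_le_iff₀ hpos]
    have h3 : 0 ≤ |a k| * (D.omega k : ℝ) := mul_nonneg (abs_nonneg _) (D.omega k).2.le
    calc D.kLsq k ^ D.p * |a k| * (D.omega k : ℝ)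
        = D.kLsq k ^ D.p * (|a k| * (D.omega k : ℝ)) := by ring
      _ ≤ (∑ i, D.L i ^ 2) ^ D.p * (infNorm k : ℝ) ^ (2 * D.p) * (|a k| * (D.omega k : ℝ)) :=
          mul_le_mul_of_nonneg_right h1 h3
      _ = _ := by ring⟩

/-! ### Discrete convolution and the nonlinearity -/

/-- `(a * b)_k = ∑_{k₁ + k₂ = k, k₁, k₂ ∈ ℤ^d} a_{|k₁|} b_{|k₂|}`. -/
def _root_.ParabolicIVP.convSeq (a b : (Fin d → ℕ) → ℝ) (k : Fin d → ℕ) : ℝ :=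
  ∑' j : Fin d → ℤ, a (absIdx j) * b (absIdx fun i => (k i : ℤ) - j i)

/-- The weight `ν^|j|` on all integer multi-indices. -/
def zWeight (j : Fin d → ℤ) : ℝ := D.nu ^ (∑ i, absIdx j i)

theorem zWeight_nonneg (j : Fin d → ℤ) : 0 ≤ D.zWeight j := pow_nonneg D.nu_pos.le _

theorem zWeight_add_le (j l : Fin d → ℤ) : D.zWeight (j + l) ≤ D.zWeight j * D.zWeight l := by
  unfold zWeight
  rw [← pow_add, ← Finset.sum_add_distrib]
  exact pow_le_pow_right₀ D.one_le_nu (Finset.sum_le_sum fun i _ => Int.natAbs_add_le _ _)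

theorem _root_.ParabolicIVP.sign_absIdx_injective {d : ℕ} : Function.Injective
    (fun j : Fin d → ℤ => ((fun i => decide (0 ≤ j i), absIdx j) :
      (Fin d → Bool) × (Fin d → ℕ))) := by
  intro j l h
  funext i
  have e1 : decide (0 ≤ j i) = decide (0 ≤ l i) := congrFun (congrArg Prod.fst h) i
  have e2 : (j i).natAbs = (l i).natAbs := congrFun (congrArg Prod.snd h) i
  have e3 : (0 ≤ j i) ↔ (0 ≤ l i) := decide_eq_decide.1 e1
  clear e1 h
  generalize j i = x at *
  generalize l i = y at *
  omega

theorem _root_.ParabolicIVP.summable_comp_absIdx {d : ℕ} (g : (Fin d → ℕ) → ℝ)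
    (hg : Summable g) (hg0 : ∀ k, 0 ≤ g k) :
    Summable fun j : Fin d → ℤ => g (absIdx j) := by
  have h2 : Summable fun x : (Fin d → Bool) × (Fin d → ℕ) => (1 : ℝ) * g x.2 :=
    Summable.mul_of_nonneg (f := fun _ : Fin d → Bool => (1 : ℝ))
      (Summable.of_finite) hg (fun _ => zero_le_one) hg0
  exact (h2.comp_injective sign_absIdx_injective).congr fun j => (one_mul _)

theorem summable_zWeight (a : D.Ell) :
    Summable fun j : Fin d → ℤ => |a (absIdx j)| * D.zWeight j := by
  have h1 : Summable fun k : Fin d → ℕ => |a k| * D.nu ^ (∑ i, k i) := by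
    refine Summable.of_nonneg_of_le
      (fun k => mul_nonneg (abs_nonneg _) (pow_nonneg D.nu_pos.le _)) (fun k => ?_) a.summable
    exact mul_le_mul_of_nonneg_left
      (le_mul_of_one_le_left (pow_nonneg D.nu_pos.le _) (one_le_alpha k)) (abs_nonneg _)
  exact summable_comp_absIdx _ h1
    fun k => mul_nonneg (abs_nonneg _) (pow_nonneg D.nu_pos.le _)

theorem conv_mem (a b : D.Ell) : convSeq a b ∈ ell1Submodule D.omega := by
  have ha := D.summable_zWeight a
  have hb := D.summable_zWeight b
  have hnn : ∀ (c : D.Ell) (j : Fin d → ℤ), 0 ≤ |c (absIdx j)| * D.zWeight j :=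
    fun c j => mul_nonneg (abs_nonneg _) (D.zWeight_nonneg j)
  have hab := ha.mul_of_nonneg hb (hnn a) (hnn b)
  have hinj : Function.Injective
      (fun x : (Fin d → ℤ) × (Fin d → ℤ) => (x.2, x.1 - x.2)) := by
    rintro ⟨x, y⟩ ⟨x', y'⟩ h
    simp only [Prod.mk.injEq] at h
    obtain ⟨rfl, h2⟩ := h
    simpa using h2
  have hsh := hab.comp_injective hinj
  have hrow := hsh.prod_factor
  have hcol := hsh.prod
  have hemb : Function.Injective (fun (k : Fin d → ℕ) (i : Fin d) => (k i : ℤ)) := by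
    intro k l h
    funext i
    have h1 : (k i : ℤ) = (l i : ℤ) := congrFun h i
    exact_mod_cast h1
  have hk := (hcol.comp_injective hemb).mul_left ((2 : ℝ) ^ d)
  refine Summable.of_nonneg_of_le
    (fun k => mul_nonneg (abs_nonneg _) (D.omega k).2.le) (fun k => ?_) hk
  set z : Fin d → ℤ := fun i => (k i : ℤ) with hz
  have hzw : D.zWeight z = D.nu ^ (∑ i, k i) := by simp [zWeight, absIdx, hz]
  have hterm : ∀ j : Fin d → ℤ,
      |a (absIdx j) * b (absIdx fun i => (k i : ℤ) - j i)| * D.zWeight z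
        ≤ |a (absIdx j)| * D.zWeight j * (|b (absIdx (z - j))| * D.zWeight (z - j)) := by
    intro j
    have e : (fun i => (k i : ℤ) - j i) = z - j := rfl
    have hw := D.zWeight_add_le j (z - j)
    rw [add_sub_cancel] at hw
    rw [e, abs_mul]
    calc |a (absIdx j)| * |b (absIdx (z - j))| * D.zWeight z
        ≤ |a (absIdx j)| * |b (absIdx (z - j))| * (D.zWeight j * D.zWeight (z - j)) :=
          mul_le_mul_of_nonneg_left hw (mul_nonneg (abs_nonneg _) (abs_nonneg _))
      _ = _ := by ring
  have hwpos : 0 < D.zWeight z := pow_pos D.nu_pos _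
  have hs1 : Summable fun j : Fin d → ℤ =>
      |a (absIdx j) * b (absIdx fun i => (k i : ℤ) - j i)| * D.zWeight z :=
    Summable.of_nonneg_of_le (fun j => mul_nonneg (abs_nonneg _) hwpos.le) hterm (hrow z)
  have hs2 : Summable fun j : Fin d → ℤ =>
      ‖a (absIdx j) * b (absIdx fun i => (k i : ℤ) - j i)‖ := by
    refine (hs1.mul_right (D.zWeight z)⁻¹).congr fun j => ?_
    rw [mul_assoc, mul_inv_cancel₀ hwpos.ne', mul_one, Real.norm_eq_abs]
  have hbound : |convSeq a b k| * D.zWeight z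
      ≤ ∑' j, |a (absIdx j)| * D.zWeight j * (|b (absIdx (z - j))| * D.zWeight (z - j)) := by
    have h1 : |convSeq a b k|
        ≤ ∑' j : Fin d → ℤ, |a (absIdx j) * b (absIdx fun i => (k i : ℤ) - j i)| :=
      norm_tsum_le_tsum_norm hs2
    calc |convSeq a b k| * D.zWeight z
        ≤ (∑' j : Fin d → ℤ, |a (absIdx j) * b (absIdx fun i => (k i : ℤ) - j i)|)
            * D.zWeight z := mul_le_mul_of_nonneg_right h1 hwpos.le
      _ = ∑' j : Fin d → ℤ,
            |a (absIdx j) * b (absIdx fun i => (k i : ℤ) - j i)| * D.zWeight z :=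
          tsum_mul_right.symm
      _ ≤ _ := Summable.tsum_le_tsum hterm hs1 (hrow z)
  have hom : (D.omega k : ℝ) ≤ 2 ^ d * D.zWeight z := by
    rw [hzw]
    exact mul_le_mul_of_nonneg_right (alpha_le k) (pow_nonneg D.nu_pos.le _)
  calc |convSeq a b k| * (D.omega k : ℝ)
      ≤ |convSeq a b k| * (2 ^ d * D.zWeight z) :=
        mul_le_mul_of_nonneg_left hom (abs_nonneg _)
    _ = 2 ^ d * (|convSeq a b k| * D.zWeight z) := by ring
    _ ≤ _ := mul_le_mul_of_nonneg_left hbound (by positivity)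

/-- The discrete convolution on `ℓ¹_ω`. -/
def conv (a b : D.Ell) : D.Ell := ⟨convSeq a b, D.conv_mem a b⟩

/-- A sequence with finitely many nonzero entries, as an element of `ℓ¹_ω`. -/
def ofFinite (a : (Fin d → ℕ) → ℝ) (S : Finset (Fin d → ℕ)) (h : ∀ k ∉ S, a k = 0) : D.Ell :=
  ⟨a, summable_of_ne_finset_zero (s := S) fun k hk => by simp [h k hk]⟩

/-- The unit of the convolution. -/
def unit : D.Ell :=
  D.ofFinite (fun k => if k = 0 then 1 else 0) {0} fun k hk => by
    simpa using hk

/-- Convolution powers. -/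
def convPow (a : D.Ell) : ℕ → D.Ell
  | 0 => D.unit
  | n + 1 => D.conv a (convPow a n)

/-- The operator `𝒩 : ℓ¹_ω → ℓ¹_ω`: the Fourier coefficients of `N(u)` are obtained by replacing
the powers in the polynomial `N` by convolution powers. -/
def Nop (a : D.Ell) : D.Ell := D.N.sum fun n c => c • D.convPow a n

/-- The Fréchet derivative `D𝒩(ψ)`, acting on `h`. -/
def DN (ψ h : D.Ell) : D.Ell := fderiv ℝ D.Nop ψ h

/-! ### The approximate solution -/

/-- The Chebyshev–Fourier approximation: for `k < M` component-wise,
`ā_k(t) = c_{0,k} + 2 ∑_{ℓ=1}^{n-1} c_{ℓ,k} T_ℓ(t)` with `T_ℓ` the Chebyshev polynomials of the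
first kind scaled to `[0, τ]`, and `ā_k = 0` for the other `k`. -/
def approx (τ : ℝ) (n : ℕ) (M : Fin d → ℕ) (c : ℕ → (Fin d → ℕ) → ℝ) (t : ℝ) : D.Ell :=
  D.ofFinite
    (fun k => if ∀ i, k i < M i then
      c 0 k + 2 * ∑ l ∈ Finset.Ico 1 n,
        c l k * (Polynomial.Chebyshev.T ℝ (l : ℤ)).eval (2 * t / τ - 1)
      else 0)
    (Fintype.piFinset fun i => Finset.range (M i))
    (fun k hk => by
      rw [if_neg]
      simpa [Fintype.mem_piFinset] using hk)

/-! ### Classical regularity on `(s, τ]` and the map `F` -/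

/-- The class `C((s,τ]; D(ℒ)) ∩ C¹((s,τ); ℓ¹_ω) ∩ C((s,τ]; ℓ¹_ω)`. -/
def MemD (s τ : ℝ) (b : ℝ → D.Ell) : Prop :=
  ContinuousOn b (Ioc s τ) ∧
  (∃ h : ∀ t : Ioc s τ, b t ∈ D.Lop.domain,
    Continuous fun t : Ioc s τ => D.Lop ⟨b t, h t⟩) ∧
  ContDiffOn ℝ 1 b (Ioo s τ)

/-- The first component of `F` on `J = (0, τ]`: the sequence
`ȧ(t) - ℒ a(t) - 𝒬 𝒩(a(t))`, where the derivative is one-sided at `t = τ`. -/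
def F1 (τ : ℝ) (a : ℝ → D.Ell) (t : ℝ) (k : Fin d → ℕ) : ℝ :=
  derivWithin a (Ioc 0 τ) t k - D.mu k * a t k - D.Q (D.Nop (a t)) k

/-- `a ∈ 𝒟` is a zero of `F`. As `a` is defined on `(0, τ]`, the value `a(0)` is the limit
at `0`. -/
def IsZeroOfF (τ : ℝ) (φ : D.Ell) (a : ℝ → D.Ell) : Prop :=
  D.MemD 0 τ a ∧ (∀ t ∈ Ioo 0 τ, D.F1 τ a t = 0) ∧ Tendsto a (𝓝[>] 0) (𝓝 φ)

/-! ### The evolution operator of the linearisation -/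

/-- `b` solves `ḃ = ℒ b + 𝒬 D𝒩(ā) b` on `(s, τ]` with `b(s) = χ ∈ ℓ¹_{ω,-q}`, the initial value
being attained in `ℓ¹_{ω,-q}`. -/
def IsLinSol (abar : ℝ → D.Ell) (τ s : ℝ) (χ : D.EllNeg) (b : ℝ → D.Ell) : Prop :=
  D.MemD s τ b ∧
  (∀ t ∈ Ioo s τ, ∀ k, deriv b t k = D.mu k * b t k + D.Q (D.DN (abar t) (b t)) k) ∧
  Tendsto (fun t => D.incl (b t)) (𝓝[>] s) (𝓝 χ)

open Classical in
/-- The evolution operator: `U(t, s) χ = b(t)`, for `s < t ≤ τ`, where `b` is the solution of the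
linearised problem with `b(s) = χ`. -/
def U (abar : ℝ → D.Ell) (τ t s : ℝ) (χ : D.EllNeg) : D.Ell :=
  if h : ∃ b, D.IsLinSol abar τ s χ b then h.choose t else 0

/-! ### The Newton-like operator -/

/-- The space `X = C(J; ℓ¹_ω)`, `J = (0, τ]`, with the supremum norm. -/
abbrev X (τ : ℝ) : Type := BoundedContinuousFunction (Ioc (0 : ℝ) τ) D.Ell

/-- An element of `X` as a function on `ℝ`, with the junk value `0` outside `J`. -/
def ext {τ : ℝ} (a : D.X τ) (t : ℝ) : D.Ell :=
  if h : t ∈ Ioc 0 τ then a ⟨t, h⟩ else 0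

/-- The ball `B_J(ā, ϱ) = {a ∈ X | sup_{t ∈ J} ‖a(t) - ā(t)‖ ≤ ϱ}`. -/
def ball {τ : ℝ} (abar : ℝ → D.Ell) (ϱ : ℝ) : Set (D.X τ) :=
  {a | ∀ t : Ioc 0 τ, ‖a t - abar t‖ ≤ ϱ}

/-- `DF(ā)⁻¹ (P, φ) (t) = U(t, 0) φ + ∫₀ᵗ U(t, s) P(s) ds`. -/
def DFinv (abar : ℝ → D.Ell) (τ : ℝ) (P : ℝ → D.EllNeg) (φ : D.Ell) (t : ℝ) : D.Ell :=
  D.U abar τ t 0 (D.incl φ) + ∫ s in (0 : ℝ)..t, D.U abar τ t s (P s)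

/-- `DF(ā) a - F(a) = (𝒬 𝒩(a) - 𝒬 D𝒩(ā) a, φ)`: the first component. -/
def newtonRhs {τ : ℝ} (abar : ℝ → D.Ell) (a : D.X τ) (s : ℝ) : D.EllNeg :=
  D.Q (D.Nop (D.ext a s)) - D.Q (D.DN (abar s) (D.ext a s))

/-- The Newton-like operator `T(a) = DF(ā)⁻¹ (DF(ā) a - F(a))`. -/
def T {τ : ℝ} (abar : ℝ → D.Ell) (φ : D.Ell) (a : D.X τ) (t : ℝ) : D.Ell :=
  D.DFinv abar τ (D.newtonRhs abar a) φ t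

/-! ### The initial value problem for the partial differential equation -/

/-- The cosine series `∑_{k ≥ 0} α_k a_k cos(k_1 L_1 x_1) ⋯ cos(k_d L_d x_d)`. -/
def cosSeries (a : D.Ell) (x : EuclideanSpace ℝ (Fin d)) : ℝ :=
  ∑' k : Fin d → ℕ, alpha k * a k * ∏ i, Real.cos ((k i : ℝ) * D.L i * x i)

/-- `u` is a classical solution on `J = (0, τ]` of `u_t = (λ₀ + λ₁ Δ + λ₂ Δ²) u + Δ^p N(u)`,
`u(0, ·) = u₀`, with periodic boundary conditions and even symmetry; at `t = τ` the time
derivative is one-sided. -/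
structure IsIVPSolution (τ : ℝ) (u₀ : EuclideanSpace ℝ (Fin d) → ℝ)
    (u : ℝ → EuclideanSpace ℝ (Fin d) → ℝ) : Prop where
  contDiff_two : ∀ t ∈ Ioc 0 τ, ContDiff ℝ 2 (u t)
  contDiff_four : D.lam2 ≠ 0 → ∀ t ∈ Ioc 0 τ, ContDiff ℝ 4 (u t)
  periodic : ∀ t ∈ Ioc 0 τ, ∀ x i,
    u t (x + EuclideanSpace.single i (2 * Real.pi / D.L i)) = u t x
  even : ∀ t ∈ Ioc 0 τ, ∀ x, u t (-x) = u t x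
  equation : ∀ t ∈ Ioc 0 τ, ∀ x,
    HasDerivWithinAt (fun r => u r x)
      (D.lam0 * u t x + D.lam1 * Laplacian.laplacian (u t) x
        + D.lam2 * Laplacian.laplacian (Laplacian.laplacian (u t)) x
        + (fun f : EuclideanSpace ℝ (Fin d) → ℝ =>
            (Laplacian.laplacian f : EuclideanSpace ℝ (Fin d) → ℝ))^[D.p]
              (fun y => D.N.eval (u t y)) x)
      (Ioc 0 τ) t
  initial : TendstoUniformly u u₀ (𝓝[>] 0)

end Setting

end ParabolicIVP

end

open ParabolicIVP

/-! Apart from the convolution, every operator is diagonal in the Fourier index. A solution of `ḃ =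
ℒ b + f` is therefore treated as a family of scalar Duhamel formulas (`Mild`), and measured by the
`[0, ∞]`-valued norms `enrm m` with weights `ω_k θ_k^m`, where `θ_k = 1 + (kL)²`. Parabolicity and
semilinearity enter through `c θ_k^(p+1) ≤ Λ - μ_k`: the linear part gains `p + 1` powers of `θ`,
while `𝒬` costs only `p`. In `L¹` in time, time integrals and sums over modes commute, so maximal
regularity reduces to the Laplace transform of a scalar exponential. This gives smoothing by one
power of `θ` (`Mild.smoothing`) and, with a weight `e^{-lt}` for large `l`, a contraction with
arbitrarily small constant (`Mild.contraction`), hence uniqueness (`Mild.eq_zero`). Iterated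
smoothing makes mild solutions classical for positive times (`Mild.regularity`).

The linearisation: `ā` has finite Fourier support, so `D𝒩(ā)` is convolution with a finitely
supported kernel, that is, a finite sum of shifts. The Picard series of the linear equation
converges geometrically in `L¹` in time; by uniqueness its sum is `U(t, s) χ` (`U_eq_evol`). It is
jointly measurable in `(t, s)`, and Fubini's theorem shows that `DF(ā)⁻¹(P, φ)` is the mild solution
with force `P` and initial value `φ` (`mild_DFinv`). The assumed bounds on `U` then become a
stability estimate for the forced linear equation (`EvolBounds.norm_sub_le`).

The fixed point: `T(a)` solves the linear equation with force `𝒬(𝒩(a) - D𝒩(ā) a)`, and `ā` solves it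
with force `𝒬(𝒩(ā) - D𝒩(ā) ā)` plus its defect. Stability bounds `T(a) - ā` by `p_ε(ϱ₀)` and `T(a₁)
- T(a₂)` by `κ L(ϱ₀) ‖a₁ - a₂‖`, where `κ = τ^(1-γ) W_q / (1-γ)`. If `ε + τδ > 0`, Banach's theorem
applies; if `ε + τδ = 0`, the same estimate at `a = ā` says `T(ā) = ā`. At a fixed point the
linearised terms cancel, which leaves a mild solution of the nonlinear equation. Bounded continuous
mild solutions of that equation are unique, which settles both uniqueness claims whatever the
Lipschitz constant.

The differential equation: as a series of exponentials over `ℤ^d`, the cosine series turns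
convolution into multiplication (`cosSeries_conv`) and may be differentiated term by term, because
the solution has finite norm in every weight at positive times. -/

section

open MeasureTheory
open scoped ENNReal NNReal

noncomputable section

namespace ParabolicIVP

/-! ### Weighted `ℓ¹` spaces: completeness, domination and measurability -/

section WeightedSpaceAux

variable {ι : Type} {w : ι → {x : ℝ // 0 < x}}

theorem Ell1.neg_apply (a : Ell1 w) (k : ι) : (-a) k = -a k := rfl

theorem Ell1.sub_apply (a b : Ell1 w) (k : ι) : (a - b) k = a k - b k := rfl

theorem Ell1.zero_apply (k : ι) : (0 : Ell1 w) k = 0 := rfl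

/-- A summable sequence as an element of `Ell1 w`. -/
def Ell1.mk (a : ι → ℝ) (h : a ∈ ell1Submodule w) : Ell1 w := ⟨a, h⟩

@[simp] theorem Ell1.mk_apply (a : ι → ℝ) (h : a ∈ ell1Submodule w) (k : ι) :
    Ell1.mk a h k = a k := rfl

theorem Ell1.abs_apply_le (a : Ell1 w) (k : ι) : |a k| ≤ (w k : ℝ)⁻¹ * ‖a‖ := by
  have h : |a k| * (w k : ℝ) ≤ ‖a‖ :=
    a.summable.le_tsum k fun j _ => mul_nonneg (abs_nonneg _) (w j).2.le
  rw [← div_eq_inv_mul]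
  exact (le_div_iff₀ (w k).2).2 h

/-- Evaluation at an index as a continuous linear functional. -/
def Ell1.coord (w : ι → {x : ℝ // 0 < x}) (k : ι) : Ell1 w →L[ℝ] ℝ :=
  LinearMap.mkContinuous
    { toFun := fun a => a k
      map_add' := fun _ _ => rfl
      map_smul' := fun _ _ => rfl } (w k : ℝ)⁻¹ fun a => Ell1.abs_apply_le a k

@[simp] theorem Ell1.coord_apply (k : ι) (a : Ell1 w) : Ell1.coord w k a = a k := rfl

theorem Ell1.sum_apply {κ : Type*} (s : Finset κ) (f : κ → Ell1 w) (k : ι) :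
    (∑ i ∈ s, f i) k = ∑ i ∈ s, f i k :=
  map_sum (Ell1.coord w k) f s

/-- Multiplication by the weight identifies `Ell1 w` with the unweighted `ℓ¹`. -/
def Ell1.toLp (a : Ell1 w) : lp (fun _ : ι => ℝ) 1 :=
  ⟨fun k => a k * (w k : ℝ), memℓp_gen (by
    refine a.summable.congr fun k => ?_
    simp [abs_of_pos (w k).2])⟩

theorem Ell1.isometry_toLp : Isometry (Ell1.toLp (w := w)) := by
  refine Isometry.of_dist_eq fun a b => ?_
  rw [dist_eq_norm, dist_eq_norm, lp.norm_eq_tsum_rpow (by simp), Ell1.norm_def]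
  simp only [ENNReal.toReal_one, Real.rpow_one, div_one]
  refine tsum_congr fun k => ?_
  change ‖a k * (w k : ℝ) - b k * (w k : ℝ)‖ = |a k - b k| * _
  rw [← sub_mul, Real.norm_eq_abs, abs_mul, abs_of_pos (w k).2]

theorem Ell1.surjective_toLp : Function.Surjective (Ell1.toLp (w := w)) := by
  intro f
  have hf := (lp.memℓp f).summable (by simp)
  refine ⟨⟨fun k => f k / (w k : ℝ), ?_⟩, ?_⟩
  · refine hf.congr fun k => ?_
    simp [abs_div, abs_of_pos (w k).2, div_mul_cancel₀ _ (w k).2.ne']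
  · ext k
    exact div_mul_cancel₀ _ (w k).2.ne'

/-- Needed for the Bochner integral in `T` and for Banach's theorem in `X`. -/
instance : CompleteSpace (Ell1 w) :=
  ((IsometryEquiv.mk (Equiv.ofBijective _ ⟨Ell1.isometry_toLp.injective, Ell1.surjective_toLp⟩)
    Ell1.isometry_toLp).completeSpace_iff).2 inferInstance

/-- Dominated convergence for sums, with `|F - G| ≤ 2B`. This is how mode-wise limits are turned
into limits in norm. -/
theorem Ell1.tendsto_of_dominated {α : Type*} {l : Filter α} {F : α → Ell1 w} {G : Ell1 w}
    {B : ι → ℝ} (hB : Summable fun k => B k * (w k : ℝ))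
    (hlim : ∀ k, Tendsto (fun x => F x k) l (𝓝 (G k)))
    (hdom : ∀ᶠ x in l, ∀ k, |F x k| ≤ B k) : Tendsto F l (𝓝 G) := by
  rcases eq_or_neBot l with rfl | hl
  · exact tendsto_bot
  have hG : ∀ k, |G k| ≤ B k := fun k =>
    le_of_tendsto (hlim k).abs (hdom.mono fun x hx => hx k)
  rw [tendsto_iff_norm_sub_tendsto_zero]
  have h0 : (0 : ℝ) = ∑' _ : ι, (0 : ℝ) := by simp
  rw [h0]
  refine tendsto_tsum_of_dominated_convergence (bound := fun k => 2 * (B k * (w k : ℝ)))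
    (hB.mul_left 2) (fun k => ?_) (hdom.mono fun x hx k => ?_)
  · have h1 : Tendsto (fun x => |F x k - G k| * (w k : ℝ)) l (𝓝 (|G k - G k| * (w k : ℝ))) :=
      (((hlim k).sub_const _).abs).mul_const _
    rw [sub_self, abs_zero, zero_mul] at h1
    exact h1
  · rw [Real.norm_eq_abs, abs_of_nonneg (mul_nonneg (abs_nonneg _) (w k).2.le), ← mul_assoc]
    refine mul_le_mul_of_nonneg_right ?_ (w k).2.le
    calc |F x k - G k| ≤ |F x k| + |G k| := abs_sub _ _
      _ ≤ 2 * B k := by linarith [hx k, hG k]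

/-- The sequence supported at one index. -/
def Ell1.single (w : ι → {x : ℝ // 0 < x}) (k : ι) : Ell1 w :=
  ⟨Set.indicator {k} 1, summable_of_ne_finset_zero (s := {k}) fun j hj => by
    have : j ≠ k := by simpa using hj
    simp [this]⟩

theorem Ell1.tendsto_truncation (a : Ell1 w) :
    Tendsto (fun s : Finset ι => ∑ k ∈ s, a k • Ell1.single w k) atTop (𝓝 a) := by
  classical
  have key : ∀ (s : Finset ι) j, (∑ k ∈ s, a k • Ell1.single w k) j = if j ∈ s then a j else 0 := by
    intro s j
    rw [Ell1.sum_apply, ← Finset.sum_ite_eq s j (fun k => a k)]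
    refine Finset.sum_congr rfl fun k _ => ?_
    rw [Ell1.smul_apply]
    change a k * Set.indicator {k} 1 j = _
    by_cases h : j = k <;> simp [h, Set.indicator]
  refine Ell1.tendsto_of_dominated a.summable (fun k => ?_) (Eventually.of_forall fun s k => ?_)
  · refine tendsto_const_nhds.congr' ?_
    filter_upwards [eventually_ge_atTop {k}] with s hs
    rw [key, if_pos (hs (Finset.mem_singleton_self k))]
  · rw [key]
    split_ifs <;> simp

/-- Each element is the limit of its finite truncations, so measurability can be checked mode by
mode. This is used for `s ↦ U(t, s) P(s)`, which is only known through its coefficients. -/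
theorem Ell1.aestronglyMeasurable [Countable ι] {Ω : Type*} [MeasurableSpace Ω]
    {m : MeasureTheory.Measure Ω} {F : Ω → Ell1 w}
    (h : ∀ k, MeasureTheory.AEStronglyMeasurable (fun x => F x k) m) :
    MeasureTheory.AEStronglyMeasurable F m := by
  refine aestronglyMeasurable_of_tendsto_ae (u := (atTop : Filter (Finset ι)))
    (f := fun s x => ∑ k ∈ s, F x k • Ell1.single w k) (fun s => ?_)
    (Eventually.of_forall fun x => Ell1.tendsto_truncation (F x))
  exact Finset.aestronglyMeasurable_fun_sum s fun k _ => (h k).smul_const _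

/-- With sums in `[0, ∞]`, Tonelli's theorem applies without summability conditions, and membership
is a statement of finiteness checked at the end. -/
theorem Ell1.mem_iff (a : ι → ℝ) :
    a ∈ ell1Submodule w ↔ ∑' k, ENNReal.ofReal (w k) * ‖a k‖ₑ ≠ ∞ := by
  have h0 : ∀ k, 0 ≤ |a k| * (w k : ℝ) := fun k => mul_nonneg (abs_nonneg _) (w k).2.le
  have e : ∀ k, ENNReal.ofReal (w k) * ‖a k‖ₑ = ENNReal.ofReal (|a k| * (w k : ℝ)) := fun k => by
    rw [ENNReal.ofReal_mul (abs_nonneg _), mul_comm, Real.enorm_eq_ofReal_abs]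
  simp only [e]
  constructor
  · intro h
    exact Summable.tsum_ofReal_ne_top h
  · intro h
    have := ENNReal.summable_toReal h
    exact this.congr fun k => ENNReal.toReal_ofReal (h0 k)

theorem Ell1.enorm_eq (a : Ell1 w) : ‖a‖ₑ = ∑' k, ENNReal.ofReal (w k) * ‖a k‖ₑ := by
  have h0 : ∀ k, 0 ≤ |a k| * (w k : ℝ) := fun k => mul_nonneg (abs_nonneg _) (w k).2.le
  have e : ∀ k, ENNReal.ofReal (w k) * ‖a k‖ₑ = ENNReal.ofReal (|a k| * (w k : ℝ)) := fun k => by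
    rw [ENNReal.ofReal_mul (abs_nonneg _), mul_comm, Real.enorm_eq_ofReal_abs]
  simp only [e]
  rw [← ENNReal.ofReal_tsum_of_nonneg h0 a.summable, ← ofReal_norm, Ell1.norm_def]

end WeightedSpaceAux

namespace Setting

variable {d : ℕ} (D : Setting d)

/-! ### Polynomial weights -/

/-- `θ_k = 1 + (kL)²`. -/
def theta (k : Fin d → ℕ) : ℝ := 1 + D.kLsq k

theorem one_le_theta (k : Fin d → ℕ) : 1 ≤ D.theta k := by
  have := D.kLsq_nonneg k
  unfold theta
  linarith

theorem theta_pos (k : Fin d → ℕ) : 0 < D.theta k := one_pos.trans_le (D.one_le_theta k)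

/-- The symbol of `𝒬`. -/
def kap (k : Fin d → ℕ) : ℝ := (-D.kLsq k) ^ D.p

theorem abs_kap_le (k : Fin d → ℕ) : |D.kap k| ≤ D.theta k ^ D.p := by
  rw [kap, abs_pow, abs_neg, abs_of_nonneg (D.kLsq_nonneg k)]
  exact pow_le_pow_left₀ (D.kLsq_nonneg k) (by unfold theta; linarith) _

theorem Q_apply (a : D.Ell) (k : Fin d → ℕ) : D.Q a k = D.kap k * a k := rfl

theorem incl_apply (a : D.Ell) (k : Fin d → ℕ) : D.incl a k = a k := rfl

/-- The weight `ω_k θ_k^m`. -/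
def wt (m : ℤ) (k : Fin d → ℕ) : ℝ≥0∞ := ENNReal.ofReal (D.omega k * D.theta k ^ m)

theorem wt_real_pos (m : ℤ) (k : Fin d → ℕ) : 0 < (D.omega k : ℝ) * D.theta k ^ m :=
  mul_pos (D.omega k).2 (zpow_pos (D.theta_pos k) _)

theorem wt_ne_top (m : ℤ) (k : Fin d → ℕ) : D.wt m k ≠ ∞ := ENNReal.ofReal_ne_top

theorem wt_ne_zero (m : ℤ) (k : Fin d → ℕ) : D.wt m k ≠ 0 :=
  (ENNReal.ofReal_pos.2 (D.wt_real_pos m k)).ne'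

theorem wt_zero (k : Fin d → ℕ) : D.wt 0 k = ENNReal.ofReal (D.omega k) := by simp [wt]

theorem wt_mono {m n : ℤ} (h : m ≤ n) (k : Fin d → ℕ) : D.wt m k ≤ D.wt n k :=
  ENNReal.ofReal_le_ofReal <| mul_le_mul_of_nonneg_left
    (zpow_le_zpow_right₀ (D.one_le_theta k) h) (D.omega k).2.le

theorem wt_add (m n : ℤ) (k : Fin d → ℕ) :
    D.wt (m + n) k = D.wt m k * ENNReal.ofReal (D.theta k ^ n) := by
  rw [wt, wt, ← ENNReal.ofReal_mul (D.wt_real_pos m k).le, zpow_add₀ (D.theta_pos k).ne', mul_assoc]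

/-- The norm with weights `ω_k θ_k^m`, with values in `[0, ∞]`. -/
def enrm (m : ℤ) (a : (Fin d → ℕ) → ℝ) : ℝ≥0∞ := ∑' k, D.wt m k * ‖a k‖ₑ

theorem enrm_mono {m n : ℤ} (h : m ≤ n) (a : (Fin d → ℕ) → ℝ) : D.enrm m a ≤ D.enrm n a :=
  ENNReal.tsum_le_tsum fun k => mul_le_mul_left (D.wt_mono h k) _

theorem enrm_le_of_abs_le {m : ℤ} {a b : (Fin d → ℕ) → ℝ} (h : ∀ k, |a k| ≤ |b k|) :
    D.enrm m a ≤ D.enrm m b :=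
  ENNReal.tsum_le_tsum fun k => mul_le_mul_right (enorm_le_iff_norm_le.2 (h k)) _

theorem enrm_zero (m : ℤ) : D.enrm m (fun _ => 0) = 0 := by simp [enrm]

theorem enrm_add_le (m : ℤ) (a b : (Fin d → ℕ) → ℝ) :
    D.enrm m (fun k => a k + b k) ≤ D.enrm m a + D.enrm m b := by
  unfold enrm
  rw [← ENNReal.tsum_add]
  refine ENNReal.tsum_le_tsum fun k => ?_
  rw [← mul_add]
  exact mul_le_mul_right (enorm_add_le _ _) _

theorem enrm_sub_le (m : ℤ) (a b : (Fin d → ℕ) → ℝ) :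
    D.enrm m (fun k => a k - b k) ≤ D.enrm m a + D.enrm m b := by
  unfold enrm
  rw [← ENNReal.tsum_add]
  refine ENNReal.tsum_le_tsum fun k => ?_
  rw [← mul_add]
  exact mul_le_mul_right (enorm_sub_le) _

theorem enrm_const_mul (m : ℤ) (c : ℝ) (a : (Fin d → ℕ) → ℝ) :
    D.enrm m (fun k => c * a k) = ‖c‖ₑ * D.enrm m a := by
  unfold enrm
  rw [← ENNReal.tsum_mul_left]
  refine tsum_congr fun k => ?_
  rw [enorm_mul]; ring

theorem enrm_sum_le {κ : Type*} (m : ℤ) (s : Finset κ) (f : κ → (Fin d → ℕ) → ℝ) :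
    D.enrm m (fun k => ∑ i ∈ s, f i k) ≤ ∑ i ∈ s, D.enrm m (f i) := by
  classical
  induction s using Finset.induction_on with
  | empty => simp [enrm_zero]
  | insert i s hi ih =>
    simp only [Finset.sum_insert hi]
    exact (D.enrm_add_le m _ _).trans (by gcongr)

theorem wt_mul_enorm_le_enrm (m : ℤ) (a : (Fin d → ℕ) → ℝ) (k : Fin d → ℕ) :
    D.wt m k * ‖a k‖ₑ ≤ D.enrm m a := ENNReal.le_tsum k

theorem mem_ell_iff (a : (Fin d → ℕ) → ℝ) : a ∈ ell1Submodule D.omega ↔ D.enrm 0 a ≠ ∞ := by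
  rw [Ell1.mem_iff]; simp only [enrm, wt_zero]

theorem enorm_ell (a : D.Ell) : ‖a‖ₑ = D.enrm 0 a := by
  rw [Ell1.enorm_eq]; simp only [enrm, wt_zero]

theorem enrm_zero_ell (a : D.Ell) : D.enrm 0 a = ENNReal.ofReal ‖a‖ := by
  rw [← enorm_ell, ofReal_norm]

theorem enrm_zero_ell_ne_top (a : D.Ell) : D.enrm 0 a ≠ ∞ := by
  rw [enrm_zero_ell]; exact ENNReal.ofReal_ne_top

theorem summable_of_enrm_ne_top {m : ℤ} {a : (Fin d → ℕ) → ℝ} (h : D.enrm m a ≠ ∞) :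
    Summable fun k => |a k| * (D.omega k * D.theta k ^ m) := by
  have := ENNReal.summable_toReal h
  refine this.congr fun k => ?_
  rw [wt, ENNReal.toReal_mul, ENNReal.toReal_ofReal (D.wt_real_pos m k).le, toReal_enorm,
    Real.norm_eq_abs, mul_comm]

/-- The weights of `ℓ¹_{ω,-q}` are equivalent to `ω_k θ_k^{-p}`. -/
theorem exists_omegaNeg_le : ∃ C : ℝ≥0, ∀ k,
    ENNReal.ofReal (D.omegaNeg k) ≤ C * D.wt (-D.p) k := by
  refine ⟨((1 + ∑ i, D.L i ^ 2) ^ D.p).toNNReal, fun k => ?_⟩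
  have hS : 0 ≤ ∑ i, D.L i ^ 2 := Finset.sum_nonneg fun i _ => sq_nonneg _
  have hn := one_le_infNorm k
  have h1 : D.theta k ≤ (1 + ∑ i, D.L i ^ 2) * (infNorm k : ℝ) ^ 2 := by
    have := D.kLsq_le k
    have h2 : (1 : ℝ) ≤ (infNorm k : ℝ) ^ 2 := one_le_pow₀ hn
    unfold theta
    nlinarith
  have h3 : D.theta k ^ D.p ≤ (1 + ∑ i, D.L i ^ 2) ^ D.p * (infNorm k : ℝ) ^ (2 * D.p) := by
    rw [pow_mul, ← mul_pow]
    exact pow_le_pow_left₀ (D.theta_pos k).le h1 _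
  change _ ≤ ENNReal.ofReal _ * _
  rw [wt, ← ENNReal.ofReal_mul (by positivity)]
  refine ENNReal.ofReal_le_ofReal ?_
  change (D.omega k : ℝ) / (infNorm k : ℝ) ^ (2 * D.p) ≤ _
  have ht := D.theta_pos k
  have ho := (D.omega k).2
  rw [zpow_neg, zpow_natCast, div_le_iff₀ (by positivity)]
  calc (D.omega k : ℝ) = D.omega k * (D.theta k ^ D.p)⁻¹ * D.theta k ^ D.p := by field_simp
    _ ≤ D.omega k * (D.theta k ^ D.p)⁻¹ *
        ((1 + ∑ i, D.L i ^ 2) ^ D.p * (infNorm k : ℝ) ^ (2 * D.p)) := by gcongr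
    _ = _ := by ring

theorem exists_infNorm_sq_le : ∃ C : ℝ, 0 < C ∧ ∀ k, (infNorm k : ℝ) ^ 2 ≤ C * D.theta k := by
  have hC : 0 ≤ ∑ i, (D.L i ^ 2)⁻¹ := Finset.sum_nonneg fun i _ => inv_nonneg.2 (sq_nonneg _)
  refine ⟨1 + ∑ i, (D.L i ^ 2)⁻¹, by linarith, fun k => ?_⟩
  have ht := D.one_le_theta k
  have hk := D.kLsq_nonneg k
  have hcase : infNorm k = 1 ∨ ∃ i, infNorm k = k i := by
    unfold infNorm
    rcases le_total (Finset.univ.sup k) 1 with h | h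
    · exact Or.inl (max_eq_left h)
    · right
      rw [max_eq_right h]
      rcases (Finset.univ : Finset (Fin d)).eq_empty_or_nonempty with h0 | h0
      · simp [h0] at h
      · obtain ⟨i, -, hi⟩ := Finset.exists_mem_eq_sup _ h0 k
        exact ⟨i, hi⟩
  rcases hcase with h | ⟨i, h⟩
  · rw [h]
    have := mul_nonneg hC (D.theta_pos k).le
    push_cast
    nlinarith
  · rw [h]
    have hL := D.L_pos i
    have h1 : ((k i : ℝ) * D.L i) ^ 2 ≤ D.kLsq k :=
      Finset.single_le_sum (f := fun i => ((k i : ℝ) * D.L i) ^ 2)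
        (fun j _ => sq_nonneg _) (Finset.mem_univ i)
    have h2 : (D.L i ^ 2)⁻¹ ≤ ∑ i, (D.L i ^ 2)⁻¹ :=
      Finset.single_le_sum (f := fun i => (D.L i ^ 2)⁻¹)
        (fun j _ => inv_nonneg.2 (sq_nonneg _)) (Finset.mem_univ i)
    calc (k i : ℝ) ^ 2 = (D.L i ^ 2)⁻¹ * ((k i : ℝ) * D.L i) ^ 2 := by field_simp
      _ ≤ (∑ i, (D.L i ^ 2)⁻¹) * D.theta k := by
        refine mul_le_mul h2 (h1.trans ?_) (sq_nonneg _) hC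
        unfold theta; linarith
      _ ≤ _ := by nlinarith [D.theta_pos k]

theorem exists_le_omegaNeg : ∃ C : ℝ≥0, ∀ k,
    D.wt (-D.p) k ≤ C * ENNReal.ofReal (D.omegaNeg k) := by
  obtain ⟨C, hC, h⟩ := D.exists_infNorm_sq_le
  refine ⟨(C ^ D.p).toNNReal, fun k => ?_⟩
  have h3 : (infNorm k : ℝ) ^ (2 * D.p) ≤ C ^ D.p * D.theta k ^ D.p := by
    rw [pow_mul, ← mul_pow]
    exact pow_le_pow_left₀ (by positivity) (h k) _
  change _ ≤ ENNReal.ofReal _ * _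
  rw [wt, ← ENNReal.ofReal_mul (by positivity)]
  refine ENNReal.ofReal_le_ofReal ?_
  change _ ≤ C ^ D.p * ((D.omega k : ℝ) / (infNorm k : ℝ) ^ (2 * D.p))
  have ht := D.theta_pos k
  have ho := (D.omega k).2
  have hn := one_pos.trans_le (one_le_infNorm k)
  rw [← mul_div_assoc, le_div_iff₀ (by positivity), zpow_neg, zpow_natCast]
  calc _ ≤ D.omega k * (D.theta k ^ D.p)⁻¹ * (C ^ D.p * D.theta k ^ D.p) := by gcongr
    _ = _ := by field_simp

theorem exists_enrm_le_enorm_ellNeg : ∃ C : ℝ≥0, ∀ a : D.EllNeg, D.enrm (-D.p) a ≤ C * ‖a‖ₑ := by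
  obtain ⟨C, h⟩ := D.exists_le_omegaNeg
  refine ⟨C, fun a => ?_⟩
  rw [Ell1.enorm_eq, ← ENNReal.tsum_mul_left]
  refine ENNReal.tsum_le_tsum fun k => ?_
  rw [← mul_assoc]
  exact mul_le_mul_left (h k) _

theorem enrm_ellNeg_ne_top (a : D.EllNeg) : D.enrm (-D.p) a ≠ ∞ := by
  obtain ⟨C, h⟩ := D.exists_enrm_le_enorm_ellNeg
  exact ne_top_of_le_ne_top (ENNReal.mul_ne_top ENNReal.coe_ne_top enorm_ne_top) (h a)

theorem summable_omegaNeg {a : (Fin d → ℕ) → ℝ} (h : D.enrm (-D.p) a ≠ ∞) :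
    Summable fun k => |a k| * (D.omegaNeg k : ℝ) := by
  obtain ⟨C, hC⟩ := D.exists_omegaNeg_le
  change a ∈ ell1Submodule D.omegaNeg
  rw [Ell1.mem_iff]
  refine ne_top_of_le_ne_top (ENNReal.mul_ne_top (ENNReal.coe_ne_top (r := C)) h) ?_
  rw [enrm, ← ENNReal.tsum_mul_left]
  refine ENNReal.tsum_le_tsum fun k => ?_
  rw [← mul_assoc]
  exact mul_le_mul_left (hC k) _

/-- Induction on the dimension, splitting off the first coordinate; in `[0, ∞]` no convergence is
needed. -/
theorem _root_.ParabolicIVP.tsum_pi_prod (f : ℕ → ℝ≥0∞) :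
    ∀ n : ℕ, ∑' k : Fin n → ℕ, ∏ i, f (k i) = (∑' x, f x) ^ n
  | 0 => by simp
  | n + 1 => by
    rw [← (Fin.consEquiv (fun _ : Fin (n + 1) => ℕ)).tsum_eq, ENNReal.tsum_prod']
    simp only [Fin.consEquiv_apply, Fin.prod_univ_succ, Fin.cons_zero, Fin.cons_succ]
    simp only [ENNReal.tsum_mul_left, tsum_pi_prod f n, ENNReal.tsum_mul_right]
    rw [pow_succ, mul_comm]

/-- `∑_k θ_k^{-m}` converges for large `m`. -/
theorem exists_tsum_theta_ne_top : ∃ m : ℕ,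
    ∑' k, ENNReal.ofReal (D.theta k ^ (-(m : ℤ))) ≠ ∞ := by
  obtain ⟨C, hC, h⟩ := D.exists_infNorm_sq_le
  -- `θ_k^{-d}` is split into `d` factors, one for each coordinate. Each is at most `4C / (k_i +
  -- 1)²`, because `(k_i + 1)² ≤ (2 |k|_∞)² ≤ 4 C θ_k`.
  refine ⟨d, ?_⟩
  have hs : Summable fun x : ℕ => 4 * C * (((x : ℝ) + 1) ^ 2)⁻¹ := by
    have h1 : Summable fun x : ℕ => (((x : ℝ)) ^ 2)⁻¹ :=
      Real.summable_nat_pow_inv.2 one_lt_two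
    have := (summable_nat_add_iff 1).2 h1
    refine (this.mul_left (4 * C)).congr fun x => ?_
    push_cast; rfl
  have hf := hs.tsum_ofReal_ne_top
  refine ne_top_of_le_ne_top (ENNReal.pow_ne_top hf (n := d)) ?_
  rw [← tsum_pi_prod]
  refine ENNReal.tsum_le_tsum fun k => ?_
  rw [← ENNReal.ofReal_prod_of_nonneg (fun i _ => by positivity)]
  refine ENNReal.ofReal_le_ofReal ?_
  have h1 : ∀ i, (D.theta k)⁻¹ ≤ 4 * C * (((k i : ℝ) + 1) ^ 2)⁻¹ := by
    intro i
    have ht := D.theta_pos k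
    have hk : ((k i : ℝ) + 1) ^ 2 ≤ 4 * C * D.theta k := by
      have h2 : (k i : ℝ) ≤ infNorm k := by
        exact_mod_cast le_trans (Finset.le_sup (f := k) (Finset.mem_univ i)) (le_max_right _ _)
      have h3 := one_le_infNorm k
      have h4 : ((k i : ℝ) + 1) ^ 2 ≤ (2 * (infNorm k : ℝ)) ^ 2 := by
        gcongr; linarith
      nlinarith [h k]
    rw [inv_le_iff_one_le_mul₀ ht]
    have : 0 < ((k i : ℝ) + 1) ^ 2 := by positivity
    calc (1 : ℝ) = (((k i : ℝ) + 1) ^ 2)⁻¹ * ((k i : ℝ) + 1) ^ 2 := by field_simp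
      _ ≤ (((k i : ℝ) + 1) ^ 2)⁻¹ * (4 * C * D.theta k) := by gcongr
      _ = _ := by ring
  calc D.theta k ^ (-(d : ℤ)) = ∏ _i : Fin d, (D.theta k)⁻¹ := by simp
    _ ≤ _ := Finset.prod_le_prod (fun i _ => (inv_pos.2 (D.theta_pos k)).le) fun i _ => h1 i

/-! ### Parabolicity -/

/-- The only place where the fields `parabolic` and `semilinear` are used. The exponent is `p + 1`,
one more than the order of `𝒬` in powers of `θ`. -/
theorem exists_parabolic : ∃ c Λ : ℝ, 0 < c ∧ 0 ≤ Λ ∧ ∀ k,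
    c * D.theta k ^ (D.p + 1) + D.mu k ≤ Λ := by
  have hp := D.p_le_one
  rcases D.parabolic with h2 | ⟨h2, h1⟩
  · -- fourth order
    set l := -D.lam2 with hl
    have hl0 : 0 < l := by linarith
    refine ⟨l / 4, |D.lam0| + l + D.lam1 ^ 2 / l, by positivity, by positivity, fun k => ?_⟩
    have hx := D.kLsq_nonneg k
    have hth : D.theta k ^ (D.p + 1) ≤ (1 + D.kLsq k) ^ 2 :=
      pow_le_pow_right₀ (D.one_le_theta k) (by omega)
    have h0 := le_abs_self D.lam0
    have hmu : D.mu k = D.lam0 - D.lam1 * D.kLsq k - l * D.kLsq k ^ 2 := by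
      rw [mu, hl]; ring
    -- Young's inequality, by completing the square: the second-order term costs a quarter of `l
    -- (kL)⁴`. The claimed `l/4 · (1 + (kL)²)²` costs at most half of it plus a constant.
    have hyoung : -D.lam1 * D.kLsq k ≤ D.lam1 ^ 2 / l + l / 4 * D.kLsq k ^ 2 := by
      have e : D.lam1 ^ 2 / l + l / 4 * D.kLsq k ^ 2 - -D.lam1 * D.kLsq k
          = (D.lam1 + l / 2 * D.kLsq k) ^ 2 / l := by field_simp; ring
      have : 0 ≤ (D.lam1 + l / 2 * D.kLsq k) ^ 2 / l := by positivity
      linarith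
    have h3 : l / 4 * D.theta k ^ (D.p + 1) ≤ l / 4 * (1 + D.kLsq k) ^ 2 := by gcongr
    rw [hmu]
    nlinarith [sq_nonneg (D.kLsq k - 1), mul_nonneg hl0.le (sq_nonneg (D.kLsq k - 1))]
  · have hp0 : D.p = 0 := by
      by_contra h
      have := D.semilinear (by omega)
      linarith
    refine ⟨D.lam1, |D.lam0| + D.lam1, h1, by positivity, fun k => ?_⟩
    have h0 := le_abs_self D.lam0
    rw [hp0, mu, h2, theta]
    simp only [zero_add, pow_one, zero_mul]
    linarith

/-- The parabolicity constant. -/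
def cPar : ℝ := D.exists_parabolic.choose

/-- An upper bound of the symbol `μ`. -/
def Lam : ℝ := D.exists_parabolic.choose_spec.choose

theorem cPar_pos : 0 < D.cPar := D.exists_parabolic.choose_spec.choose_spec.1

theorem Lam_nonneg : 0 ≤ D.Lam := D.exists_parabolic.choose_spec.choose_spec.2.1

theorem cPar_mul_le (k : Fin d → ℕ) : D.cPar * D.theta k ^ (D.p + 1) ≤ D.Lam - D.mu k := by
  have := D.exists_parabolic.choose_spec.choose_spec.2.2 k
  unfold cPar Lam
  linarith

theorem mu_le (k : Fin d → ℕ) : D.mu k ≤ D.Lam := by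
  have := D.cPar_mul_le k
  have h2 : 0 < D.cPar * D.theta k ^ (D.p + 1) := mul_pos D.cPar_pos (pow_pos (D.theta_pos k) _)
  linarith

/-- `|μ_k|` grows at most like `θ_k²`. -/
theorem exists_abs_mu_le : ∃ C : ℝ, 0 ≤ C ∧ ∀ k, |D.mu k| ≤ C * D.theta k ^ 2 := by
  refine ⟨|D.lam0| + |D.lam1| + |D.lam2|, by positivity, fun k => ?_⟩
  have hx := D.kLsq_nonneg k
  have h1 : 1 ≤ D.theta k ^ 2 := one_le_pow₀ (D.one_le_theta k)
  have h2 : D.kLsq k ≤ D.theta k ^ 2 := by unfold theta; nlinarith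
  have h3 : D.kLsq k ^ 2 ≤ D.theta k ^ 2 := by unfold theta; nlinarith
  calc |D.mu k| ≤ |D.lam0| + |D.lam1| * D.kLsq k + |D.lam2| * D.kLsq k ^ 2 := by
        unfold mu
        refine (abs_add_le _ _).trans ?_
        rw [abs_mul, abs_of_nonneg (sq_nonneg (D.kLsq k))]
        gcongr
        refine (abs_sub _ _).trans ?_
        rw [abs_mul, abs_of_nonneg hx]
    _ ≤ |D.lam0| * D.theta k ^ 2 + |D.lam1| * D.theta k ^ 2 + |D.lam2| * D.theta k ^ 2 := by
        gcongr
        nlinarith [abs_nonneg D.lam0]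
    _ = _ := by ring

/-- The resolvent absorbs `𝒬` with an arbitrarily small constant. -/
theorem exists_resolvent_small (η : ℝ) (hη : 0 < η) : ∃ l₀ : ℝ, ∀ l ≥ l₀, D.Lam < l ∧
    ∀ k, |D.kap k| ≤ η * (l - D.mu k) := by
  have hc := D.cPar_pos
  -- The threshold is `θ = 1/(η c)`. Above it, `η c θ^(p+1)` already dominates `θ^p`; below it, `θ^p
  -- ≤ (1/(η c))^p`, which the last summand of `l₀` pays for.
  refine ⟨D.Lam + 1 + η⁻¹ * (1 / (η * D.cPar)) ^ D.p, fun l hl => ?_⟩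
  have hpos : 0 ≤ η⁻¹ * (1 / (η * D.cPar)) ^ D.p := by positivity
  refine ⟨by linarith, fun k => (D.abs_kap_le k).trans ?_⟩
  have ht := D.theta_pos k
  have h1 : D.cPar * D.theta k ^ (D.p + 1) + η⁻¹ * (1 / (η * D.cPar)) ^ D.p ≤ l - D.mu k := by
    have := D.cPar_mul_le k
    linarith
  refine le_trans ?_ (mul_le_mul_of_nonneg_left h1 hη.le)
  have e : η * (D.cPar * D.theta k ^ (D.p + 1) + η⁻¹ * (1 / (η * D.cPar)) ^ D.p)
      = (η * D.cPar * D.theta k) * D.theta k ^ D.p + (1 / (η * D.cPar)) ^ D.p := by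
    field_simp; ring
  rw [e]
  rcases le_total (1 / (η * D.cPar)) (D.theta k) with h | h
  · have h2 : 1 ≤ η * D.cPar * D.theta k := by
      rw [div_le_iff₀ (by positivity)] at h; linarith
    have h3 : 0 ≤ (1 / (η * D.cPar)) ^ D.p := by positivity
    nlinarith [pow_pos ht D.p]
  · have h3 : D.theta k ^ D.p ≤ (1 / (η * D.cPar)) ^ D.p := pow_le_pow_left₀ ht.le h _
    have : 0 ≤ η * D.cPar * D.theta k * D.theta k ^ D.p := by positivity
    linarith

end Setting

/-! ### Reindexing over integer multi-indices -/

section Reindex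

variable {d : ℕ}

theorem absIdx_neg (j : Fin d → ℤ) : absIdx (-j) = absIdx j := by
  funext i; simp [absIdx]

theorem absIdx_natCast (k : Fin d → ℕ) : absIdx (fun i => (k i : ℤ)) = k := by
  funext i; simp [absIdx]

/-- The integer multi-indices with given component-wise absolute value. -/
def absFiber (k : Fin d → ℕ) : Finset (Fin d → ℤ) :=
  Fintype.piFinset fun i => ({(k i : ℤ), -(k i : ℤ)} : Finset ℤ)

theorem mem_absFiber {k : Fin d → ℕ} {j : Fin d → ℤ} : j ∈ absFiber k ↔ absIdx j = k := by
  simp only [absFiber, Fintype.mem_piFinset, Finset.mem_insert, Finset.mem_singleton, absIdx,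
    funext_iff]
  refine forall_congr' fun i => ?_
  omega

theorem card_absFiber (k : Fin d → ℕ) : ((absFiber k).card : ℝ) = alpha k := by
  rw [absFiber, Fintype.card_piFinset, alpha, Nat.cast_prod]
  refine Finset.prod_congr rfl fun i _ => ?_
  split_ifs with h
  · simp [h]
  · rw [Finset.card_pair (by omega)]
    norm_num

theorem coe_absFiber (k : Fin d → ℕ) : (absIdx ⁻¹' {k} : Set (Fin d → ℤ)) = ↑(absFiber k) := by
  ext j
  simp [mem_absFiber]

/-- The fibre of `|·|` over `k` has `α_k` elements. The factor `α_k` in `ω_k` is thus a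
multiplicity, and the norm is a sum over `ℤ^d` with weight `ν^|j|`. -/
theorem tsum_absIdx (F : (Fin d → ℕ) → ℝ≥0∞) :
    ∑' j : Fin d → ℤ, F (absIdx j) = ∑' k, ENNReal.ofReal (alpha k) * F k := by
  rw [← ENNReal.tsum_fiberwise _ absIdx]
  refine tsum_congr fun k => ?_
  rw [coe_absFiber, Finset.tsum_subtype' (absFiber k) (fun j => F (absIdx j)),
    Finset.sum_congr rfl (fun j hj => by rw [mem_absFiber.1 hj]), Finset.sum_const,
    ← card_absFiber, ENNReal.ofReal_natCast, nsmul_eq_mul]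

/-- Change of signs that makes `j` non-negative. -/
def flipFun (j l : Fin d → ℤ) : Fin d → ℤ := fun i => if 0 ≤ j i then l i else -l i

/-- `flipFun` as an equivalence. -/
def flipEquiv (j : Fin d → ℤ) : (Fin d → ℤ) ≃ (Fin d → ℤ) :=
  Function.Involutive.toPerm (flipFun j) fun l => by
    funext i
    simp only [flipFun]
    split_ifs <;> simp

theorem absIdx_flipEquiv (j l : Fin d → ℤ) : absIdx (flipEquiv j l) = absIdx l := by
  funext i
  change (flipFun j l i).natAbs = (l i).natAbs
  unfold flipFun
  split_ifs <;> simp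

theorem absIdx_sub_flipEquiv (j l : Fin d → ℤ) :
    absIdx (fun i => (absIdx j i : ℤ) - flipEquiv j l i) = absIdx (j - l) := by
  funext i
  change (((j i).natAbs : ℤ) - flipFun j l i).natAbs = (j i - l i).natAbs
  unfold flipFun
  split_ifs <;> omega

/-- Flipping signs in the summation index carries `|j|` to `j`. Hence `convSeq` is the ordinary
convolution on `ℤ^d` of the even extensions. -/
theorem convSeq_absIdx (a b : (Fin d → ℕ) → ℝ) (j : Fin d → ℤ) :
    convSeq a b (absIdx j) = ∑' l, a (absIdx l) * b (absIdx (j - l)) := by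
  unfold convSeq
  rw [← (flipEquiv j).tsum_eq]
  refine tsum_congr fun l => ?_
  rw [absIdx_flipEquiv, absIdx_sub_flipEquiv]

theorem convSeq_eq (a b : (Fin d → ℕ) → ℝ) (k : Fin d → ℕ) :
    convSeq a b k = ∑' l, a (absIdx l) * b (absIdx ((fun i => (k i : ℤ)) - l)) := by
  rw [← convSeq_absIdx, absIdx_natCast]

theorem convSeq_comm (a b : (Fin d → ℕ) → ℝ) : convSeq a b = convSeq b a := by
  funext k
  rw [convSeq_eq, convSeq_eq, ← (Equiv.subLeft (fun i => (k i : ℤ))).tsum_eq]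
  refine tsum_congr fun l => ?_
  rw [Equiv.subLeft_apply, sub_sub_cancel, mul_comm]

end Reindex

namespace Setting

variable {d : ℕ} (D : Setting d)

/-- The weight `ν^|j| θ_{|j|}^m` on integer multi-indices. -/
def zwt (m : ℤ) (j : Fin d → ℤ) : ℝ≥0∞ :=
  ENNReal.ofReal (D.zWeight j * D.theta (absIdx j) ^ m)

theorem enrm_eq (m : ℤ) (a : (Fin d → ℕ) → ℝ) :
    D.enrm m a = ∑' j : Fin d → ℤ, D.zwt m j * ‖a (absIdx j)‖ₑ := by
  have h := tsum_absIdx (d := d)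
    fun k => ENNReal.ofReal (D.nu ^ (∑ i, k i) * D.theta k ^ m) * ‖a k‖ₑ
  refine Eq.trans ?_ h.symm
  refine tsum_congr fun k => ?_
  rw [wt, ← mul_assoc, ← ENNReal.ofReal_mul (one_pos.trans_le (one_le_alpha k)).le, ← mul_assoc]
  rfl

theorem theta_absIdx (j : Fin d → ℤ) : D.theta (absIdx j) = 1 + ∑ i, ((j i : ℝ) * D.L i) ^ 2 := by
  unfold theta kLsq absIdx
  congr 1
  refine Finset.sum_congr rfl fun i _ => ?_
  have : (((j i).natAbs : ℕ) : ℝ) = |(j i : ℝ)| := by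
    rw [← Int.cast_abs, Int.abs_eq_natAbs]; simp
  rw [this, mul_pow, mul_pow, sq_abs]

theorem theta_add_le (j l : Fin d → ℤ) :
    D.theta (absIdx (j + l)) ≤ 2 * (D.theta (absIdx j) + D.theta (absIdx l)) - 2 := by
  simp only [theta_absIdx]
  have : ∑ i, (((j + l) i : ℤ) * D.L i : ℝ) ^ 2
      ≤ ∑ i, (2 * ((j i : ℝ) * D.L i) ^ 2 + 2 * ((l i : ℝ) * D.L i) ^ 2) := by
    refine Finset.sum_le_sum fun i _ => ?_
    rw [Pi.add_apply]
    push_cast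
    nlinarith [sq_nonneg ((j i : ℝ) * D.L i - (l i : ℝ) * D.L i)]
  rw [Finset.sum_add_distrib, ← Finset.mul_sum, ← Finset.mul_sum] at this
  linarith

theorem theta_add_le_mul (j l : Fin d → ℤ) :
    D.theta (absIdx (j + l)) ≤ 2 * D.theta (absIdx j) * D.theta (absIdx l) := by
  have h := D.theta_add_le j l
  nlinarith [mul_nonneg (sub_nonneg.2 (D.one_le_theta (absIdx j)))
    (sub_nonneg.2 (D.one_le_theta (absIdx l)))]

/-- Peetre's inequality. For negative `m` it comes from `n = (l + n) - l`; the first factor carries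
the weight `|m|`, so multiplication by a fixed smooth kernel is bounded in every norm. -/
theorem zwt_add_le (m : ℤ) (l n : Fin d → ℤ) :
    D.zwt m (l + n) ≤ ENNReal.ofReal (2 ^ m.natAbs) * (D.zwt m.natAbs l * D.zwt m n) := by
  have hz := D.zWeight_add_le l n
  have hz1 := D.zWeight_nonneg l
  have hz2 := D.zWeight_nonneg n
  have t1 := D.theta_pos (absIdx l)
  have t2 := D.theta_pos (absIdx n)
  have t3 := D.theta_pos (absIdx (l + n))
  unfold zwt
  rw [← ENNReal.ofReal_mul (by positivity), ← ENNReal.ofReal_mul (by positivity)]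
  refine ENNReal.ofReal_le_ofReal ?_
  have key : D.theta (absIdx (l + n)) ^ m
      ≤ 2 ^ m.natAbs * D.theta (absIdx l) ^ (m.natAbs : ℤ) * D.theta (absIdx n) ^ m := by
    obtain ⟨q, rfl | rfl⟩ := m.eq_nat_or_neg
    · rw [Int.natAbs_natCast, zpow_natCast, zpow_natCast, zpow_natCast, ← mul_pow, ← mul_pow]
      exact pow_le_pow_left₀ t3.le (D.theta_add_le_mul l n) _
    · rw [Int.natAbs_neg, Int.natAbs_natCast, zpow_neg, zpow_neg, zpow_natCast, zpow_natCast,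
        zpow_natCast, ← inv_pow, ← inv_pow, ← mul_pow, ← mul_pow]
      refine pow_le_pow_left₀ (inv_pos.2 t3).le ?_ _
      have h := D.theta_add_le_mul (l + n) (-l)
      rw [add_neg_cancel_comm, absIdx_neg] at h
      rw [inv_le_iff_one_le_mul₀ t3, ← div_eq_mul_inv, div_mul_eq_mul_div, le_div_iff₀ t2]
      linarith
  calc D.zWeight (l + n) * D.theta (absIdx (l + n)) ^ m
      ≤ (D.zWeight l * D.zWeight n) *
        (2 ^ m.natAbs * D.theta (absIdx l) ^ (m.natAbs : ℤ) * D.theta (absIdx n) ^ m) :=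
        mul_le_mul hz key (by positivity) (by positivity)
    _ = _ := by ring

/-- The larger of the two frequencies carries the whole weight, as `θ_{l+n} ≤ 2(θ_l + θ_n) ≤ 4
max(θ_l, θ_n)`. -/
theorem zwt_add_le_add (m : ℕ) (l n : Fin d → ℤ) :
    D.zwt m (l + n) ≤ ENNReal.ofReal (4 ^ m) * (D.zwt m l * D.zwt 0 n + D.zwt 0 l * D.zwt m n) := by
  have hz := D.zWeight_add_le l n
  have hz1 := D.zWeight_nonneg l
  have hz2 := D.zWeight_nonneg n
  have t1 := D.theta_pos (absIdx l)
  have t2 := D.theta_pos (absIdx n)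
  have t3 := D.theta_pos (absIdx (l + n))
  unfold zwt
  rw [← ENNReal.ofReal_mul (by positivity), ← ENNReal.ofReal_mul (by positivity),
    ← ENNReal.ofReal_add (by positivity) (by positivity), ← ENNReal.ofReal_mul (by positivity)]
  refine ENNReal.ofReal_le_ofReal ?_
  simp only [zpow_natCast, zpow_zero, mul_one]
  have h := D.theta_add_le l n
  have key : D.theta (absIdx (l + n)) ^ m
      ≤ 4 ^ m * (D.theta (absIdx l) ^ m + D.theta (absIdx n) ^ m) := by
    have p1 := pow_pos t1 m
    have p2 := pow_pos t2 m
    rcases le_total (D.theta (absIdx l)) (D.theta (absIdx n)) with hc | hc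
    · calc _ ≤ (4 * D.theta (absIdx n)) ^ m := pow_le_pow_left₀ t3.le (by linarith) _
        _ = 4 ^ m * D.theta (absIdx n) ^ m := mul_pow _ _ _
        _ ≤ _ := by gcongr; linarith
    · calc _ ≤ (4 * D.theta (absIdx l)) ^ m := pow_le_pow_left₀ t3.le (by linarith) _
        _ = 4 ^ m * D.theta (absIdx l) ^ m := mul_pow _ _ _
        _ ≤ _ := by gcongr; linarith
  calc D.zWeight (l + n) * D.theta (absIdx (l + n)) ^ m
      ≤ (D.zWeight l * D.zWeight n) *
        (4 ^ m * (D.theta (absIdx l) ^ m + D.theta (absIdx n) ^ m)) :=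
        mul_le_mul hz key (by positivity) (by positivity)
    _ = _ := by ring

theorem enrm_convSeq_le_tsum (m : ℤ) (a b : (Fin d → ℕ) → ℝ) :
    D.enrm m (convSeq a b) ≤ ∑' l : Fin d → ℤ, ∑' n : Fin d → ℤ,
      D.zwt m (l + n) * (‖a (absIdx l)‖ₑ * ‖b (absIdx n)‖ₑ) := by
  rw [enrm_eq]
  calc _ ≤ ∑' j : Fin d → ℤ, ∑' l : Fin d → ℤ,
        D.zwt m j * (‖a (absIdx l)‖ₑ * ‖b (absIdx (j - l))‖ₑ) := by
        refine ENNReal.tsum_le_tsum fun j => ?_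
        rw [ENNReal.tsum_mul_left]
        refine mul_le_mul_right ?_ _
        rw [convSeq_absIdx]
        refine enorm_tsum_le_tsum_enorm.trans (le_of_eq ?_)
        exact tsum_congr fun l => enorm_mul _ _
    _ = _ := by
        rw [ENNReal.tsum_comm]
        refine tsum_congr fun l => ?_
        rw [← (Equiv.addLeft l).tsum_eq]
        refine tsum_congr fun n => ?_
        simp

theorem enrm_convSeq_le (m : ℤ) (a b : (Fin d → ℕ) → ℝ) :
    D.enrm m (convSeq a b) ≤ ENNReal.ofReal (2 ^ m.natAbs) * (D.enrm m.natAbs a * D.enrm m b) := by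
  refine (D.enrm_convSeq_le_tsum m a b).trans ?_
  rw [D.enrm_eq m b, D.enrm_eq _ a, ← ENNReal.tsum_mul_right, ← ENNReal.tsum_mul_left]
  refine ENNReal.tsum_le_tsum fun l => ?_
  rw [← ENNReal.tsum_mul_left, ← ENNReal.tsum_mul_left]
  refine ENNReal.tsum_le_tsum fun n => ?_
  calc _ ≤ ENNReal.ofReal (2 ^ m.natAbs) * (D.zwt m.natAbs l * D.zwt m n)
        * (‖a (absIdx l)‖ₑ * ‖b (absIdx n)‖ₑ) := mul_le_mul_left (D.zwt_add_le m l n) _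
    _ = _ := by ring

theorem enrm_zero_convSeq_le (a b : (Fin d → ℕ) → ℝ) :
    D.enrm 0 (convSeq a b) ≤ D.enrm 0 a * D.enrm 0 b := by
  simpa using D.enrm_convSeq_le 0 a b

/-- A tame estimate, linear in the strong norm. It lets the bootstrap run for the nonlinear
equation, where only the `ℓ¹_ω` norm is bounded beforehand. -/
theorem enrm_convSeq_le_add (m : ℕ) (a b : (Fin d → ℕ) → ℝ) :
    D.enrm m (convSeq a b)
      ≤ ENNReal.ofReal (4 ^ m) * (D.enrm m a * D.enrm 0 b + D.enrm 0 a * D.enrm m b) := by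
  refine (D.enrm_convSeq_le_tsum m a b).trans ?_
  simp only [D.enrm_eq _ b, D.enrm_eq _ a]
  rw [← ENNReal.tsum_mul_right, ← ENNReal.tsum_mul_right, ← ENNReal.tsum_add,
    ← ENNReal.tsum_mul_left]
  refine ENNReal.tsum_le_tsum fun l => ?_
  rw [← ENNReal.tsum_mul_left, ← ENNReal.tsum_mul_left, ← ENNReal.tsum_add,
    ← ENNReal.tsum_mul_left]
  refine ENNReal.tsum_le_tsum fun n => ?_
  calc _ ≤ ENNReal.ofReal (4 ^ m) * (D.zwt m l * D.zwt 0 n + D.zwt 0 l * D.zwt m n)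
        * (‖a (absIdx l)‖ₑ * ‖b (absIdx n)‖ₑ) := mul_le_mul_left (D.zwt_add_le_add m l n) _
    _ = _ := by ring

/-! ### The convolution algebra -/

theorem one_le_zWeight (j : Fin d → ℤ) : 1 ≤ D.zWeight j := one_le_pow₀ D.one_le_nu

theorem one_le_omega (k : Fin d → ℕ) : 1 ≤ (D.omega k : ℝ) :=
  one_le_mul_of_one_le_of_one_le (one_le_alpha k) (one_le_pow₀ D.one_le_nu)

theorem abs_apply_le_norm (a : D.Ell) (k : Fin d → ℕ) : |a k| ≤ ‖a‖ :=
  (Ell1.abs_apply_le a k).trans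
    (mul_le_of_le_one_left (norm_nonneg _) (inv_le_one_of_one_le₀ (D.one_le_omega k)))

theorem summable_absIdx (a : D.Ell) : Summable fun j : Fin d → ℤ => |a (absIdx j)| :=
  Summable.of_nonneg_of_le (fun _ => abs_nonneg _)
    (fun j => le_mul_of_one_le_right (abs_nonneg _) (D.one_le_zWeight j)) (D.summable_zWeight a)

theorem summable_conv (a b : D.Ell) (j : Fin d → ℤ) :
    Summable fun l : Fin d → ℤ => a (absIdx l) * b (absIdx (j - l)) := by
  refine Summable.of_norm_bounded ((D.summable_absIdx a).mul_right ‖b‖) fun l => ?_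
  rw [Real.norm_eq_abs, abs_mul]
  exact mul_le_mul_of_nonneg_left (D.abs_apply_le_norm b _) (abs_nonneg _)

theorem conv_apply (a b : D.Ell) (k : Fin d → ℕ) : D.conv a b k = convSeq a b k := rfl

theorem conv_comm (a b : D.Ell) : D.conv a b = D.conv b a := by
  ext k; exact congrFun (convSeq_comm _ _) k

theorem conv_add_right (a b c : D.Ell) : D.conv a (b + c) = D.conv a b + D.conv a c := by
  ext k
  rw [Ell1.add_apply, conv_apply, conv_apply, conv_apply, convSeq_eq, convSeq_eq, convSeq_eq,
    ← (D.summable_conv a b _).tsum_add (D.summable_conv a c _)]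
  exact tsum_congr fun l => by rw [Ell1.add_apply, mul_add]

theorem conv_smul_right (r : ℝ) (a b : D.Ell) : D.conv a (r • b) = r • D.conv a b := by
  ext k
  rw [Ell1.smul_apply, conv_apply, conv_apply, convSeq_eq, convSeq_eq, ← tsum_mul_left]
  exact tsum_congr fun l => by rw [Ell1.smul_apply]; ring

theorem norm_conv_le (a b : D.Ell) : ‖D.conv a b‖ ≤ ‖a‖ * ‖b‖ := by
  have h := D.enrm_zero_convSeq_le a b
  rw [← enorm_ell, ← enorm_ell] at h
  have h2 : ‖D.conv a b‖ₑ ≤ ‖a‖ₑ * ‖b‖ₑ := by rw [enorm_ell]; exact h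
  rw [← toReal_enorm, ← toReal_enorm a, ← toReal_enorm b, ← ENNReal.toReal_mul]
  exact ENNReal.toReal_mono (ENNReal.mul_ne_top enorm_ne_top enorm_ne_top) h2

/-- The convolution as a continuous bilinear map. -/
def convL : D.Ell →L[ℝ] D.Ell →L[ℝ] D.Ell :=
  LinearMap.mkContinuous₂
    (LinearMap.mk₂ ℝ D.conv
      (fun a b c => by rw [D.conv_comm, conv_add_right, D.conv_comm c a, D.conv_comm c b])
      (fun r a b => by rw [D.conv_comm, conv_smul_right, D.conv_comm])
      D.conv_add_right (fun r a b => D.conv_smul_right r a b)) 1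
    fun a b => by rw [one_mul]; exact D.norm_conv_le a b

@[simp] theorem convL_apply (a b : D.Ell) : D.convL a b = D.conv a b := rfl

/-- Shift the inner index and apply Fubini's theorem. Associativity is what makes the derivative of
a convolution power a convolution with a single sequence. -/
theorem conv_assoc (a b c : D.Ell) : D.conv (D.conv a b) c = D.conv a (D.conv b c) := by
  ext k
  set z : Fin d → ℤ := fun i => (k i : ℤ) with hz
  rw [conv_apply, conv_apply, convSeq_eq, convSeq_eq]
  have e1 : ∀ l : Fin d → ℤ, D.conv a b (absIdx l) * c (absIdx (z - l))
      = ∑' n, a (absIdx n) * b (absIdx (l - n)) * c (absIdx (z - l)) := fun l => by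
    rw [conv_apply, convSeq_absIdx, tsum_mul_right]
  have e2 : ∀ n : Fin d → ℤ, a (absIdx n) * D.conv b c (absIdx (z - n))
      = ∑' l, a (absIdx n) * b (absIdx (l - n)) * c (absIdx (z - l)) := fun n => by
    rw [conv_apply, convSeq_absIdx, ← tsum_mul_left, ← (Equiv.subRight n).tsum_eq]
    refine tsum_congr fun l => ?_
    rw [Equiv.subRight_apply, sub_sub_sub_cancel_right, mul_assoc]
  refine (tsum_congr e1).trans (Eq.trans ?_ (tsum_congr e2).symm)
  refine Summable.tsum_comm ?_
  have hab := (D.summable_absIdx a).mul_of_nonneg (D.summable_absIdx b)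
    (fun _ => abs_nonneg _) (fun _ => abs_nonneg _)
  have hinj : Function.Injective
      (fun x : (Fin d → ℤ) × (Fin d → ℤ) => (x.1, x.2 - x.1)) := by
    rintro ⟨x, y⟩ ⟨x', y'⟩ h
    simp only [Prod.mk.injEq] at h
    obtain ⟨rfl, h2⟩ := h
    simpa using h2
  refine Summable.of_norm_bounded ((hab.comp_injective hinj).mul_right ‖c‖) fun x => ?_
  rw [Function.uncurry_def]
  simp only [Function.comp, norm_mul, Real.norm_eq_abs]
  exact mul_le_mul_of_nonneg_left (D.abs_apply_le_norm c _)
    (mul_nonneg (abs_nonneg _) (abs_nonneg _))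

theorem convPow_succ (a : D.Ell) (n : ℕ) : D.convPow a (n + 1) = D.conv a (D.convPow a n) := rfl

theorem hasFDerivAt_convPow (a : D.Ell) (n : ℕ) :
    HasFDerivAt (fun x => D.convPow x n) ((n : ℝ) • D.convL (D.convPow a (n - 1))) a := by
  induction n with
  | zero =>
    rw [Nat.cast_zero, zero_smul]
    exact hasFDerivAt_const (𝕜 := ℝ) D.unit a
  | succ n ih =>
    have h := D.convL.isBoundedBilinearMap.hasFDerivAt (a, D.convPow a n)
    have h2 := h.comp (f := fun x => (x, D.convPow x n)) a ((hasFDerivAt_id a).prodMk ih)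
    refine h2.congr_fderiv ?_
    ext1 x
    -- For `n = 0` the truncated `n - 1` does no harm, since the coefficient is zero.
    have e : D.conv a ((n : ℝ) • D.conv (D.convPow a (n - 1)) x)
        = (n : ℝ) • D.conv (D.convPow a n) x := by
      cases n with
      | zero => rw [conv_smul_right, Nat.cast_zero, zero_smul, zero_smul]
      | succ n => rw [conv_smul_right, convPow_succ, Nat.add_sub_cancel, conv_assoc]
    simp only [ContinuousLinearMap.comp_apply, ContinuousLinearMap.prod_apply,
      smul_apply, IsBoundedBilinearMap.deriv_apply, convL_apply,
      ContinuousLinearMap.id_apply, Nat.add_sub_cancel]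
    erw [e]
    rw [D.conv_comm x]
    push_cast
    module

/-- The sequence of Fourier coefficients of `N'(u)`. -/
def dNop (a : D.Ell) : D.Ell := D.N.sum fun n c => (c * n) • D.convPow a (n - 1)

theorem hasFDerivAt_Nop (a : D.Ell) : HasFDerivAt D.Nop (D.convL (D.dNop a)) a := by
  unfold Nop dNop Polynomial.sum
  rw [map_sum]
  refine HasFDerivAt.fun_sum fun n _ => ?_
  have h := (D.hasFDerivAt_convPow a n).const_smul (D.N.coeff n)
  rw [map_smul, mul_smul]
  exact h

theorem DN_eq (ψ h : D.Ell) : D.DN ψ h = D.conv (D.dNop ψ) h := by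
  rw [DN, (D.hasFDerivAt_Nop ψ).fderiv, convL_apply]

theorem continuous_Nop : Continuous D.Nop :=
  continuous_iff_continuousAt.2 fun a => (D.hasFDerivAt_Nop a).continuousAt

theorem continuous_convPow (n : ℕ) : Continuous fun a => D.convPow a n :=
  continuous_iff_continuousAt.2 fun a => (D.hasFDerivAt_convPow a n).continuousAt

theorem continuous_dNop : Continuous D.dNop := by
  unfold dNop Polynomial.sum
  exact continuous_finsetSum _ fun n _ =>
    (D.continuous_convPow (n - 1)).const_smul (D.N.coeff n * n)

theorem enrm_ofFinite_ne_top (m : ℤ) {a : (Fin d → ℕ) → ℝ} (S : Finset (Fin d → ℕ))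
    (h : ∀ k ∉ S, a k = 0) : D.enrm m a ≠ ∞ := by
  rw [enrm, tsum_eq_sum (s := S) fun k hk => by simp [h k hk]]
  exact ENNReal.sum_ne_top.2 fun k _ => ENNReal.mul_ne_top (D.wt_ne_top m k) enorm_ne_top

theorem enrm_unit_ne_top (m : ℤ) : D.enrm m D.unit ≠ ∞ :=
  D.enrm_ofFinite_ne_top m {0} fun k hk => by
    have : k ≠ 0 := by simpa using hk
    exact if_neg this

/-- Tame bound for convolution powers. -/
theorem exists_enrm_convPow_le (m n : ℕ) (R : ℝ≥0) : ∃ C : ℝ≥0, ∀ a : D.Ell, ‖a‖ₑ ≤ R →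
    D.enrm 0 (D.convPow a n) ≤ C ∧ D.enrm m (D.convPow a n) ≤ C * (1 + D.enrm m a) := by
  induction n with
  | zero =>
    refine ⟨(D.enrm 0 D.unit).toNNReal + (D.enrm m D.unit).toNNReal, fun a _ => ?_⟩
    rw [ENNReal.coe_add, ENNReal.coe_toNNReal (D.enrm_unit_ne_top _),
      ENNReal.coe_toNNReal (D.enrm_unit_ne_top _)]
    refine ⟨le_self_add, ?_⟩
    refine (le_add_self.trans (le_mul_of_one_le_right (zero_le) le_self_add))
  | succ n ih =>
    obtain ⟨C, hC⟩ := ih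
    refine ⟨R * C + 4 ^ m * (C + R * C), fun a ha => ?_⟩
    obtain ⟨h0, hm⟩ := hC a ha
    rw [enorm_ell] at ha
    have e4 : ENNReal.ofReal (4 ^ m) = 4 ^ m := by
      rw [ENNReal.ofReal_pow (by norm_num), ENNReal.ofReal_ofNat]
    push_cast
    refine ⟨?_, ?_⟩
    · refine le_trans (D.enrm_zero_convSeq_le _ _) ?_
      exact le_trans (mul_le_mul' ha h0) le_self_add
    · refine (D.enrm_convSeq_le_add m _ _).trans ?_
      rw [e4]
      calc (4 : ℝ≥0∞) ^ m * (D.enrm m a * D.enrm 0 (D.convPow a n)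
            + D.enrm 0 a * D.enrm m (D.convPow a n))
          ≤ 4 ^ m * ((1 + D.enrm m a) * C + R * (C * (1 + D.enrm m a))) := by
            gcongr
            exact le_add_self
        _ = 4 ^ m * (C + R * C) * (1 + D.enrm m a) := by ring
        _ ≤ _ := by gcongr; exact le_add_self

theorem polySum_apply (f : ℕ → ℝ → D.Ell) (k : Fin d → ℕ) :
    (D.N.sum f) k = ∑ n ∈ D.N.support, f n (D.N.coeff n) k := by
  rw [Polynomial.sum, Ell1.sum_apply]

/-- Tame bound for the nonlinearity. -/
theorem exists_enrm_Nop_le (m : ℕ) (R : ℝ≥0) : ∃ C : ℝ≥0, ∀ a : D.Ell, ‖a‖ₑ ≤ R →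
    D.enrm m (D.Nop a) ≤ C * (1 + D.enrm m a) := by
  choose C hC using fun n => D.exists_enrm_convPow_le m n R
  refine ⟨∑ n ∈ D.N.support, ‖D.N.coeff n‖₊ * C n, fun a ha => ?_⟩
  have e : (fun k => D.Nop a k)
      = fun k => ∑ n ∈ D.N.support, D.N.coeff n * D.convPow a n k := by
    funext k
    rw [Nop, polySum_apply]
    rfl
  change D.enrm m (fun k => D.Nop a k) ≤ _
  rw [e]
  refine (D.enrm_sum_le m _ _).trans ?_
  rw [ENNReal.ofNNReal_finsetSum, Finset.sum_mul]
  refine Finset.sum_le_sum fun n _ => ?_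
  rw [enrm_const_mul, ENNReal.coe_mul, mul_assoc]
  exact mul_le_mul_right (hC n a ha).2 _

/-- Mean value inequality on the ball of radius `R`, where `‖𝒩'(x)‖ ≤ K` bounds the derivative. -/
theorem exists_norm_Nop_sub_le (R : ℝ≥0) : ∃ C : ℝ≥0, ∀ a b : D.Ell, ‖a‖ ≤ R → ‖b‖ ≤ R →
    ‖D.Nop a - D.Nop b‖ ≤ C * ‖a - b‖ := by
  choose C hC using fun n => D.exists_enrm_convPow_le 0 n R
  set K : ℝ≥0 := ∑ n ∈ D.N.support, ‖D.N.coeff n * n‖₊ * C (n - 1) with hK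
  have hd : ∀ a : D.Ell, ‖a‖ ≤ R → ‖D.dNop a‖ ≤ K := by
    intro a ha
    have ha' : ‖a‖ₑ ≤ R := by
      rw [← ofReal_norm]; exact ENNReal.ofReal_le_of_le_toReal (by simpa using ha)
    rw [hK, NNReal.coe_sum]
    refine (norm_sum_le _ _).trans (Finset.sum_le_sum fun n _ => ?_)
    rw [norm_smul, NNReal.coe_mul, coe_nnnorm]
    refine mul_le_mul_of_nonneg_left ?_ (norm_nonneg _)
    have h := (hC (n - 1) a ha').1
    rw [← enorm_ell, ← ofReal_norm] at h
    exact (ENNReal.ofReal_le_coe).1 h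
  refine ⟨K, fun a b ha hb => ?_⟩
  refine (convex_closedBall (0 : D.Ell) R).norm_image_sub_le_of_norm_hasFDerivWithin_le
    (f' := fun x => D.convL (D.dNop x))
    (fun x _ => (D.hasFDerivAt_Nop x).hasFDerivWithinAt) (fun x hx => ?_) (by simpa using hb)
    (by simpa using ha)
  refine ContinuousLinearMap.opNorm_le_bound _ K.2 fun y => ?_
  exact (D.norm_conv_le _ _).trans
    (mul_le_mul_of_nonneg_right (hd x (by simpa using hx)) (norm_nonneg _))

/-! ### Finitely supported kernels -/

/-- The sequence `a` vanishes outside the box `[0, B)^d`. -/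
def BoxSupp (B : ℕ) (a : (Fin d → ℕ) → ℝ) : Prop := ∀ k i, B ≤ k i → a k = 0

theorem _root_.ParabolicIVP.Setting.BoxSupp.mono {B B' : ℕ} (h : B ≤ B')
    {a : (Fin d → ℕ) → ℝ} (ha : BoxSupp B a) : BoxSupp B' a := fun k i hk => ha k i (h.trans hk)

theorem boxSupp_unit : BoxSupp 1 (D.unit : (Fin d → ℕ) → ℝ) := by
  intro k i hk
  refine if_neg ?_
  rintro rfl
  simp at hk

theorem boxSupp_convSeq {A B : ℕ} {a b : (Fin d → ℕ) → ℝ} (ha : BoxSupp A a) (hb : BoxSupp B b) :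
    BoxSupp (A + B) (convSeq a b) := by
  intro k i hk
  rw [convSeq_eq]
  have : ∀ l : Fin d → ℤ, a (absIdx l) * b (absIdx ((fun i => (k i : ℤ)) - l)) = 0 := by
    intro l
    rcases le_total A (absIdx l i) with h | h
    · rw [ha _ i h, zero_mul]
    · rw [hb _ i ?_, mul_zero]
      simp only [absIdx, Pi.sub_apply] at h ⊢
      omega
  simp [this]

/-- The `+ 1` accounts for the unit, which occupies the box of size one. -/
theorem boxSupp_convPow {A : ℕ} {a : D.Ell} (ha : BoxSupp A (a : (Fin d → ℕ) → ℝ)) (n : ℕ) :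
    BoxSupp (n * A + 1) (D.convPow a n : (Fin d → ℕ) → ℝ) := by
  induction n with
  | zero => exact D.boxSupp_unit.mono (by omega)
  | succ n ih =>
    have := boxSupp_convSeq ha ih
    rw [show (n + 1) * A + 1 = A + (n * A + 1) by ring]
    exact this

theorem boxSupp_dNop {A : ℕ} {a : D.Ell} (ha : BoxSupp A (a : (Fin d → ℕ) → ℝ)) :
    BoxSupp (D.N.natDegree * A + 1) (D.dNop a : (Fin d → ℕ) → ℝ) := by
  intro k i hk
  rw [dNop, polySum_apply]
  refine Finset.sum_eq_zero fun n hn => ?_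
  have h1 : n ≤ D.N.natDegree := Polynomial.le_natDegree_of_mem_supp n hn
  have h2 : (n - 1) * A + 1 ≤ D.N.natDegree * A + 1 := by gcongr; omega
  rw [Ell1.smul_apply, (D.boxSupp_convPow ha (n - 1)).mono h2 k i hk, mul_zero]

/-- The integer multi-indices in the box `(-B, B)^d`. -/
def intBox (d B : ℕ) : Finset (Fin d → ℤ) := Fintype.piFinset fun _ => Finset.Icc (-(B : ℤ)) B

/-- The range of summation depends neither on `k` nor on `b`. Convolution with a finitely supported
kernel therefore commutes with integrals, series and limits mode by mode, without any summability of
`b`. -/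
theorem convSeq_eq_sum {B : ℕ} {a : (Fin d → ℕ) → ℝ} (ha : BoxSupp B a) (b : (Fin d → ℕ) → ℝ)
    (k : Fin d → ℕ) :
    convSeq a b k
      = ∑ l ∈ intBox d B, a (absIdx l) * b (absIdx ((fun i => (k i : ℤ)) - l)) := by
  rw [convSeq_eq]
  refine tsum_eq_sum fun l hl => ?_
  simp only [intBox, Fintype.mem_piFinset, Finset.mem_Icc, not_forall] at hl
  obtain ⟨i, hi⟩ := hl
  rw [ha _ i ?_, zero_mul]
  simp only [absIdx]
  omega

end Setting

/-! ### Scalar estimates -/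

theorem lintegral_exp_neg_le {α : ℝ} (hα : 0 < α) (s τ : ℝ) :
    ∫⁻ t in Ioc s τ, ENNReal.ofReal (Real.exp (-α * (t - s))) ≤ ENNReal.ofReal α⁻¹ := by
  rcases le_total τ s with h | h
  · simp [Ioc_eq_empty_of_le h]
  have hd : ∀ t, HasDerivAt (fun t => -α⁻¹ * Real.exp (-α * (t - s)))
      (Real.exp (-α * (t - s))) t := by
    intro t
    have h1 : HasDerivAt (fun t => -α * (t - s)) (-α) t := by
      simpa using ((hasDerivAt_id t).sub_const s).const_mul (-α)
    refine (h1.exp.const_mul (-α⁻¹)).congr_deriv ?_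
    field_simp
  have hcont : Continuous fun t => Real.exp (-α * (t - s)) := by fun_prop
  rw [← ofReal_integral_eq_lintegral_ofReal
    ((hcont.intervalIntegrable s τ).1) (Eventually.of_forall fun t => (Real.exp_pos _).le),
    ← intervalIntegral.integral_of_le h,
    intervalIntegral.integral_eq_sub_of_hasDerivAt (fun t _ => hd t) (hcont.intervalIntegrable s τ)]
  refine ENNReal.ofReal_le_ofReal ?_
  simp only [sub_self, mul_zero, Real.exp_zero]
  have := mul_pos (inv_pos.2 hα) (Real.exp_pos (-α * (τ - s)))
  linarith

/-- The exponential weight in time. -/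
def expWt (l t : ℝ) : ℝ≥0∞ := ENNReal.ofReal (Real.exp (-l * t))

theorem expWt_ne_zero (l t : ℝ) : expWt l t ≠ 0 := (ENNReal.ofReal_pos.2 (Real.exp_pos _)).ne'

theorem expWt_ne_top (l t : ℝ) : expWt l t ≠ ∞ := ENNReal.ofReal_ne_top

theorem measurable_expWt (l : ℝ) : Measurable (expWt l) := by
  unfold expWt; fun_prop

theorem exists_expWt_bounds (l s τ : ℝ) : ∃ C : ℝ≥0, ∀ t ∈ Icc s τ,
    expWt l t ≤ C ∧ 1 ≤ C * expWt l t := by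
  refine ⟨(Real.exp (|l| * (|s| + |τ|))).toNNReal, fun t ht => ?_⟩
  have h1 : |l * t| ≤ |l| * (|s| + |τ|) := by
    rw [abs_mul]
    refine mul_le_mul_of_nonneg_left ?_ (abs_nonneg _)
    rw [abs_le]
    constructor
    · linarith [neg_abs_le s, abs_nonneg τ, ht.1]
    · linarith [le_abs_self τ, abs_nonneg s, ht.2]
  have h2 := abs_le.1 h1
  change ENNReal.ofReal _ ≤ ENNReal.ofReal _ ∧ 1 ≤ ENNReal.ofReal _ * ENNReal.ofReal _
  refine ⟨ENNReal.ofReal_le_ofReal (Real.exp_le_exp.2 (by linarith)), ?_⟩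
  rw [← ENNReal.ofReal_mul (Real.exp_pos _).le, ← Real.exp_add, ← ENNReal.ofReal_one]
  exact ENNReal.ofReal_le_ofReal (Real.one_le_exp (by linarith))

/-- On a bounded interval the weight lies between positive constants, so it can be inserted to win a
small constant and removed again where only finiteness matters. -/
theorem lintegral_expWt_ne_top_iff (l s τ : ℝ) (F : ℝ → ℝ≥0∞) :
    ∫⁻ t in Ioc s τ, expWt l t * F t ≠ ∞ ↔ ∫⁻ t in Ioc s τ, F t ≠ ∞ := by
  obtain ⟨C, hC⟩ := exists_expWt_bounds l s τ
  constructor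
  · intro h
    refine ne_top_of_le_ne_top (ENNReal.mul_ne_top (ENNReal.coe_ne_top (r := C)) h) ?_
    rw [← lintegral_const_mul' _ _ ENNReal.coe_ne_top]
    refine setLIntegral_mono' measurableSet_Ioc fun t ht => ?_
    rw [← mul_assoc]
    exact le_mul_of_one_le_left zero_le (hC t (Ioc_subset_Icc_self ht)).2
  · intro h
    refine ne_top_of_le_ne_top (ENNReal.mul_ne_top (ENNReal.coe_ne_top (r := C)) h) ?_
    rw [← lintegral_const_mul' _ _ ENNReal.coe_ne_top]
    refine setLIntegral_mono' measurableSet_Ioc fun t ht => ?_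
    exact mul_le_mul_left (hC t (Ioc_subset_Icc_self ht)).1 _

theorem expWt_mul_exp (l m s t : ℝ) :
    expWt l t * ENNReal.ofReal (Real.exp (m * (t - s)))
      = expWt l s * ENNReal.ofReal (Real.exp (-(l - m) * (t - s))) := by
  unfold expWt
  rw [← ENNReal.ofReal_mul (Real.exp_pos _).le, ← ENNReal.ofReal_mul (Real.exp_pos _).le,
    ← Real.exp_add, ← Real.exp_add]
  congr 2; ring

theorem lintegral_expWt_exp_le {l m : ℝ} (h : m < l) (s τ : ℝ) :
    ∫⁻ t in Ioc s τ, expWt l t * ENNReal.ofReal (Real.exp (m * (t - s)))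
      ≤ ENNReal.ofReal (l - m)⁻¹ * expWt l s := by
  simp only [expWt_mul_exp]
  rw [lintegral_const_mul' _ _ (expWt_ne_top _ _), mul_comm]
  exact mul_le_mul_left (lintegral_exp_neg_le (sub_pos.2 h) s τ) _

/-- Young's inequality for the exponential kernel, in exponentially weighted `L¹`. -/
theorem lintegral_expWt_duhamel_le {l m : ℝ} (h : m < l) (s τ : ℝ) {F : ℝ → ℝ≥0∞}
    (hF : AEMeasurable F (volume.restrict (Ioc s τ))) :
    ∫⁻ t in Ioc s τ, expWt l t *
        ∫⁻ r in Ioc s t, ENNReal.ofReal (Real.exp (m * (t - r))) * F r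
      ≤ ENNReal.ofReal (l - m)⁻¹ * ∫⁻ r in Ioc s τ, expWt l r * F r := by
  -- The kernel is extended by zero from the triangle `r ≤ t` to the square, so that Tonelli's
  -- theorem can exchange the two integrals.
  set K : ℝ × ℝ → ℝ≥0∞ := fun x =>
    if x.2 ≤ x.1 then expWt l x.1 * ENNReal.ofReal (Real.exp (m * (x.1 - x.2))) else 0 with hKdef
  have hK : Measurable K :=
    Measurable.ite (measurableSet_le measurable_snd measurable_fst)
      (((measurable_expWt l).comp measurable_fst).mul (by fun_prop)) measurable_const
  have e1 : ∀ t ∈ Ioc s τ, expWt l t *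
        ∫⁻ r in Ioc s t, ENNReal.ofReal (Real.exp (m * (t - r))) * F r
      = ∫⁻ r in Ioc s τ, K (t, r) * F r := by
    intro t ht
    rw [← lintegral_const_mul' _ _ (expWt_ne_top _ _),
      ← lintegral_indicator measurableSet_Ioc, ← lintegral_indicator measurableSet_Ioc]
    refine lintegral_congr fun r => ?_
    by_cases hr : r ∈ Ioc s t
    · have hr' : r ∈ Ioc s τ := ⟨hr.1, hr.2.trans ht.2⟩
      rw [indicator_of_mem hr, indicator_of_mem hr', hKdef]
      simp only [if_pos hr.2, mul_assoc]
    · rw [indicator_of_notMem hr]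
      by_cases hr' : r ∈ Ioc s τ
      · have : ¬ r ≤ t := fun h => hr ⟨hr'.1, h⟩
        rw [indicator_of_mem hr', hKdef]
        simp only [if_neg this, zero_mul]
      · rw [indicator_of_notMem hr']
  rw [setLIntegral_congr_fun measurableSet_Ioc e1, lintegral_lintegral_swap]
  · rw [← lintegral_const_mul' _ _ ENNReal.ofReal_ne_top]
    refine setLIntegral_mono' measurableSet_Ioc fun r hr => ?_
    calc ∫⁻ t in Ioc s τ, K (t, r) * F r
        = (∫⁻ t in Ioc s τ, K (t, r)) * F r :=
          lintegral_mul_const _ (hK.comp measurable_prodMk_right)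
      _ ≤ (∫⁻ t in Ioc r τ, expWt l t * ENNReal.ofReal (Real.exp (m * (t - r)))) * F r := by
          refine mul_le_mul_left ?_ _
          rw [← lintegral_indicator measurableSet_Ioc, ← lintegral_indicator measurableSet_Ioc]
          refine lintegral_mono_ae ?_
          have hne : ∀ᵐ t : ℝ, t ≠ r := by simp [ae_iff]
          filter_upwards [hne] with t htr
          by_cases ht : t ∈ Ioc s τ
          · rw [indicator_of_mem ht, hKdef]
            by_cases hrt : r ≤ t
            · have htr' : t ∈ Ioc r τ := ⟨lt_of_le_of_ne hrt htr.symm, ht.2⟩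
              rw [indicator_of_mem htr']
              simp only [if_pos hrt, le_refl]
            · simp only [if_neg hrt, zero_le]
          · rw [indicator_of_notMem ht]
            exact zero_le
      _ ≤ ENNReal.ofReal (l - m)⁻¹ * expWt l r * F r :=
          mul_le_mul_left (lintegral_expWt_exp_le h r τ) _
      _ = _ := mul_assoc _ _ _
  · exact AEMeasurable.mul hK.aemeasurable
      (hF.comp_quasiMeasurePreserving Measure.quasiMeasurePreserving_snd)

/-! ### Dominated calculus in weighted `ℓ¹` -/

theorem Ell1.continuousOn_of_dominated {ι : Type} {w : ι → {x : ℝ // 0 < x}} {S : Set ℝ}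
    {B : ℝ → Ell1 w} {M : ι → ℝ} (hM : Summable fun k => M k * (w k : ℝ))
    (hB : ∀ k, ContinuousOn (fun t => B t k) S) (hdom : ∀ t ∈ S, ∀ k, |B t k| ≤ M k) :
    ContinuousOn B S := fun t ht =>
  Ell1.tendsto_of_dominated hM (fun k => hB k t ht) (eventually_mem_nhdsWithin.mono hdom)

/-- By the mean value inequality a majorant of the derivatives bounds all difference quotients, mode
by mode; then dominated convergence applies. -/
theorem Ell1.hasDerivWithinAt_of_dominated {ι : Type} {w : ι → {x : ℝ // 0 < x}} {S : Set ℝ}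
    (hS : Convex ℝ S) {B B' : ℝ → Ell1 w} {M : ι → ℝ} (hM : Summable fun k => M k * (w k : ℝ))
    (hB : ∀ k, ∀ t ∈ S, HasDerivWithinAt (fun t => B t k) (B' t k) S t)
    (hdom : ∀ t ∈ S, ∀ k, |B' t k| ≤ M k) {t : ℝ} (ht : t ∈ S) :
    HasDerivWithinAt B (B' t) S t := by
  rw [hasDerivWithinAt_iff_tendsto_slope]
  refine Ell1.tendsto_of_dominated hM (fun k => ?_) ?_
  · exact hasDerivWithinAt_iff_tendsto_slope.1 (hB k t ht)
  · filter_upwards [self_mem_nhdsWithin] with r hr k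
    have h1 : ‖B r k - B t k‖ ≤ M k * ‖r - t‖ :=
      hS.norm_image_sub_le_of_norm_hasDerivWithin_le (hB k) (fun x hx => hdom x hx k) ht hr.1
    have h2 : 0 < |r - t| := abs_pos.2 (sub_ne_zero.2 hr.2)
    change |(r - t)⁻¹ * (B r k - B t k)| ≤ M k
    rw [abs_mul, abs_inv, inv_mul_le_iff₀ h2, mul_comm]
    exact h1

namespace Setting

variable {d : ℕ} (D : Setting d)

/-! ### Mild solutions -/

/-- `b` is the mild solution on `(s, τ]` of `ḃ = ℒ b + f`, `b(s) = χ`, understood mode by mode. -/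
def Mild (s τ : ℝ) (χ : (Fin d → ℕ) → ℝ) (f b : ℝ → (Fin d → ℕ) → ℝ) : Prop :=
  (∀ k, IntegrableOn (fun r => f r k) (Ioc s τ)) ∧
  ∀ t ∈ Ioc s τ, ∀ k, b t k = Real.exp (D.mu k * (t - s)) * χ k
    + ∫ r in Ioc s t, Real.exp (D.mu k * (t - r)) * f r k

variable {D} {s τ : ℝ} {χ : (Fin d → ℕ) → ℝ} {f b h : ℝ → (Fin d → ℕ) → ℝ}

theorem integrableOn_exp_mul (k : Fin d → ℕ) (t : ℝ) {F : ℝ → ℝ} {a c : ℝ}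
    (hF : IntegrableOn F (Ioc a c)) :
    IntegrableOn (fun r => Real.exp (D.mu k * (t - r)) * F r) (Ioc a c) := by
  rw [← integrableOn_Icc_iff_integrableOn_Ioc] at hF ⊢
  refine hF.continuousOn_mul ?_ isCompact_Icc
  fun_prop

theorem Mild.sub {χ' : (Fin d → ℕ) → ℝ} {f' b' : ℝ → (Fin d → ℕ) → ℝ} (h : D.Mild s τ χ f b)
    (h' : D.Mild s τ χ' f' b') :
    D.Mild s τ (fun k => χ k - χ' k) (fun r k => f r k - f' r k) (fun t k => b t k - b' t k) := by
  refine ⟨fun k => (h.1 k).sub (h'.1 k), fun t ht k => ?_⟩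
  have hs : Ioc s t ⊆ Ioc s τ := Ioc_subset_Ioc_right ht.2
  have e : ∀ r, Real.exp (D.mu k * (t - r)) * (f r k - f' r k)
      = Real.exp (D.mu k * (t - r)) * f r k - Real.exp (D.mu k * (t - r)) * f' r k :=
    fun r => mul_sub _ _ _
  simp only [e]
  rw [h.2 t ht k, h'.2 t ht k]
  rw [integral_sub (integrableOn_exp_mul k t ((h.1 k).mono_set hs))
    (integrableOn_exp_mul k t ((h'.1 k).mono_set hs))]
  ring

theorem Mild.congr {f' b' : ℝ → (Fin d → ℕ) → ℝ} (h : D.Mild s τ χ f b)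
    (hf : ∀ t ∈ Ioc s τ, ∀ k, f t k = f' t k) (hb : ∀ t ∈ Ioc s τ, ∀ k, b t k = b' t k) :
    D.Mild s τ χ f' b' := by
  refine ⟨fun k => (h.1 k).congr_fun (fun t ht => hf t ht k) measurableSet_Ioc,
    fun t ht k => ?_⟩
  rw [← hb t ht k, h.2 t ht k]
  congr 1
  refine setIntegral_congr_fun measurableSet_Ioc fun r hr => ?_
  simp only [hf r ⟨hr.1, hr.2.trans ht.2⟩ k]

theorem Mild.restart (h : D.Mild s τ χ f b) {t₀ : ℝ} (ht₀ : t₀ ∈ Ioc s τ) :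
    D.Mild t₀ τ (b t₀) f b := by
  refine ⟨fun k => (h.1 k).mono_set (Ioc_subset_Ioc_left ht₀.1.le), fun t ht k => ?_⟩
  have hint := integrableOn_exp_mul (D := D) k t (h.1 k)
  rw [h.2 t ⟨ht₀.1.trans ht.1, ht.2⟩ k, h.2 t₀ ht₀ k,
    ← Ioc_union_Ioc_eq_Ioc ht₀.1.le ht.1.le,
    setIntegral_union (Ioc_disjoint_Ioc_of_le le_rfl) measurableSet_Ioc
      (hint.mono_set (Ioc_subset_Ioc_right ht₀.2))
      (hint.mono_set (Ioc_subset_Ioc ht₀.1.le ht.2)), mul_add, ← integral_const_mul, ← add_assoc]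
  congr 2
  · rw [← mul_assoc, ← Real.exp_add]
    congr 2; ring
  · refine setIntegral_congr_fun measurableSet_Ioc fun r _ => ?_
    simp only [← mul_assoc, ← Real.exp_add]
    congr 2; ring

/-- The right-hand side of the mild formulation is continuous up to the initial time. -/
theorem continuousOn_duhamel (k : Fin d → ℕ) (c : ℝ) {F : ℝ → ℝ} (hF : IntegrableOn F (Ioc s τ)) :
    ContinuousOn (fun t => Real.exp (D.mu k * (t - s)) * c
      + ∫ r in Ioc s t, Real.exp (D.mu k * (t - r)) * F r) (Icc s τ) := by
  have e : ∀ t, ∫ r in Ioc s t, Real.exp (D.mu k * (t - r)) * F r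
      = Real.exp (D.mu k * t) * ∫ r in Ioc s t, Real.exp (D.mu k * (0 - r)) * F r := by
    intro t
    rw [← integral_const_mul]
    refine integral_congr_ae (Eventually.of_forall fun r => ?_)
    simp only [← mul_assoc, ← Real.exp_add]
    congr 2; ring
  simp only [e]
  have h1 := intervalIntegral.continuousOn_primitive
    ((integrableOn_Icc_iff_integrableOn_Ioc enorm_ne_top).2 (integrableOn_exp_mul (D := D) k 0 hF))
  exact ContinuousOn.add (by fun_prop) (ContinuousOn.mul (by fun_prop) h1)

theorem Mild.continuousOn (h : D.Mild s τ χ f b) (k : Fin d → ℕ) :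
    ContinuousOn (fun t => b t k) (Ioc s τ) :=
  ((continuousOn_duhamel k (χ k) (h.1 k)).mono Ioc_subset_Icc_self).congr fun t ht => h.2 t ht k

theorem Mild.tendsto (h : D.Mild s τ χ f b) (hsτ : s < τ) (k : Fin d → ℕ) :
    Tendsto (fun t => b t k) (𝓝[>] s) (𝓝 (χ k)) := by
  have h1 := (continuousOn_duhamel (D := D) k (χ k) (h.1 k)).continuousWithinAt
    (left_mem_Icc.2 hsτ.le)
  have h2 := (h1.mono Ioc_subset_Icc_self).tendsto
  rw [nhdsWithin_Ioc_eq_nhdsGT hsτ] at h2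
  simp only [sub_self, mul_zero, Real.exp_zero, one_mul, Ioc_self, Measure.restrict_empty,
    integral_zero_measure, add_zero] at h2
  refine h2.congr' ?_
  filter_upwards [Ioc_mem_nhdsGT hsτ] with t ht
  rw [h.2 t ht k]

theorem Mild.hasDerivWithinAt (h : D.Mild s τ χ f b) {k : Fin d → ℕ}
    (hf : ContinuousOn (fun t => f t k) (Ioc s τ)) {t : ℝ} (ht : t ∈ Ioc s τ) :
    HasDerivWithinAt (fun t => b t k) (D.mu k * b t k + f t k) (Ioc s τ) t := by
  -- Near `s` the force is only integrable. Restarting at `t₀ ∈ (s, t)` makes it continuous on the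
  -- compact interval `[t₀, τ]`.
  obtain ⟨t₀, ht₀⟩ := exists_between ht.1
  have ht₀' : t₀ ∈ Ioc s τ := ⟨ht₀.1, ht₀.2.le.trans ht.2⟩
  have hr := h.restart ht₀'
  have htm : t ∈ Icc t₀ τ := ⟨ht₀.2.le, ht.2⟩
  have hsub : Icc t₀ τ ⊆ Ioc s τ := fun x hx => ⟨ht₀.1.trans_le hx.1, hx.2⟩
  have hg : ContinuousOn (fun r => Real.exp (D.mu k * (0 - r)) * f r k) (Icc t₀ τ) :=
    ContinuousOn.mul (by fun_prop) (hf.mono hsub)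
  have hfact : Fact (t ∈ Icc t₀ τ) := ⟨htm⟩
  have hprim : HasDerivWithinAt (fun x => ∫ r in t₀..x, Real.exp (D.mu k * (0 - r)) * f r k)
      (Real.exp (D.mu k * (0 - t)) * f t k) (Icc t₀ τ) t := by
    refine intervalIntegral.integral_hasDerivWithinAt_right ?_ ?_ (hg t htm)
    · refine ContinuousOn.intervalIntegrable (hg.mono ?_)
      rw [uIcc_of_le htm.1]
      exact Icc_subset_Icc_right htm.2
    · exact hg.stronglyMeasurableAtFilter_nhdsWithin measurableSet_Icc t
  have hexp : HasDerivAt (fun x => Real.exp (D.mu k * (x - t₀)) * b t₀ k)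
      (D.mu k * (Real.exp (D.mu k * (t - t₀)) * b t₀ k)) t := by
    have h1 : HasDerivAt (fun x => D.mu k * (x - t₀)) (D.mu k) t := by
      simpa using ((hasDerivAt_id t).sub_const t₀).const_mul (D.mu k)
    refine (h1.exp.mul_const _).congr_deriv ?_
    ring
  have hexp2 : HasDerivAt (fun x => Real.exp (D.mu k * x))
      (D.mu k * Real.exp (D.mu k * t)) t := by
    have h1 : HasDerivAt (fun x => D.mu k * x) (D.mu k) t := by
      simpa using (hasDerivAt_id t).const_mul (D.mu k)
    refine h1.exp.congr_deriv ?_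
    ring
  -- With `e^{μx}` pulled out, the integrand no longer depends on `x` and the fundamental theorem of
  -- calculus applies.
  have e : ∀ x ∈ Ioc t₀ τ, b x k = Real.exp (D.mu k * (x - t₀)) * b t₀ k
      + Real.exp (D.mu k * x) * ∫ r in t₀..x, Real.exp (D.mu k * (0 - r)) * f r k := by
    intro x hx
    rw [hr.2 x hx k, intervalIntegral.integral_of_le hx.1.le, ← integral_const_mul]
    congr 1
    refine integral_congr_ae (Eventually.of_forall fun r => ?_)
    simp only [← mul_assoc, ← Real.exp_add]
    congr 2; ring
  have hfin := (hexp.hasDerivWithinAt (s := Icc t₀ τ)).add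
    ((hexp2.hasDerivWithinAt (s := Icc t₀ τ)).mul hprim)
  have hIoc : Ioc t₀ τ ⊆ Icc t₀ τ := Ioc_subset_Icc_self
  have h3 := ((hfin.mono hIoc).congr e (e t ⟨ht₀.2, ht.2⟩))
  have h4 : HasDerivWithinAt (fun t => b t k) (D.mu k * b t k + f t k) (Ioc t₀ τ) t := by
    refine h3.congr_deriv ?_
    rw [e t ⟨ht₀.2, ht.2⟩]
    have : Real.exp (D.mu k * t) * (Real.exp (D.mu k * (0 - t)) * f t k) = f t k := by
      rw [← mul_assoc, ← Real.exp_add]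
      simp
    linear_combination this
  refine h4.mono_of_mem_nhdsWithin ?_
  rw [← Ioi_inter_Iic, ← Ioi_inter_Iic]
  exact inter_mem (mem_nhdsWithin_of_mem_nhds (Ioi_mem_nhds ht₀.2))
    (mem_of_superset self_mem_nhdsWithin inter_subset_right)

/-- Solutions of the mode-wise differential equations are mild. -/
theorem mild_of_hasDerivAt (hf : ∀ k, IntegrableOn (fun r => f r k) (Ioc s τ))
    (hb : ∀ k, ContinuousOn (fun t => b t k) (Ioc s τ))
    (hd : ∀ k, ∀ t ∈ Ioo s τ, HasDerivAt (fun t => b t k) (D.mu k * b t k + f t k) t)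
    (h0 : ∀ k, Tendsto (fun t => b t k) (𝓝[>] s) (𝓝 (χ k))) : D.Mild s τ χ f b := by
  refine ⟨hf, fun t ht k => ?_⟩
  have hexp : ∀ x, HasDerivAt (fun x => Real.exp (D.mu k * (t - x)))
      (-D.mu k * Real.exp (D.mu k * (t - x))) x := by
    intro x
    have h1 : HasDerivAt (fun x => D.mu k * (t - x)) (-D.mu k) x := by
      simpa using ((hasDerivAt_id x).const_sub t).const_mul (D.mu k)
    refine h1.exp.congr_deriv ?_
    ring
  -- The derivative of `e^{μ(t-x)} b(x)` is `e^{μ(t-x)} f(x)`; only one-sided limits are available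
  -- at the ends of `(s, t)`.
  have key := intervalIntegral.integral_eq_sub_of_hasDerivAt_of_tendsto
    (f := fun x => Real.exp (D.mu k * (t - x)) * b x k)
    (f' := fun x => Real.exp (D.mu k * (t - x)) * f x k)
    (fa := Real.exp (D.mu k * (t - s)) * χ k) (fb := b t k) ht.1
    (fun x hx => by
      refine ((hexp x).mul (hd k x ⟨hx.1, hx.2.trans_le ht.2⟩)).congr_deriv ?_
      ring)
    ((intervalIntegrable_iff_integrableOn_Ioc_of_le ht.1.le).2
      (integrableOn_exp_mul k t ((hf k).mono_set (Ioc_subset_Ioc_right ht.2))))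
    (by
      refine Tendsto.mul ?_ (h0 k)
      exact ((hexp s).continuousAt.tendsto).mono_left nhdsWithin_le_nhds)
    (by
      have h1 : Tendsto (fun x => Real.exp (D.mu k * (t - x))) (𝓝[<] t) (𝓝 1) := by
        have := ((hexp t).continuousAt.tendsto).mono_left (nhdsWithin_le_nhds (s := Iio t))
        simpa using this
      have h2 : Tendsto (fun x => b x k) (𝓝[<] t) (𝓝 (b t k)) := by
        refine (hb k t ht).mono_left ?_
        rw [← nhdsWithin_Ioo_eq_nhdsLT ht.1]
        exact nhdsWithin_mono _ fun x hx => ⟨hx.1, hx.2.le.trans ht.2⟩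
      simpa using h1.mul h2)
  rw [← intervalIntegral.integral_of_le ht.1.le, key]
  ring

/-! ### A priori estimates -/

theorem Mild.enorm_le (h : D.Mild s τ χ f b) {t : ℝ} (ht : t ∈ Ioc s τ) (k : Fin d → ℕ) :
    ‖b t k‖ₑ ≤ ENNReal.ofReal (Real.exp (D.mu k * (t - s))) * ‖χ k‖ₑ
      + ∫⁻ r in Ioc s t, ENNReal.ofReal (Real.exp (D.mu k * (t - r))) * ‖f r k‖ₑ := by
  rw [h.2 t ht k]
  refine (enorm_add_le _ _).trans (add_le_add ?_ ?_)
  · rw [enorm_mul, Real.enorm_of_nonneg (Real.exp_pos _).le]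
  · refine (enorm_integral_le_lintegral_enorm _).trans (le_of_eq ?_)
    refine lintegral_congr fun r => ?_
    rw [enorm_mul, Real.enorm_of_nonneg (Real.exp_pos _).le]

theorem aemeasurable_enorm_coord {F : ℝ → (Fin d → ℕ) → ℝ} {S : Set ℝ} {k : Fin d → ℕ}
    (hF : IntegrableOn (fun r => F r k) S) :
    AEMeasurable (fun r => ‖F r k‖ₑ) (volume.restrict S) :=
  hF.aestronglyMeasurable.enorm

theorem Mild.aemeasurable (h : D.Mild s τ χ f b) (k : Fin d → ℕ) :
    AEMeasurable (fun r => ‖b r k‖ₑ) (volume.restrict (Ioc s τ)) :=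
  ((h.continuousOn k).aestronglyMeasurable measurableSet_Ioc).enorm

/-- The reason for working in `L¹` in time: it commutes with `ℓ¹` over the modes, so vector-valued
estimates follow from scalar ones. -/
theorem lintegral_enrm {m : ℤ} {l : ℝ} {S : Set ℝ} {F : ℝ → (Fin d → ℕ) → ℝ}
    (hF : ∀ k, AEMeasurable (fun r => ‖F r k‖ₑ) (volume.restrict S)) :
    ∫⁻ t in S, expWt l t * D.enrm m (F t)
      = ∑' k, D.wt m k * ∫⁻ t in S, expWt l t * ‖F t k‖ₑ := by
  simp only [enrm]
  simp only [← ENNReal.tsum_mul_left]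
  rw [lintegral_tsum (f := fun k t => expWt l t * (D.wt m k * ‖F t k‖ₑ))
    fun k => (measurable_expWt l).aemeasurable.mul ((hF k).const_mul _)]
  refine tsum_congr fun k => ?_
  rw [← lintegral_const_mul' _ _ (D.wt_ne_top m k)]
  refine lintegral_congr fun t => ?_
  ring

/-- The resolvent estimate: `L¹` maximal regularity. -/
theorem Mild.resolvent_le (h : D.Mild s τ χ f b) (m : ℤ) {l : ℝ} (hl : D.Lam < l) :
    ∫⁻ t in Ioc s τ, expWt l t * D.enrm m (b t)
      ≤ ∑' k, D.wt m k * (ENNReal.ofReal (l - D.mu k)⁻¹ *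
        (expWt l s * ‖χ k‖ₑ + ∫⁻ r in Ioc s τ, expWt l r * ‖f r k‖ₑ)) := by
  rw [lintegral_enrm h.aemeasurable]
  refine ENNReal.tsum_le_tsum fun k => mul_le_mul_right ?_ _
  have hk : D.mu k < l := (D.mu_le k).trans_lt hl
  calc ∫⁻ t in Ioc s τ, expWt l t * ‖b t k‖ₑ
      ≤ ∫⁻ t in Ioc s τ, (expWt l t * ENNReal.ofReal (Real.exp (D.mu k * (t - s))) * ‖χ k‖ₑ
        + expWt l t * ∫⁻ r in Ioc s t, ENNReal.ofReal (Real.exp (D.mu k * (t - r))) * ‖f r k‖ₑ) :=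
        setLIntegral_mono' measurableSet_Ioc fun t ht => by
          rw [mul_assoc, ← mul_add]
          exact mul_le_mul_right (h.enorm_le ht k) _
    _ = (∫⁻ t in Ioc s τ, expWt l t * ENNReal.ofReal (Real.exp (D.mu k * (t - s))) * ‖χ k‖ₑ)
        + ∫⁻ t in Ioc s τ, expWt l t *
          ∫⁻ r in Ioc s t, ENNReal.ofReal (Real.exp (D.mu k * (t - r))) * ‖f r k‖ₑ := by
        refine lintegral_add_left ?_ _
        exact ((measurable_expWt l).mul (by fun_prop)).mul_const _
    _ ≤ ENNReal.ofReal (l - D.mu k)⁻¹ * expWt l s * ‖χ k‖ₑ + ENNReal.ofReal (l - D.mu k)⁻¹ *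
          ∫⁻ r in Ioc s τ, expWt l r * ‖f r k‖ₑ := by
        refine add_le_add ?_ (lintegral_expWt_duhamel_le hk s τ (aemeasurable_enorm_coord (h.1 k)))
        rw [lintegral_mul_const' _ _ enorm_ne_top]
        exact mul_le_mul_left (lintegral_expWt_exp_le hk s τ) _
    _ = _ := by ring

/-- The resolvent gains `p + 1` powers of `θ`. After the `p` powers spent on `𝒬`, one is left. -/
theorem wt_mul_resolvent_le (m : ℤ) {l : ℝ} (hl : D.Lam < l) (k : Fin d → ℕ) :
    D.wt (m + 1) k * ENNReal.ofReal (l - D.mu k)⁻¹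
      ≤ ENNReal.ofReal D.cPar⁻¹ * D.wt (m - D.p) k := by
  have ht := D.theta_pos k
  have hc := D.cPar_pos
  have h1 := D.cPar_mul_le k
  have h2 : 0 < D.cPar * D.theta k ^ (D.p + 1) := by positivity
  unfold wt
  rw [← ENNReal.ofReal_mul (D.wt_real_pos _ k).le, ← ENNReal.ofReal_mul (inv_pos.2 hc).le]
  refine ENNReal.ofReal_le_ofReal ?_
  have h3 : (l - D.mu k)⁻¹ ≤ (D.cPar * D.theta k ^ (D.p + 1))⁻¹ :=
    inv_anti₀ h2 (by linarith)
  refine (mul_le_mul_of_nonneg_left h3 (D.wt_real_pos _ k).le).trans (le_of_eq ?_)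
  have e : D.theta k ^ (m + 1) = D.theta k ^ (m - D.p) * D.theta k ^ (D.p + 1) := by
    rw [← zpow_natCast, ← zpow_add₀ ht.ne']
    congr 1; push_cast; ring
  rw [e]
  field_simp

theorem wt_mul_kap_le (m : ℤ) (k : Fin d → ℕ) : D.wt (m - D.p) k * ‖D.kap k‖ₑ ≤ D.wt m k := by
  have ht := D.theta_pos k
  have hw := D.wt_real_pos (m - D.p) k
  unfold wt
  rw [Real.enorm_eq_ofReal_abs, ← ENNReal.ofReal_mul hw.le]
  refine ENNReal.ofReal_le_ofReal ?_
  refine (mul_le_mul_of_nonneg_left (D.abs_kap_le k) hw.le).trans (le_of_eq ?_)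
  rw [mul_assoc, ← zpow_natCast (D.theta k), ← zpow_add₀ ht.ne', sub_add_cancel]

theorem enrm_kap_le (m : ℤ) (a : (Fin d → ℕ) → ℝ) :
    D.enrm (m - D.p) (fun k => D.kap k * a k) ≤ D.enrm m a := by
  refine ENNReal.tsum_le_tsum fun k => ?_
  rw [enorm_mul, ← mul_assoc]
  exact mul_le_mul_left (D.wt_mul_kap_le m k) _

/-- Smoothing: a gain of one power of `θ`, in `L¹` in time. -/
theorem Mild.smoothing (hM : D.Mild s τ χ (fun r k => D.kap k * h r k) b) (m : ℤ)
    (hh : ∀ k, AEMeasurable (fun r => ‖h r k‖ₑ) (volume.restrict (Ioc s τ)))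
    {l : ℝ} (hl : D.Lam < l) :
    ∫⁻ t in Ioc s τ, expWt l t * D.enrm (m + 1) (b t)
      ≤ ENNReal.ofReal D.cPar⁻¹ * (expWt l s * D.enrm (m - D.p) χ
        + ∫⁻ t in Ioc s τ, expWt l t * D.enrm m (h t)) := by
  refine (hM.resolvent_le (m + 1) hl).trans ?_
  rw [lintegral_enrm hh, enrm, ← ENNReal.tsum_mul_left, ← ENNReal.tsum_add,
    ← ENNReal.tsum_mul_left]
  refine ENNReal.tsum_le_tsum fun k => ?_
  rw [← mul_assoc]
  refine (mul_le_mul_left (wt_mul_resolvent_le m hl k) _).trans ?_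
  rw [mul_assoc, mul_add]
  refine mul_le_mul_right (add_le_add (le_of_eq (by ring)) ?_) _
  have e : ∫⁻ r in Ioc s τ, expWt l r * ‖D.kap k * h r k‖ₑ
      = ‖D.kap k‖ₑ * ∫⁻ r in Ioc s τ, expWt l r * ‖h r k‖ₑ := by
    rw [← lintegral_const_mul' _ _ enorm_ne_top]
    refine lintegral_congr fun r => ?_
    rw [enorm_mul]; ring
  rw [e, ← mul_assoc]
  exact mul_le_mul_left (D.wt_mul_kap_le m k) _

/-- The contraction estimate for zero initial data. -/
theorem Mild.contraction (hM : D.Mild s τ (fun _ => 0) (fun r k => D.kap k * h r k) b) (m : ℤ)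
    (hh : ∀ k, AEMeasurable (fun r => ‖h r k‖ₑ) (volume.restrict (Ioc s τ)))
    {l η : ℝ} (hl : D.Lam < l) (hη : ∀ k, |D.kap k| ≤ η * (l - D.mu k)) :
    ∫⁻ t in Ioc s τ, expWt l t * D.enrm m (b t)
      ≤ ENNReal.ofReal η * ∫⁻ t in Ioc s τ, expWt l t * D.enrm m (h t) := by
  refine (hM.resolvent_le m hl).trans ?_
  rw [lintegral_enrm hh, ← ENNReal.tsum_mul_left]
  refine ENNReal.tsum_le_tsum fun k => ?_
  have e : ∫⁻ r in Ioc s τ, expWt l r * ‖D.kap k * h r k‖ₑ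
      = ‖D.kap k‖ₑ * ∫⁻ r in Ioc s τ, expWt l r * ‖h r k‖ₑ := by
    rw [← lintegral_const_mul' _ _ enorm_ne_top]
    refine lintegral_congr fun r => ?_
    rw [enorm_mul]; ring
  have hk : 0 < l - D.mu k := by linarith [D.mu_le k]
  have e2 : ENNReal.ofReal (l - D.mu k)⁻¹ * ‖D.kap k‖ₑ ≤ ENNReal.ofReal η := by
    rw [Real.enorm_eq_ofReal_abs, ← ENNReal.ofReal_mul (inv_pos.2 hk).le]
    refine ENNReal.ofReal_le_ofReal ?_
    rw [inv_mul_le_iff₀ hk, mul_comm]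
    exact hη k
  rw [e, enorm_zero, mul_zero, zero_add, ← mul_assoc (ENNReal.ofReal _), mul_left_comm]
  exact mul_le_mul_left e2 _

/-- Uniqueness of mild solutions. -/
theorem Mild.eq_zero (hM : D.Mild s τ (fun _ => 0) (fun r k => D.kap k * h r k) b) (m : ℤ)
    (hh : ∀ k, AEMeasurable (fun r => ‖h r k‖ₑ) (volume.restrict (Ioc s τ))) (C : ℝ≥0)
    (hC : ∀ t ∈ Ioc s τ, D.enrm m (h t) ≤ C * D.enrm m (b t))
    (hfin : ∫⁻ t in Ioc s τ, D.enrm m (b t) ≠ ∞) : ∀ t ∈ Ioc s τ, ∀ k, b t k = 0 := by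
  -- With this `η` the contraction estimate and `‖h‖ ≤ C ‖b‖` give `I ≤ I/2` for a finite `I`. The
  -- `+ 1` covers `C = 0`.
  obtain ⟨l₀, hl₀⟩ := D.exists_resolvent_small (2 * ((C : ℝ) + 1))⁻¹ (by positivity)
  obtain ⟨hl, hη⟩ := hl₀ l₀ le_rfl
  set I := ∫⁻ t in Ioc s τ, expWt l₀ t * D.enrm m (b t) with hI
  have hI_top : I ≠ ∞ := (lintegral_expWt_ne_top_iff l₀ s τ _).2 hfin
  have h1 : I ≤ 2⁻¹ * I := by
    refine (hM.contraction m hh hl hη).trans ?_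
    calc ENNReal.ofReal (2 * ((C : ℝ) + 1))⁻¹ * ∫⁻ t in Ioc s τ, expWt l₀ t * D.enrm m (h t)
        ≤ ENNReal.ofReal (2 * ((C : ℝ) + 1))⁻¹ * (C * I) := by
          refine mul_le_mul_right ?_ _
          rw [hI, ← lintegral_const_mul' _ _ ENNReal.coe_ne_top]
          refine setLIntegral_mono' measurableSet_Ioc fun t ht => ?_
          rw [mul_left_comm]
          exact mul_le_mul_right (hC t ht) _
      _ ≤ 2⁻¹ * I := by
          rw [← mul_assoc]
          refine mul_le_mul_left ?_ _
          rw [← ENNReal.ofReal_coe_nnreal, ← ENNReal.ofReal_mul (by positivity)]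
          have : (2⁻¹ : ℝ≥0∞) = ENNReal.ofReal 2⁻¹ := by
            rw [ENNReal.ofReal_inv_of_pos two_pos, ENNReal.ofReal_ofNat]
          rw [this]
          refine ENNReal.ofReal_le_ofReal ?_
          have hC0 : (0 : ℝ) ≤ C := C.2
          rw [inv_mul_le_iff₀ (by positivity)]
          linarith
  have hI0 : I = 0 := by
    by_contra hne
    have : 2⁻¹ * I < 1 * I :=
      ENNReal.mul_lt_mul_left hne hI_top (by simp)
    rw [one_mul] at this
    exact absurd h1 (not_le.2 this)
  have hae : ∀ k, (fun t => expWt l₀ t * ‖b t k‖ₑ) =ᵐ[volume.restrict (Ioc s τ)] 0 := by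
    intro k
    rw [hI, lintegral_enrm hM.aemeasurable, ENNReal.tsum_eq_zero] at hI0
    have := (mul_eq_zero.1 (hI0 k)).resolve_left (D.wt_ne_zero m k)
    exact (lintegral_eq_zero_iff' ((measurable_expWt l₀).aemeasurable.mul (hM.aemeasurable k))).1
      this
  have hae2 : ∀ᵐ t ∂(volume.restrict (Ioc s τ)), ∀ k, h t k = 0 := by
    filter_upwards [ae_all_iff.2 hae, ae_restrict_mem measurableSet_Ioc] with t hb ht k
    have hb0 : D.enrm m (b t) = 0 := by
      rw [enrm, ENNReal.tsum_eq_zero]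
      intro j
      have := (mul_eq_zero.1 (hb j)).resolve_left (expWt_ne_zero _ _)
      rw [this, mul_zero]
    have h0 : D.enrm m (h t) = 0 := by
      have := hC t ht
      rw [hb0, mul_zero] at this
      exact le_antisymm this zero_le
    rw [enrm, ENNReal.tsum_eq_zero] at h0
    have := (mul_eq_zero.1 (h0 k)).resolve_left (D.wt_ne_zero m k)
    simpa using this
  -- So far `h` vanishes almost everywhere; the Duhamel formula with zero data turns this into
  -- vanishing of `b` at every time.
  intro t ht k
  rw [hM.2 t ht k, mul_zero, zero_add]
  refine integral_eq_zero_of_ae ?_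
  filter_upwards [ae_restrict_of_ae_restrict_of_subset (Ioc_subset_Ioc_right ht.2) hae2] with r hr
  simp [hr k]

/-- A bound of all modes that is uniform in time. -/
theorem Mild.exists_bound (hM : D.Mild s τ χ (fun r k => D.kap k * h r k) b) (m : ℤ)
    (hh : ∀ k, AEMeasurable (fun r => ‖h r k‖ₑ) (volume.restrict (Ioc s τ)))
    (hχ : D.enrm m χ ≠ ∞) (hfin : ∫⁻ t in Ioc s τ, D.enrm (m + D.p) (h t) ≠ ∞) :
    ∃ M : (Fin d → ℕ) → ℝ, D.enrm m M ≠ ∞ ∧ ∀ t ∈ Ioc s τ, ∀ k, |b t k| ≤ M k := by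
  -- In each mode the Duhamel formula is bounded by the initial value plus the whole time integral
  -- of the force, up to the largest value `E` of the exponential. No supremum in time of the force
  -- is needed.
  set E : ℝ≥0∞ := ENNReal.ofReal (Real.exp (D.Lam * (τ - s))) with hE
  set F : (Fin d → ℕ) → ℝ≥0∞ := fun k =>
    E * (‖χ k‖ₑ + ∫⁻ r in Ioc s τ, ‖D.kap k * h r k‖ₑ) with hF
  have hF_top : ∀ k, F k ≠ ∞ := fun k =>
    ENNReal.mul_ne_top ENNReal.ofReal_ne_top
      (ENNReal.add_ne_top.2 ⟨enorm_ne_top, (hM.1 k).2.ne⟩)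
  refine ⟨fun k => (F k).toReal, ?_, fun t ht k => ?_⟩
  · have e : D.enrm m (fun k => (F k).toReal) = E * (D.enrm m χ
        + ∑' k, D.wt m k * ∫⁻ r in Ioc s τ, ‖D.kap k * h r k‖ₑ) := by
      unfold enrm
      rw [← ENNReal.tsum_add, ← ENNReal.tsum_mul_left]
      refine tsum_congr fun k => ?_
      rw [Real.enorm_of_nonneg ENNReal.toReal_nonneg, ENNReal.ofReal_toReal (hF_top k), hF]
      ring
    rw [e]
    refine ENNReal.mul_ne_top ENNReal.ofReal_ne_top (ENNReal.add_ne_top.2 ⟨hχ, ?_⟩)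
    have h1 := lintegral_enrm (D := D) (m := m + D.p) (l := 0) hh
    have h0 : ∀ t, expWt 0 t = 1 := fun t => by simp [expWt]
    simp only [h0, one_mul] at h1
    refine ne_top_of_le_ne_top hfin ?_
    rw [h1]
    refine ENNReal.tsum_le_tsum fun k => ?_
    simp only [enorm_mul]
    rw [lintegral_const_mul' _ _ enorm_ne_top, ← mul_assoc]
    refine mul_le_mul_left ?_ _
    simpa using D.wt_mul_kap_le (m + D.p) k
  · have hexp : ∀ r ∈ Icc s t, ENNReal.ofReal (Real.exp (D.mu k * (t - r))) ≤ E := by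
      intro r hr
      refine ENNReal.ofReal_le_ofReal (Real.exp_le_exp.2 ?_)
      have h1 : D.mu k * (t - r) ≤ D.Lam * (t - r) :=
        mul_le_mul_of_nonneg_right (D.mu_le k) (by linarith [hr.2])
      have h2 : D.Lam * (t - r) ≤ D.Lam * (τ - s) :=
        mul_le_mul_of_nonneg_left (by linarith [hr.1, ht.2]) D.Lam_nonneg
      linarith
    have h1 : ‖b t k‖ₑ ≤ F k := by
      refine (hM.enorm_le ht k).trans ?_
      rw [hF]
      simp only [mul_add]
      refine add_le_add (mul_le_mul_left (hexp s (left_mem_Icc.2 ht.1.le)) _) ?_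
      rw [← lintegral_const_mul' _ _ ENNReal.ofReal_ne_top]
      refine (setLIntegral_mono' measurableSet_Ioc fun r hr =>
        mul_le_mul_left (hexp r (Ioc_subset_Icc_self hr)) _).trans ?_
      exact lintegral_mono_set (Ioc_subset_Ioc_right ht.2)
    rw [← Real.norm_eq_abs, ← toReal_enorm]
    exact ENNReal.toReal_mono (hF_top k) h1

end Setting

/-! ### Smoothing and classical regularity of mild solutions -/

theorem contDiffOn_one_of_hasDerivWithinAt {E : Type*} [NormedAddCommGroup E] [NormedSpace ℝ E]
    {S : Set ℝ} (hS : UniqueDiffOn ℝ S) {B B' : ℝ → E}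
    (h : ∀ t ∈ S, HasDerivWithinAt B (B' t) S t) (hc : ContinuousOn B' S) :
    ContDiffOn ℝ 1 B S :=
  (contDiffOn_one_iff_derivWithin hS).2 ⟨fun t ht => (h t ht).differentiableWithinAt,
    hc.congr fun t ht => (h t ht).derivWithin (hS t ht)⟩

namespace Setting

variable {d : ℕ} {D : Setting d} {s τ : ℝ} {χ : (Fin d → ℕ) → ℝ} {h b : ℝ → (Fin d → ℕ) → ℝ}

theorem lintegral_Ioc_const_ne_top (c : ℝ≥0) (s τ : ℝ) : ∫⁻ _ in Ioc s τ, (c : ℝ≥0∞) ≠ ∞ := by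
  rw [setLIntegral_const, Real.volume_Ioc]
  exact ENNReal.mul_ne_top ENNReal.coe_ne_top ENNReal.ofReal_ne_top

theorem lintegral_affine_ne_top {C : ℝ≥0} {F G : ℝ → ℝ≥0∞}
    (hFG : ∀ t ∈ Ioc s τ, G t ≤ C * (1 + F t)) (hF : ∫⁻ t in Ioc s τ, F t ≠ ∞) :
    ∫⁻ t in Ioc s τ, G t ≠ ∞ := by
  refine ne_top_of_le_ne_top ?_ (setLIntegral_mono' measurableSet_Ioc hFG)
  rw [lintegral_const_mul' _ _ ENNReal.coe_ne_top, lintegral_add_left measurable_const]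
  exact ENNReal.mul_ne_top ENNReal.coe_ne_top
    (ENNReal.add_ne_top.2 ⟨lintegral_Ioc_const_ne_top 1 s τ, hF⟩)

/-- Finiteness in `L¹` provides a time at which a norm is finite, from which the solution can be
restarted. No measurability of `F` is needed. -/
theorem exists_lt_top_of_lintegral {F : ℝ → ℝ≥0∞} (hF : ∫⁻ t in Ioc s τ, F t ≠ ∞) (hsτ : s < τ) :
    ∃ t ∈ Ioo s τ, F t ≠ ∞ := by
  by_contra! hcon
  refine hF (top_le_iff.1 ?_)
  calc (∞ : ℝ≥0∞) = ∫⁻ _ in Ioo s τ, ∞ := by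
        rw [setLIntegral_const, Real.volume_Ioo, ENNReal.top_mul]
        exact (ENNReal.ofReal_pos.2 (sub_pos.2 hsτ)).ne'
    _ ≤ ∫⁻ t in Ioo s τ, F t := setLIntegral_mono' measurableSet_Ioo fun t ht => (hcon t ht).ge
    _ ≤ _ := lintegral_mono_set Ioo_subset_Ioc_self

/-- Parabolic smoothing of mild solutions, in `L¹` in time. -/
theorem Mild.bootstrap (hM : D.Mild s τ χ (fun r k => D.kap k * h r k) b)
    (hh : ∀ m : ℕ, ∃ C : ℝ≥0, ∀ t ∈ Ioc s τ, D.enrm m (h t) ≤ C * (1 + D.enrm m (b t)))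
    (hc : ∀ k, ContinuousOn (fun t => h t k) (Ioc s τ))
    (h0 : ∫⁻ t in Ioc s τ, D.enrm 0 (b t) ≠ ∞) (m : ℕ) :
    ∀ t₀ ∈ Ioo s τ, ∫⁻ t in Ioc t₀ τ, D.enrm m (b t) ≠ ∞ := by
  induction m with
  | zero =>
    intro t₀ ht₀
    exact ne_top_of_le_ne_top h0 (lintegral_mono_set (Ioc_subset_Ioc_left ht₀.1.le))
  | succ m ih =>
    intro t₀ ht₀
    -- The induction hypothesis holds from `t₁` on, so the norm of order `m` is finite at some `t₂ ∈
    -- (t₁, t₀)`. The solution restarted at `t₂` gains one power of `θ`.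
    obtain ⟨t₁, ht₁⟩ := exists_between ht₀.1
    have ht₁' : t₁ ∈ Ioo s τ := ⟨ht₁.1, ht₁.2.trans ht₀.2⟩
    obtain ⟨t₂, ht₂, hfin⟩ := exists_lt_top_of_lintegral
      (ne_top_of_le_ne_top (ih t₁ ht₁') (lintegral_mono_set (Ioc_subset_Ioc_right ht₀.2.le))) ht₁.2
    have ht₂' : t₂ ∈ Ioc s τ := ⟨ht₁.1.trans ht₂.1, ht₂.2.le.trans ht₀.2.le⟩
    have hsub : Ioc t₂ τ ⊆ Ioc s τ := Ioc_subset_Ioc_left ht₂'.1.le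
    have hR := hM.restart ht₂'
    obtain ⟨C, hC⟩ := hh m
    have hL : D.Lam < D.Lam + 1 := by linarith
    have key := hR.smoothing (m : ℤ)
      (fun k => (((hc k).mono hsub).aestronglyMeasurable measurableSet_Ioc).enorm) hL
    have hb : ∫⁻ t in Ioc t₂ τ, D.enrm m (b t) ≠ ∞ :=
      ih t₂ ⟨ht₂'.1, ht₂.2.trans ht₀.2⟩
    have hfin2 : ∫⁻ t in Ioc t₂ τ, D.enrm m (h t) ≠ ∞ :=
      lintegral_affine_ne_top (fun t ht => hC t (hsub ht)) hb
    have hfin3 : D.enrm (m - D.p : ℤ) (b t₂) ≠ ∞ :=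
      ne_top_of_le_ne_top hfin (D.enrm_mono (by omega) _)
    have h4 : ∫⁻ t in Ioc t₂ τ, D.enrm (m + 1 : ℤ) (b t) ≠ ∞ := by
      rw [← lintegral_expWt_ne_top_iff (D.Lam + 1)]
      refine ne_top_of_le_ne_top ?_ key
      exact ENNReal.mul_ne_top ENNReal.ofReal_ne_top (ENNReal.add_ne_top.2
        ⟨ENNReal.mul_ne_top (expWt_ne_top _ _) hfin3,
          (lintegral_expWt_ne_top_iff _ _ _ _).2 hfin2⟩)
    push_cast
    exact ne_top_of_le_ne_top h4 (lintegral_mono_set (Ioc_subset_Ioc_left ht₂.2.le))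

/-- Passes from `L¹` in time to a majorant uniform in time: restart at a time of finite norm and
apply `Mild.exists_bound`. The `p` powers lost to `𝒬` are covered by the bootstrap at order `m + p`.
-/
theorem Mild.smooth_bound (hM : D.Mild s τ χ (fun r k => D.kap k * h r k) b)
    (hh : ∀ m : ℕ, ∃ C : ℝ≥0, ∀ t ∈ Ioc s τ, D.enrm m (h t) ≤ C * (1 + D.enrm m (b t)))
    (hc : ∀ k, ContinuousOn (fun t => h t k) (Ioc s τ))
    (h0 : ∫⁻ t in Ioc s τ, D.enrm 0 (b t) ≠ ∞) (m : ℕ) {t₀ : ℝ} (ht₀ : t₀ ∈ Ioo s τ) :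
    ∃ M : (Fin d → ℕ) → ℝ, D.enrm m M ≠ ∞ ∧ ∀ t ∈ Ioc t₀ τ, ∀ k, |b t k| ≤ M k := by
  have hboot := hM.bootstrap hh hc h0
  obtain ⟨t₁, ht₁⟩ := exists_between ht₀.1
  have ht₁' : t₁ ∈ Ioo s τ := ⟨ht₁.1, ht₁.2.trans ht₀.2⟩
  obtain ⟨t₂, ht₂, hfin⟩ := exists_lt_top_of_lintegral
    (ne_top_of_le_ne_top (hboot m t₁ ht₁') (lintegral_mono_set (Ioc_subset_Ioc_right ht₀.2.le)))
    ht₁.2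
  have ht₂' : t₂ ∈ Ioc s τ := ⟨ht₁.1.trans ht₂.1, ht₂.2.le.trans ht₀.2.le⟩
  have hsub : Ioc t₂ τ ⊆ Ioc s τ := Ioc_subset_Ioc_left ht₂'.1.le
  obtain ⟨C, hC⟩ := hh (m + D.p)
  obtain ⟨M, hM1, hM2⟩ := (hM.restart ht₂').exists_bound (m : ℤ)
    (fun k => (((hc k).mono hsub).aestronglyMeasurable measurableSet_Ioc).enorm) hfin
    (by
      have := lintegral_affine_ne_top (fun t ht => hC t (hsub ht))
        (hboot (m + D.p) t₂ ⟨ht₂'.1, ht₂.2.trans ht₀.2⟩)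
      exact_mod_cast this)
  exact ⟨M, hM1, fun t ht => hM2 t ⟨ht₂.2.trans ht.1, ht.2⟩⟩

/-- Sequences that are bounded in every weighted norm have a common majorant. -/
theorem exists_majorant {S : Set ℝ} (H : ∀ m : ℕ, ∃ R : ℝ≥0, ∀ t ∈ S, D.enrm m (h t) ≤ R) (m : ℕ) :
    ∃ M : (Fin d → ℕ) → ℝ, D.enrm m M ≠ ∞ ∧ ∀ t ∈ S, ∀ k, |h t k| ≤ M k := by
  obtain ⟨n, hn⟩ := D.exists_tsum_theta_ne_top
  obtain ⟨R, hR⟩ := H (m + n)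
  have hpos := fun k => D.wt_real_pos (m + n : ℕ) k
  -- A bound in the norm of order `m + n` bounds each coefficient by its inverse weight; the spare
  -- `n` powers of `θ` make these bounds summable with weight `ω_k θ_k^m`.
  refine ⟨fun k => R * (D.omega k * D.theta k ^ ((m + n : ℕ) : ℤ))⁻¹, ?_, fun t ht k => ?_⟩
  · refine ne_top_of_le_ne_top (ENNReal.mul_ne_top (ENNReal.coe_ne_top (r := R)) hn) ?_
    rw [enrm, ← ENNReal.tsum_mul_left]
    refine ENNReal.tsum_le_tsum fun k => le_of_eq ?_
    have ht := D.theta_pos k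
    have ho := (D.omega k).2
    have hp := hpos k
    rw [Real.enorm_of_nonneg (mul_nonneg R.coe_nonneg (inv_pos.2 hp).le), wt,
      ← ENNReal.ofReal_mul (D.wt_real_pos _ k).le, ← ENNReal.ofReal_coe_nnreal,
      ← ENNReal.ofReal_mul R.coe_nonneg]
    congr 1
    push_cast
    rw [zpow_add₀ ht.ne', zpow_neg]
    field_simp
  · have h1 := (D.wt_mul_enorm_le_enrm (m + n : ℕ) (h t) k).trans (hR t ht)
    rw [wt, Real.enorm_eq_ofReal_abs, ← ENNReal.ofReal_mul (hpos k).le, ← ENNReal.ofReal_coe_nnreal,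
      ENNReal.ofReal_le_ofReal_iff R.coe_nonneg] at h1
    change _ ≤ (R : ℝ) * _
    rw [← div_eq_mul_inv, le_div_iff₀ (hpos k), mul_comm]
    exact h1

theorem summable_of_majorant {M : (Fin d → ℕ) → ℝ} (h0 : ∀ k, 0 ≤ M k) (h : D.enrm 0 M ≠ ∞) :
    Summable fun k => M k * (D.omega k : ℝ) := by
  have := D.summable_of_enrm_ne_top h
  refine this.congr fun k => ?_
  rw [abs_of_nonneg (h0 k), zpow_zero, mul_one]

/-- Classical regularity of mild solutions. -/
theorem Mild.regularity {B : ℝ → D.Ell}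
    (hM : D.Mild s τ χ (fun r k => D.kap k * h r k) (fun t k => B t k))
    (hh : ∀ m : ℕ, ∃ C : ℝ≥0, ∀ t ∈ Ioc s τ, D.enrm m (h t) ≤ C * (1 + D.enrm m (B t)))
    (hc : ∀ k, ContinuousOn (fun t => h t k) (Ioc s τ))
    (h0 : ∫⁻ t in Ioc s τ, D.enrm 0 (B t) ≠ ∞) :
    ∃ B' : ℝ → D.Ell, (∀ t ∈ Ioc s τ, ∀ k, B' t k = D.mu k * B t k + D.kap k * h t k) ∧
      ContinuousOn B' (Ioc s τ) ∧
      (∀ t ∈ Ioc s τ, HasDerivWithinAt B (B' t) (Ioc s τ) t) ∧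
      D.MemD s τ B ∧ ∀ t ∈ Ioc s τ, ∀ m : ℕ, D.enrm m (B t) ≠ ∞ := by
  have hb := fun (m : ℕ) (t₀ : ℝ) (ht₀ : t₀ ∈ Ioo s τ) => hM.smooth_bound hh hc h0 m ht₀
  -- all quantities are bounded in every weighted norm, locally uniformly in time
  have hbB : ∀ t₀ ∈ Ioo s τ, ∀ m : ℕ, ∃ R : ℝ≥0, ∀ t ∈ Ioc t₀ τ, D.enrm m (B t) ≤ R := by
    intro t₀ ht₀ m
    obtain ⟨M, hM1, hM2⟩ := hb m t₀ ht₀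
    refine ⟨(D.enrm m M).toNNReal, fun t ht => ?_⟩
    rw [ENNReal.coe_toNNReal hM1]
    exact D.enrm_le_of_abs_le fun k => (hM2 t ht k).trans (le_abs_self _)
  obtain ⟨Cμ, hCμ0, hCμ⟩ := D.exists_abs_mu_le
  have hμ : ∀ (m : ℕ) (a : (Fin d → ℕ) → ℝ), D.enrm m (fun k => D.mu k * a k)
      ≤ ENNReal.ofReal Cμ * D.enrm (m + 2 : ℕ) a := by
    intro m a
    rw [enrm, enrm, ← ENNReal.tsum_mul_left]
    refine ENNReal.tsum_le_tsum fun k => ?_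
    rw [enorm_mul, ← mul_assoc, ← mul_assoc]
    refine mul_le_mul_left ?_ _
    push_cast
    rw [wt_add, mul_left_comm]
    refine mul_le_mul_right ?_ _
    rw [Real.enorm_eq_ofReal_abs, ← ENNReal.ofReal_mul hCμ0]
    exact ENNReal.ofReal_le_ofReal (by exact_mod_cast hCμ k)
  have hbμ : ∀ t₀ ∈ Ioo s τ, ∀ m : ℕ, ∃ R : ℝ≥0, ∀ t ∈ Ioc t₀ τ,
      D.enrm m (fun k => D.mu k * B t k) ≤ R := by
    intro t₀ ht₀ m
    obtain ⟨R, hR⟩ := hbB t₀ ht₀ (m + 2)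
    refine ⟨Cμ.toNNReal * R, fun t ht => (hμ m _).trans ?_⟩
    rw [ENNReal.coe_mul]
    exact mul_le_mul_right (hR t ht) _
  have hbh : ∀ t₀ ∈ Ioo s τ, ∀ m : ℕ, ∃ R : ℝ≥0, ∀ t ∈ Ioc t₀ τ,
      D.enrm m (fun k => D.kap k * h t k) ≤ R := by
    intro t₀ ht₀ m
    obtain ⟨R, hR⟩ := hbB t₀ ht₀ (m + D.p)
    obtain ⟨C, hC⟩ := hh (m + D.p)
    refine ⟨C * (1 + R), fun t ht => ?_⟩
    have h1 := D.enrm_kap_le (m + D.p : ℕ) (h t)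
    have e : (((m + D.p : ℕ) : ℤ) - D.p) = m := by push_cast; ring
    rw [e] at h1
    refine (h1.trans (hC t ⟨ht₀.1.trans ht.1, ht.2⟩)).trans ?_
    push_cast
    gcongr
    exact hR t ht
  have hb' : ∀ t₀ ∈ Ioo s τ, ∀ m : ℕ, ∃ R : ℝ≥0, ∀ t ∈ Ioc t₀ τ,
      D.enrm m (fun k => D.mu k * B t k + D.kap k * h t k) ≤ R := by
    intro t₀ ht₀ m
    obtain ⟨R, hR⟩ := hbμ t₀ ht₀ m
    obtain ⟨R', hR'⟩ := hbh t₀ ht₀ m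
    exact ⟨R + R', fun t ht => (D.enrm_add_le _ _ _).trans
      (by push_cast; exact add_le_add (hR t ht) (hR' t ht))⟩
  have hmem : ∀ t ∈ Ioc s τ, ∃ t₀ ∈ Ioo s τ, t ∈ Ioc t₀ τ := by
    intro t ht
    obtain ⟨t₀, ht₀⟩ := exists_between ht.1
    exact ⟨t₀, ⟨ht₀.1, ht₀.2.trans_le ht.2⟩, ht₀.2, ht.2⟩
  have hnhds : ∀ t₀ ∈ Ioo s τ, ∀ t ∈ Ioc t₀ τ, Ioc t₀ τ ∈ 𝓝[Ioc s τ] t := by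
    intro t₀ ht₀ t ht
    rw [← Ioi_inter_Iic, ← Ioi_inter_Iic]
    exact inter_mem (mem_nhdsWithin_of_mem_nhds (Ioi_mem_nhds ht.1))
      (mem_of_superset self_mem_nhdsWithin inter_subset_right)
  have hell : ∀ (F : ℝ → (Fin d → ℕ) → ℝ), (∀ t₀ ∈ Ioo s τ, ∀ m : ℕ, ∃ R : ℝ≥0, ∀ t ∈ Ioc t₀ τ,
      D.enrm m (F t) ≤ R) → ∀ t ∈ Ioc s τ, F t ∈ ell1Submodule D.omega := by
    intro F hF t ht
    obtain ⟨t₀, ht₀, ht'⟩ := hmem t ht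
    obtain ⟨R, hR⟩ := hF t₀ ht₀ 0
    rw [mem_ell_iff]
    exact ne_top_of_le_ne_top ENNReal.coe_ne_top (hR t ht')
  -- Continuity is local, and on each `(t₀, τ]` there is a common majorant, although none need exist
  -- up to `s`.
  have hcont : ∀ (F : ℝ → D.Ell), (∀ t₀ ∈ Ioo s τ, ∀ m : ℕ, ∃ R : ℝ≥0, ∀ t ∈ Ioc t₀ τ,
      D.enrm m (F t) ≤ R) → (∀ k, ContinuousOn (fun t => F t k) (Ioc s τ)) →
      ContinuousOn F (Ioc s τ) := by
    intro F hF hFk t ht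
    obtain ⟨t₀, ht₀, ht'⟩ := hmem t ht
    obtain ⟨M, hM1, hM2⟩ := exists_majorant (h := fun t k => F t k) (hF t₀ ht₀) 0
    have h1 := Ell1.continuousOn_of_dominated (S := Ioc t₀ τ) (B := F) (M := M)
      (summable_of_majorant (fun k => (abs_nonneg _).trans (hM2 τ ⟨ht₀.2, le_rfl⟩ k))
        (by exact_mod_cast hM1))
      (fun k => (hFk k).mono (Ioc_subset_Ioc_left ht₀.1.le)) hM2
    exact (h1 t ht').mono_of_mem_nhdsWithin (hnhds t₀ ht₀ t ht')
  have hBk := hM.continuousOn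
  have hder := fun k => fun (t : ℝ) (ht : t ∈ Ioc s τ) =>
    hM.hasDerivWithinAt (k := k) (continuousOn_const.mul (hc k)) ht
  classical
  -- The sequence is known to lie in `ℓ¹_ω` only for `t ∈ (s, τ]`; outside, the value zero is never
  -- used.
  set B' : ℝ → D.Ell := fun t => if ht : t ∈ Ioc s τ then
    Ell1.mk _ (hell _ hb' t ht) else 0 with hB'
  have hB'eq : ∀ t ∈ Ioc s τ, ∀ k, B' t k = D.mu k * B t k + D.kap k * h t k := by
    intro t ht k
    rw [hB']
    simp only [dif_pos ht, Ell1.mk_apply]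
  have hB'b : ∀ t₀ ∈ Ioo s τ, ∀ m : ℕ, ∃ R : ℝ≥0, ∀ t ∈ Ioc t₀ τ, D.enrm m (B' t) ≤ R := by
    intro t₀ ht₀ m
    obtain ⟨R, hR⟩ := hb' t₀ ht₀ m
    refine ⟨R, fun t ht => ?_⟩
    have e : (B' t : (Fin d → ℕ) → ℝ) = fun k => D.mu k * B t k + D.kap k * h t k :=
      funext (hB'eq t ⟨ht₀.1.trans ht.1, ht.2⟩)
    rw [e]
    exact hR t ht
  have hB'c : ContinuousOn B' (Ioc s τ) := by
    refine hcont B' hB'b fun k => ?_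
    refine ContinuousOn.congr (f := fun t => D.mu k * B t k + D.kap k * h t k) ?_
      (fun t ht => hB'eq t ht k)
    exact (continuousOn_const.mul (hBk k)).add (continuousOn_const.mul (hc k))
  have hderiv : ∀ t ∈ Ioc s τ, HasDerivWithinAt B (B' t) (Ioc s τ) t := by
    intro t ht
    obtain ⟨t₀, ht₀, ht'⟩ := hmem t ht
    have hsub : Ioc t₀ τ ⊆ Ioc s τ := Ioc_subset_Ioc_left ht₀.1.le
    obtain ⟨M, hM1, hM2⟩ := exists_majorant (h := fun t k => B' t k) (hB'b t₀ ht₀) 0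
    have h1 := Ell1.hasDerivWithinAt_of_dominated (S := Ioc t₀ τ) (convex_Ioc _ _) (B := B)
      (B' := B') (M := M)
      (summable_of_majorant (fun k => (abs_nonneg _).trans (hM2 τ ⟨ht₀.2, le_rfl⟩ k))
        (by exact_mod_cast hM1))
      (fun k t ht => by
        rw [hB'eq t (hsub ht) k]
        exact (hder k t (hsub ht)).mono hsub) hM2 ht'
    exact h1.mono_of_mem_nhdsWithin (hnhds t₀ ht₀ t ht')
  have hdom : ∀ t : Ioc s τ, B t ∈ D.Lop.domain := fun t => hell _ hbμ t t.2
  refine ⟨B', hB'eq, hB'c, hderiv, ⟨fun t ht => (hderiv t ht).continuousWithinAt, ⟨hdom, ?_⟩, ?_⟩,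
    fun t ht m => ?_⟩
  · set G : ℝ → D.Ell := fun t => if ht : t ∈ Ioc s τ then
      Ell1.mk _ (hell _ hbμ t ht) else 0 with hG
    have hGeq : ∀ t ∈ Ioc s τ, ∀ k, G t k = D.mu k * B t k := by
      intro t ht k
      rw [hG]
      simp only [dif_pos ht, Ell1.mk_apply]
    have hGc : ContinuousOn G (Ioc s τ) := by
      refine hcont G (fun t₀ ht₀ m => ?_) fun k => ?_
      · obtain ⟨R, hR⟩ := hbμ t₀ ht₀ m
        refine ⟨R, fun t ht => ?_⟩
        have e : (G t : (Fin d → ℕ) → ℝ) = fun k => D.mu k * B t k :=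
          funext (hGeq t ⟨ht₀.1.trans ht.1, ht.2⟩)
        rw [e]
        exact hR t ht
      · exact ContinuousOn.congr (f := fun t => D.mu k * B t k) (continuousOn_const.mul (hBk k))
          (fun t ht => hGeq t ht k)
    have h1 := continuousOn_iff_continuous_domRestrict.1 hGc
    refine h1.congr fun t => ?_
    ext k
    exact hGeq t t.2 k
  · exact contDiffOn_one_of_hasDerivWithinAt (uniqueDiffOn_Ioo s τ)
      (fun t ht => (hderiv t (Ioo_subset_Ioc_self ht)).mono Ioo_subset_Ioc_self)
      (hB'c.mono Ioo_subset_Ioc_self)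
  · obtain ⟨t₀, ht₀, ht'⟩ := hmem t ht
    obtain ⟨R, hR⟩ := hbB t₀ ht₀ m
    exact ne_top_of_le_ne_top ENNReal.coe_ne_top (hR t ht')

end Setting

/-! ### The linear equation with a finitely supported kernel: the Picard series -/

namespace Setting

variable {d : ℕ}

/-- A time-dependent convolution kernel with uniformly finite support. -/
structure IsKernel (g : ℝ → (Fin d → ℕ) → ℝ) (B : ℕ) : Prop where
  boxSupp : ∀ r, BoxSupp B (g r)
  continuous : ∀ k, Continuous fun r => g r k

section Kernel

variable {D : Setting d} {g : ℝ → (Fin d → ℕ) → ℝ} {B : ℕ} {s τ : ℝ}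

/-- Finitely many continuous coefficients are bounded in every norm on `[0, τ]`. Hence the kernel
acts boundedly for each `m`, in particular for `m = -p`. -/
theorem IsKernel.exists_bound (hg : IsKernel g B) (D : Setting d) (τ : ℝ) (m : ℤ) :
    ∃ C : ℝ≥0, ∀ r ∈ Icc 0 τ, ∀ b, D.enrm m (convSeq (g r) b) ≤ C * D.enrm m b := by
  choose R hR using fun k => isCompact_Icc.exists_bound_of_continuousOn (s := Icc 0 τ)
    (hg.continuous k).continuousOn
  set S : Finset (Fin d → ℕ) := Fintype.piFinset fun _ => Finset.range B
  have hfin : ∑ k ∈ S, D.wt m.natAbs k * ENNReal.ofReal (R k) ≠ ∞ :=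
    ENNReal.sum_ne_top.2 fun k _ => ENNReal.mul_ne_top (D.wt_ne_top _ k) ENNReal.ofReal_ne_top
  refine ⟨(ENNReal.ofReal (2 ^ m.natAbs)
    * ∑ k ∈ S, D.wt m.natAbs k * ENNReal.ofReal (R k)).toNNReal, fun r hr b => ?_⟩
  rw [ENNReal.coe_toNNReal (ENNReal.mul_ne_top ENNReal.ofReal_ne_top hfin)]
  refine (D.enrm_convSeq_le m _ _).trans ?_
  rw [← mul_assoc]
  refine mul_le_mul_left (mul_le_mul_right ?_ _) _
  rw [enrm, tsum_eq_sum (s := S)]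
  · refine Finset.sum_le_sum fun k _ => mul_le_mul_right ?_ _
    rw [← ofReal_norm]
    exact ENNReal.ofReal_le_ofReal (hR k r hr)
  · intro k hk
    simp only [S, Fintype.mem_piFinset, Finset.mem_range, not_forall, not_lt] at hk
    obtain ⟨i, hi⟩ := hk
    rw [hg.boxSupp r k i hi, enorm_zero, mul_zero]

theorem IsKernel.continuousOn_conv (hg : IsKernel g B) {b : ℝ → (Fin d → ℕ) → ℝ} {S : Set ℝ}
    (hb : ∀ k, ContinuousOn (fun t => b t k) S) (k : Fin d → ℕ) :
    ContinuousOn (fun t => convSeq (g t) (b t) k) S := by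
  simp only [convSeq_eq_sum (hg.boxSupp _)]
  exact continuousOn_finsetSum _ fun l _ => (hg.continuous _).continuousOn.mul (hb _)

theorem IsKernel.integrableOn_conv (hg : IsKernel g B) {b : ℝ → (Fin d → ℕ) → ℝ}
    (hb : ∀ k, IntegrableOn (fun t => b t k) (Ioc s τ)) (k : Fin d → ℕ) :
    IntegrableOn (fun t => convSeq (g t) (b t) k) (Ioc s τ) := by
  simp only [convSeq_eq_sum (hg.boxSupp _)]
  refine integrable_finsetSum _ fun l _ => ?_
  have h1 := hb (absIdx ((fun i => (k i : ℤ)) - l))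
  change IntegrableOn _ _ _
  rw [← integrableOn_Icc_iff_integrableOn_Ioc
    (by exact enorm_ne_top)] at h1 ⊢
  exact h1.continuousOn_mul (hg.continuous _).continuousOn isCompact_Icc

theorem IsKernel.conv_sub (hg : IsKernel g B) (r : ℝ) (b b' : (Fin d → ℕ) → ℝ) (k : Fin d → ℕ) :
    convSeq (g r) (fun k => b k - b' k) k = convSeq (g r) b k - convSeq (g r) b' k := by
  simp only [convSeq_eq_sum (hg.boxSupp _), mul_sub, Finset.sum_sub_distrib]

end Kernel

variable (D : Setting d) (g : ℝ → (Fin d → ℕ) → ℝ)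

/-- Picard iterates for `ḃ = ℒ b + 𝒬 (g * b)`, `b(s) = P(s)`, as functions of `t` and `s`. -/
def picard (P : ℝ → (Fin d → ℕ) → ℝ) : ℕ → ℝ → ℝ → (Fin d → ℕ) → ℝ
  | 0 => fun t s k => Real.exp (D.mu k * (t - s)) * P s k
  | n + 1 => fun t s k => ∫ r in Ioc s t,
      Real.exp (D.mu k * (t - r)) * (D.kap k * convSeq (g r) (picard P n r s) k)

/-- The sum of the Picard series. -/
def evol (P : ℝ → (Fin d → ℕ) → ℝ) (t s : ℝ) (k : Fin d → ℕ) : ℝ := ∑' n, D.picard g P n t s k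

theorem picard_congr {P P' : ℝ → (Fin d → ℕ) → ℝ} {s : ℝ} (h : P s = P' s) (n : ℕ) (t : ℝ) :
    D.picard g P n t s = D.picard g P' n t s := by
  induction n generalizing t with
  | zero => funext k; simp only [picard, h]
  | succ n ih => funext k; simp only [picard, ih]

/-- Only the value at `s` matters. A constant datum, as in `U`, and a family `s ↦ P(s)`, as in the
variation of constants, give the same evolution. -/
theorem evol_congr {P P' : ℝ → (Fin d → ℕ) → ℝ} {s : ℝ} (h : P s = P' s) (t : ℝ) :
    D.evol g P t s = D.evol g P' t s := by
  funext k
  simp only [evol, D.picard_congr g h]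

variable {D g} {B : ℕ} {P : ℝ → (Fin d → ℕ) → ℝ} {s τ : ℝ}

/-- Joint measurability in `(t, s)` is what Fubini's theorem will need. It is inherited by parameter
integrals, hence by each iterate. -/
theorem measurable_picard (hg : IsKernel g B) (hP : ∀ k, Measurable fun s => P s k) (n : ℕ) :
    ∀ k, Measurable fun x : ℝ × ℝ => D.picard g P n x.1 x.2 k := by
  induction n with
  | zero =>
    intro k
    have : Measurable fun x : ℝ × ℝ => P x.2 k := (hP k).comp measurable_snd
    exact Measurable.mul (by fun_prop) this
  | succ n ih =>
    intro k
    -- The variable interval becomes a cut-off in the integrand, so that the integral is taken over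
    -- a fixed space.
    have e : (fun x : ℝ × ℝ => D.picard g P (n + 1) x.1 x.2 k) = fun x : ℝ × ℝ => ∫ r,
        if x.2 < r ∧ r ≤ x.1 then Real.exp (D.mu k * (x.1 - r)) * (D.kap k *
          ∑ l ∈ intBox d B, g r (absIdx l) *
            D.picard g P n r x.2 (absIdx ((fun i => (k i : ℤ)) - l))) else 0 := by
      funext x
      simp only [picard]
      rw [← integral_indicator measurableSet_Ioc]
      refine integral_congr_ae (Eventually.of_forall fun r => ?_)
      simp only [indicator, mem_Ioc, convSeq_eq_sum (hg.boxSupp _)]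
    rw [e]
    refine (StronglyMeasurable.integral_prod_right (ν := volume)
      (f := fun (x : ℝ × ℝ) (r : ℝ) =>
        if x.2 < r ∧ r ≤ x.1 then Real.exp (D.mu k * (x.1 - r)) * (D.kap k *
          ∑ l ∈ intBox d B, g r (absIdx l) *
            D.picard g P n r x.2 (absIdx ((fun i => (k i : ℤ)) - l))) else 0) ?_).measurable
    refine Measurable.stronglyMeasurable ?_
    refine Measurable.ite ?_ ?_ measurable_const
    · exact (measurableSet_lt (measurable_snd.comp measurable_fst) measurable_snd).inter
        (measurableSet_le measurable_snd (measurable_fst.comp measurable_fst))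
    · refine Measurable.mul (by fun_prop) (measurable_const.mul ?_)
      refine Finset.measurable_fun_sum _ fun l _ => ?_
      refine ((hg.continuous _).measurable.comp measurable_snd).mul ?_
      exact (ih _).comp (measurable_snd.prodMk (measurable_snd.comp measurable_fst))

theorem integrableOn_of_lintegral_enrm {m : ℤ} {b : ℝ → (Fin d → ℕ) → ℝ} {S : Set ℝ}
    (hb : ∀ k, AEStronglyMeasurable (fun t => b t k) (volume.restrict S))
    (hfin : ∫⁻ t in S, D.enrm m (b t) ≠ ∞) (k : Fin d → ℕ) :
    IntegrableOn (fun t => b t k) S := by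
  refine ⟨hb k, ?_⟩
  have h1 : D.wt m k * ∫⁻ t in S, ‖b t k‖ₑ ≤ ∫⁻ t in S, D.enrm m (b t) := by
    rw [← lintegral_const_mul' _ _ (D.wt_ne_top m k)]
    exact lintegral_mono fun t => D.wt_mul_enorm_le_enrm m (b t) k
  have h2 : D.wt m k * ∫⁻ t in S, ‖b t k‖ₑ ≠ ∞ := ne_top_of_le_ne_top hfin h1
  rw [HasFiniteIntegral, lt_top_iff_ne_top]
  intro h3
  rw [h3, ENNReal.mul_top (D.wt_ne_zero m k)] at h2
  exact h2 rfl

theorem mild_picard_zero (P : ℝ → (Fin d → ℕ) → ℝ) (s τ : ℝ) :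
    D.Mild s τ (P s) (fun _ k => D.kap k * (0 : ℝ)) (fun t => D.picard g P 0 t s) := by
  refine ⟨fun k => by simp, fun t _ k => by simp [picard]⟩

theorem lintegral_picard_zero_le (m : ℤ) {l : ℝ} (hl : D.Lam < l) :
    ∫⁻ t in Ioc s τ, expWt l t * D.enrm m (D.picard g P 0 t s)
      ≤ ENNReal.ofReal D.cPar⁻¹ * (expWt l s * D.enrm (m - D.p) (P s)) := by
  -- The zeroth iterate has no force, so smoothing applies at order `m - 1`. It would even allow
  -- initial data in the norm of order `m - 1 - p`.
  have h := (mild_picard_zero (D := D) (g := g) P s τ).smoothing (h := fun _ _ => 0) (m - 1)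
    (fun k => aemeasurable_const) hl
  rw [sub_add_cancel] at h
  refine h.trans (mul_le_mul_right ?_ _)
  rw [enrm_zero]
  simp only [mul_zero, lintegral_zero, add_zero]
  exact mul_le_mul_right (D.enrm_mono (by omega) _) _

theorem aemeasurable_picard (hg : IsKernel g B) (hP : ∀ k, Measurable fun s => P s k) (n : ℕ)
    (s : ℝ) (k : Fin d → ℕ) : Measurable fun t => D.picard g P n t s k :=
  (measurable_picard hg hP n k).comp measurable_prodMk_right

theorem lintegral_picard_succ (hg : IsKernel g B) (hP : ∀ k, Measurable fun s => P s k) (n : ℕ)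
    (m : ℤ) (hfin : ∫⁻ t in Ioc s τ, D.enrm m (D.picard g P n t s) ≠ ∞) (hs : 0 ≤ s) {C : ℝ≥0}
    (hC : ∀ r ∈ Icc 0 τ, ∀ b, D.enrm m (convSeq (g r) b) ≤ C * D.enrm m b)
    {l : ℝ} (hl : D.Lam < l) (hη : ∀ k, |D.kap k| ≤ (2 * ((C : ℝ) + 1))⁻¹ * (l - D.mu k)) :
    D.Mild s τ (fun _ => 0) (fun r k => D.kap k * convSeq (g r) (D.picard g P n r s) k)
      (fun t => D.picard g P (n + 1) t s) ∧
    ∫⁻ t in Ioc s τ, expWt l t * D.enrm m (D.picard g P (n + 1) t s)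
      ≤ 2⁻¹ * ∫⁻ t in Ioc s τ, expWt l t * D.enrm m (D.picard g P n t s) := by
  have hint := hg.integrableOn_conv (integrableOn_of_lintegral_enrm
    (fun k => (aemeasurable_picard hg hP n s k).aestronglyMeasurable) hfin)
  have hM : D.Mild s τ (fun _ => 0)
      (fun r k => D.kap k * convSeq (g r) (D.picard g P n r s) k)
      (fun t => D.picard g P (n + 1) t s) :=
    ⟨fun k => (hint k).const_mul _, fun t _ k => by rw [mul_zero, zero_add]; rfl⟩
  refine ⟨hM, ?_⟩
  refine (hM.contraction m (fun k => (hint k).aestronglyMeasurable.enorm) hl hη).trans ?_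
  set I := ∫⁻ t in Ioc s τ, expWt l t * D.enrm m (D.picard g P n t s)
  calc ENNReal.ofReal (2 * ((C : ℝ) + 1))⁻¹ *
        ∫⁻ t in Ioc s τ, expWt l t * D.enrm m (convSeq (g t) (D.picard g P n t s))
      ≤ ENNReal.ofReal (2 * ((C : ℝ) + 1))⁻¹ * (C * I) := by
        refine mul_le_mul_right ?_ _
        rw [← lintegral_const_mul' _ _ ENNReal.coe_ne_top]
        refine setLIntegral_mono' measurableSet_Ioc fun t ht => ?_
        rw [mul_left_comm]
        exact mul_le_mul_right (hC t ⟨hs.trans ht.1.le, ht.2⟩ _) _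
    _ ≤ 2⁻¹ * I := by
        rw [← mul_assoc]
        refine mul_le_mul_left ?_ _
        rw [← ENNReal.ofReal_coe_nnreal, ← ENNReal.ofReal_mul (by positivity)]
        have : (2⁻¹ : ℝ≥0∞) = ENNReal.ofReal 2⁻¹ := by
          rw [ENNReal.ofReal_inv_of_pos two_pos, ENNReal.ofReal_ofNat]
        rw [this]
        refine ENNReal.ofReal_le_ofReal ?_
        have hC0 := C.coe_nonneg
        rw [inv_mul_le_iff₀ (by positivity)]
        linarith

/-- Geometric convergence of the Picard series in `L¹` in time. -/
theorem exists_lintegral_picard_le (hg : IsKernel g B) (D : Setting d) (τ : ℝ) (m : ℤ) :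
    ∃ C : ℝ≥0, ∀ P : ℝ → (Fin d → ℕ) → ℝ, (∀ k, Measurable fun s => P s k) →
      ∀ s, 0 ≤ s → D.enrm (m - D.p) (P s) ≠ ∞ → ∀ n,
      (∫⁻ t in Ioc s τ, D.enrm m (D.picard g P n t s)
        ≤ 2⁻¹ ^ n * (C * D.enrm (m - D.p) (P s))) ∧
      D.Mild s τ (fun _ => 0) (fun r k => D.kap k * convSeq (g r) (D.picard g P n r s) k)
        (fun t => D.picard g P (n + 1) t s) := by
  obtain ⟨C, hC⟩ := hg.exists_bound D τ m
  -- This `l` makes every Picard step halve the weighted norm. It depends only on `C`, hence not on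
  -- `s` or `P`.
  obtain ⟨l, hl'⟩ := D.exists_resolvent_small (2 * ((C : ℝ) + 1))⁻¹ (by positivity)
  obtain ⟨hl, hη⟩ := hl' l le_rfl
  obtain ⟨E, hE⟩ := exists_expWt_bounds l 0 τ
  -- One factor `E` removes the time weight on the left, the other bounds the weight at the initial
  -- time `s`.
  refine ⟨E * (D.cPar⁻¹.toNNReal * E), fun P hP s hs hPs => ?_⟩
  have h0 := lintegral_picard_zero_le (D := D) (g := g) (P := P) (s := s) (τ := τ) m hl
  set c := ENNReal.ofReal D.cPar⁻¹ * (expWt l s * D.enrm (m - D.p) (P s)) with hc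
  have hc_top : c ≠ ∞ := ENNReal.mul_ne_top ENNReal.ofReal_ne_top
    (ENNReal.mul_ne_top (expWt_ne_top _ _) hPs)
  have key : ∀ n, ∫⁻ t in Ioc s τ, expWt l t * D.enrm m (D.picard g P n t s) ≤ 2⁻¹ ^ n * c := by
    intro n
    induction n with
    | zero => simpa using h0
    | succ n ih =>
      have hfin : ∫⁻ t in Ioc s τ, D.enrm m (D.picard g P n t s) ≠ ∞ :=
        (lintegral_expWt_ne_top_iff l s τ _).1
          (ne_top_of_le_ne_top (ENNReal.mul_ne_top (by simp) hc_top) ih)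
      refine (lintegral_picard_succ hg hP n m hfin hs hC hl hη).2.trans ?_
      rw [pow_succ', mul_assoc]
      exact mul_le_mul_right ih _
  have hbd : ∀ n, ∫⁻ t in Ioc s τ, D.enrm m (D.picard g P n t s)
        ≤ 2⁻¹ ^ n * (E * c) := by
    intro n
    calc ∫⁻ t in Ioc s τ, D.enrm m (D.picard g P n t s)
        ≤ ∫⁻ t in Ioc s τ, E * (expWt l t * D.enrm m (D.picard g P n t s)) := by
          refine setLIntegral_mono' measurableSet_Ioc fun t ht => ?_
          rw [← mul_assoc]
          exact le_mul_of_one_le_left zero_le (hE t ⟨hs.trans ht.1.le, ht.2⟩).2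
      _ = E * ∫⁻ t in Ioc s τ, expWt l t * D.enrm m (D.picard g P n t s) :=
          lintegral_const_mul' _ _ ENNReal.coe_ne_top
      _ ≤ E * (2⁻¹ ^ n * c) := mul_le_mul_right (key n) _
      _ = _ := mul_left_comm _ _ _
  intro n
  refine ⟨?_, ?_⟩
  · rcases lt_or_ge τ s with h | h
    · rw [Ioc_eq_empty_of_le h.le, Measure.restrict_empty, lintegral_zero_measure]
      exact zero_le
    refine (hbd n).trans (mul_le_mul_right ?_ _)
    rw [hc]
    push_cast
    rw [mul_assoc, mul_assoc]
    exact mul_le_mul_right (mul_le_mul_right (mul_le_mul_left (hE s ⟨hs, h⟩).1 _) _) _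
  · exact (lintegral_picard_succ hg hP n m (ne_top_of_le_ne_top
      (ENNReal.mul_ne_top (by simp) (ENNReal.mul_ne_top ENNReal.coe_ne_top hc_top)) (hbd n))
      hs hC hl hη).1

theorem tsum_geometric_mul (c : ℝ≥0∞) : ∑' n : ℕ, (2⁻¹ : ℝ≥0∞) ^ n * c = 2 * c := by
  rw [ENNReal.tsum_mul_right, ENNReal.tsum_geometric, ENNReal.one_sub_inv_two, inv_inv]

/-- `L¹` bound of the evolution. -/
theorem exists_lintegral_evol_le (hg : IsKernel g B) (D : Setting d) (τ : ℝ) (m : ℤ) :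
    ∃ C : ℝ≥0, ∀ P : ℝ → (Fin d → ℕ) → ℝ, (∀ k, Measurable fun s => P s k) →
      ∀ s, 0 ≤ s → D.enrm (m - D.p) (P s) ≠ ∞ →
      ∫⁻ t in Ioc s τ, D.enrm m (D.evol g P t s) ≤ C * D.enrm (m - D.p) (P s) := by
  obtain ⟨C, hC⟩ := exists_lintegral_picard_le hg D τ m
  refine ⟨2 * C, fun P hP s hs hPs => ?_⟩
  have h1 : ∀ t, D.enrm m (D.evol g P t s) ≤ ∑' n, D.enrm m (D.picard g P n t s) := by
    intro t
    simp only [enrm]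
    rw [ENNReal.tsum_comm]
    refine ENNReal.tsum_le_tsum fun k => ?_
    rw [ENNReal.tsum_mul_left]
    exact mul_le_mul_right enorm_tsum_le_tsum_enorm _
  refine (lintegral_mono h1).trans ?_
  rw [lintegral_tsum]
  · refine (ENNReal.tsum_le_tsum fun n => (hC P hP s hs hPs n).1).trans (le_of_eq ?_)
    rw [tsum_geometric_mul]
    push_cast
    ring
  · intro n
    refine Measurable.aemeasurable ?_
    exact Measurable.tsum fun k => ((aemeasurable_picard hg hP n s k).enorm).const_mul _

theorem tsum_lintegral_picard_ne_top (hg : IsKernel g B) (hP : ∀ k, Measurable fun s => P s k)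
    (hs : 0 ≤ s) (hPs : D.enrm (-D.p) (P s) ≠ ∞) (k : Fin d → ℕ) :
    ∑' n, ∫⁻ t in Ioc s τ, ‖D.picard g P n t s k‖ₑ ≠ ∞ := by
  obtain ⟨C, hC⟩ := exists_lintegral_picard_le hg D τ 0
  rw [zero_sub] at hC
  have h1 : D.wt 0 k * ∑' n, ∫⁻ t in Ioc s τ, ‖D.picard g P n t s k‖ₑ
      ≤ 2 * (C * D.enrm (-D.p) (P s)) := by
    rw [← tsum_geometric_mul, ← ENNReal.tsum_mul_left]
    refine ENNReal.tsum_le_tsum fun n => ?_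
    refine le_trans ?_ (hC P hP s hs hPs n).1
    rw [← lintegral_const_mul' _ _ (D.wt_ne_top 0 k)]
    exact lintegral_mono fun t => D.wt_mul_enorm_le_enrm 0 _ k
  intro h3
  rw [h3, ENNReal.mul_top (D.wt_ne_zero 0 k), top_le_iff] at h1
  exact ENNReal.mul_ne_top (by simp) (ENNReal.mul_ne_top ENNReal.coe_ne_top hPs) h1

theorem tsum_lintegral_conv_picard_ne_top (hg : IsKernel g B)
    (hP : ∀ k, Measurable fun s => P s k)
    (hs : 0 ≤ s) (hPs : D.enrm (-D.p) (P s) ≠ ∞) (k : Fin d → ℕ) :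
    ∑' n, ∫⁻ t in Ioc s τ, ‖D.kap k * convSeq (g t) (D.picard g P n t s) k‖ₑ ≠ ∞ := by
  choose R hR using fun k => isCompact_Icc.exists_bound_of_continuousOn (s := Icc 0 τ)
    (hg.continuous k).continuousOn
  refine ne_top_of_le_ne_top (b := ‖D.kap k‖ₑ * ∑ l ∈ intBox d B, ENNReal.ofReal (R (absIdx l)) *
    ∑' n, ∫⁻ t in Ioc s τ, ‖D.picard g P n t s (absIdx ((fun i => (k i : ℤ)) - l))‖ₑ) ?_ ?_
  · exact ENNReal.mul_ne_top enorm_ne_top (ENNReal.sum_ne_top.2 fun l _ => ENNReal.mul_ne_top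
      ENNReal.ofReal_ne_top (tsum_lintegral_picard_ne_top hg hP hs hPs _))
  · simp only [← ENNReal.tsum_mul_left]
    rw [← Summable.tsum_finsetSum fun _ _ => ENNReal.summable, ← ENNReal.tsum_mul_left]
    refine ENNReal.tsum_le_tsum fun n => ?_
    have h1 : ∀ l, ENNReal.ofReal (R (absIdx l)) *
        ∫⁻ t in Ioc s τ, ‖D.picard g P n t s (absIdx ((fun i => (k i : ℤ)) - l))‖ₑ
        = ∫⁻ t in Ioc s τ, ENNReal.ofReal (R (absIdx l)) *
          ‖D.picard g P n t s (absIdx ((fun i => (k i : ℤ)) - l))‖ₑ := fun l =>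
      (lintegral_const_mul' _ _ ENNReal.ofReal_ne_top).symm
    simp only [h1]
    rw [← lintegral_finsetSum _ fun l _ => ((aemeasurable_picard hg hP n s _).enorm).const_mul _,
      ← lintegral_const_mul' _ _ enorm_ne_top]
    refine setLIntegral_mono' measurableSet_Ioc fun t ht => ?_
    rw [enorm_mul, convSeq_eq_sum (hg.boxSupp _)]
    refine mul_le_mul_right ((enorm_sum_le _ _).trans (Finset.sum_le_sum fun l _ => ?_)) _
    rw [enorm_mul]
    refine mul_le_mul_left ?_ _
    rw [← ofReal_norm]
    exact ENNReal.ofReal_le_ofReal (hR _ t ⟨hs.trans ht.1.le, ht.2⟩)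

/-- One Duhamel step turns summability in `L¹` in time into summability at every time. The zeroth
iterate is not a Duhamel integral, hence the shift by one. -/
theorem summable_picard (hg : IsKernel g B) (hP : ∀ k, Measurable fun s => P s k)
    (hs : 0 ≤ s) (hPs : D.enrm (-D.p) (P s) ≠ ∞) {t : ℝ} (ht : t ∈ Ioc s τ) (k : Fin d → ℕ) :
    Summable fun n => D.picard g P n t s k := by
  obtain ⟨C, hC⟩ := exists_lintegral_picard_le hg D τ 0
  rw [zero_sub] at hC
  rw [← summable_nat_add_iff 1]
  set E : ℝ≥0∞ := ENNReal.ofReal (Real.exp (D.Lam * (τ - s)))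
  have hle : ∀ n, ‖D.picard g P (n + 1) t s k‖ₑ
      ≤ E * ∫⁻ t in Ioc s τ, ‖D.kap k * convSeq (g t) (D.picard g P n t s) k‖ₑ := by
    intro n
    have h1 := (hC P hP s hs hPs n).2.enorm_le ht k
    rw [enorm_zero, mul_zero, zero_add] at h1
    refine h1.trans ?_
    rw [← lintegral_const_mul' _ _ ENNReal.ofReal_ne_top]
    refine le_trans (setLIntegral_mono' measurableSet_Ioc fun r hr => ?_)
      (lintegral_mono_set (Ioc_subset_Ioc_right ht.2))
    refine mul_le_mul_left (ENNReal.ofReal_le_ofReal (Real.exp_le_exp.2 ?_)) _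
    have h1 : D.mu k * (t - r) ≤ D.Lam * (t - r) :=
      mul_le_mul_of_nonneg_right (D.mu_le k) (by linarith [hr.2])
    have h2 : D.Lam * (t - r) ≤ D.Lam * (τ - s) :=
      mul_le_mul_of_nonneg_left (by linarith [hr.1, ht.2]) D.Lam_nonneg
    linarith
  have hfin : ∑' n, ‖D.picard g P (n + 1) t s k‖ₑ ≠ ∞ := by
    refine ne_top_of_le_ne_top ?_ (ENNReal.tsum_le_tsum hle)
    rw [ENNReal.tsum_mul_left]
    exact ENNReal.mul_ne_top ENNReal.ofReal_ne_top
      (tsum_lintegral_conv_picard_ne_top hg hP hs hPs k)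
  exact (ENNReal.summable_toReal hfin).of_norm_bounded fun n => by rw [toReal_enorm]

/-- The sum of the Picard series is the mild solution of the linear problem. -/
theorem mild_evol (hg : IsKernel g B) (hP : ∀ k, Measurable fun s => P s k)
    (hs : 0 ≤ s) (hPs : D.enrm (-D.p) (P s) ≠ ∞) :
    D.Mild s τ (P s) (fun r k => D.kap k * convSeq (g r) (D.evol g P r s) k)
      (fun t => D.evol g P t s) := by
  have hconv : ∀ r ∈ Ioc s τ, ∀ k, D.kap k * convSeq (g r) (D.evol g P r s) k
      = ∑' n, D.kap k * convSeq (g r) (D.picard g P n r s) k := by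
    intro r hr k
    rw [tsum_mul_left]
    simp only [convSeq_eq_sum (hg.boxSupp _), evol]
    rw [Summable.tsum_finsetSum fun l _ => (summable_picard hg hP hs hPs hr _).mul_left _]
    simp only [tsum_mul_left]
  have hmeas : ∀ n k, Measurable fun r => D.kap k * convSeq (g r) (D.picard g P n r s) k := by
    intro n k
    simp only [convSeq_eq_sum (hg.boxSupp _)]
    refine measurable_const.mul (Finset.measurable_fun_sum _ fun l _ => ?_)
    exact (hg.continuous _).measurable.mul (aemeasurable_picard hg hP n s _)
  have hfin := fun k => tsum_lintegral_conv_picard_ne_top (τ := τ) hg hP hs hPs k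
  refine ⟨fun k => ?_, fun t ht k => ?_⟩
  · have h1 : IntegrableOn (fun r => ∑' n, D.kap k * convSeq (g r) (D.picard g P n r s) k)
        (Ioc s τ) := by
      have hcont : AEStronglyMeasurable
          (fun r => ∑' n, D.kap k * convSeq (g r) (D.picard g P n r s) k)
          (volume.restrict (Ioc s τ)) := by
        refine aestronglyMeasurable_of_tendsto_ae (u := atTop)
          (f := fun N r => ∑ n ∈ Finset.range N,
            D.kap k * convSeq (g r) (D.picard g P n r s) k)
          (fun N => (Finset.measurable_fun_sum _ fun n _ => hmeas n k).aestronglyMeasurable) ?_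
        filter_upwards [ae_restrict_mem measurableSet_Ioc] with r hr
        refine HasSum.tendsto_sum_nat (f := fun n => D.kap k * convSeq (g r) (D.picard g P n r s) k)
          (Summable.hasSum ?_)
        simp only [convSeq_eq_sum (hg.boxSupp _)]
        exact (summable_sum fun l _ => (summable_picard hg hP hs hPs hr _).mul_left _).mul_left _
      refine ⟨hcont, ?_⟩
      rw [HasFiniteIntegral, lt_top_iff_ne_top]
      refine ne_top_of_le_ne_top (hfin k) ?_
      rw [← lintegral_tsum fun n => (hmeas n k).enorm.aemeasurable]
      exact lintegral_mono fun r => enorm_tsum_le_tsum_enorm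
    exact h1.congr_fun (fun r hr => (hconv r hr k).symm) measurableSet_Ioc
  · have e1 : ∫ r in Ioc s t, Real.exp (D.mu k * (t - r)) *
          (D.kap k * convSeq (g r) (D.evol g P r s) k)
        = ∫ r in Ioc s t, ∑' n, Real.exp (D.mu k * (t - r)) *
          (D.kap k * convSeq (g r) (D.picard g P n r s) k) := by
      refine setIntegral_congr_fun measurableSet_Ioc fun r hr => ?_
      exact (congrArg _ (hconv r ⟨hr.1, hr.2.trans ht.2⟩ k)).trans tsum_mul_left.symm
    -- Integrated term by term, the Duhamel integral is the series of iterates from index one on;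
    -- the missing first term is the free evolution.
    rw [e1, integral_tsum]
    · exact (summable_picard hg hP hs hPs ht k).tsum_eq_zero_add
    · intro n
      exact ((by fun_prop : Measurable fun r => Real.exp (D.mu k * (t - r))).mul
        (hmeas n k)).aestronglyMeasurable
    · set E : ℝ≥0∞ := ENNReal.ofReal (Real.exp (D.Lam * (τ - s)))
      refine ne_top_of_le_ne_top (ENNReal.mul_ne_top (a := E) ENNReal.ofReal_ne_top (hfin k)) ?_
      rw [← ENNReal.tsum_mul_left]
      refine ENNReal.tsum_le_tsum fun n => ?_
      rw [← lintegral_const_mul' _ _ ENNReal.ofReal_ne_top]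
      refine le_trans (setLIntegral_mono' measurableSet_Ioc fun r hr => ?_)
        (lintegral_mono_set (Ioc_subset_Ioc_right ht.2))
      rw [enorm_mul, Real.enorm_of_nonneg (Real.exp_pos _).le]
      refine mul_le_mul_left (ENNReal.ofReal_le_ofReal (Real.exp_le_exp.2 ?_)) _
      have h1 : D.mu k * (t - r) ≤ D.Lam * (t - r) :=
        mul_le_mul_of_nonneg_right (D.mu_le k) (by linarith [hr.2])
      have h2 : D.Lam * (t - r) ≤ D.Lam * (τ - s) :=
        mul_le_mul_of_nonneg_left (by linarith [hr.1, ht.2]) D.Lam_nonneg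
      linarith

/-- Joint measurability of the evolution. -/
theorem measurable_evol (hg : IsKernel g B) (hP : ∀ k, Measurable fun s => P s k)
    (hPs : ∀ s, D.enrm (-D.p) (P s) ≠ ∞) (τ : ℝ) (k : Fin d → ℕ) :
    Measurable fun x : ℝ × ℝ =>
      if 0 ≤ x.2 ∧ x.2 < x.1 ∧ x.1 ≤ τ then D.evol g P x.1 x.2 k else 0 := by
  refine measurable_of_tendsto_metrizable (f := fun N (x : ℝ × ℝ) =>
    if 0 ≤ x.2 ∧ x.2 < x.1 ∧ x.1 ≤ τ then ∑ n ∈ Finset.range N, D.picard g P n x.1 x.2 k else 0)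
    (fun N => ?_) (tendsto_pi_nhds.2 fun x => ?_)
  · refine Measurable.ite ?_
      (Finset.measurable_fun_sum _ fun n _ => measurable_picard hg hP n k) measurable_const
    exact (measurableSet_le measurable_const measurable_snd).inter
      ((measurableSet_lt measurable_snd measurable_fst).inter
        (measurableSet_le measurable_fst measurable_const))
  · by_cases hx : 0 ≤ x.2 ∧ x.2 < x.1 ∧ x.1 ≤ τ
    · simp only [if_pos hx]
      exact (summable_picard hg hP hx.1 (hPs _) ⟨hx.2.1, hx.2.2⟩ k).hasSum.tendsto_sum_nat
    · simp only [if_neg hx]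
      exact tendsto_const_nhds

end Setting

namespace Setting

variable {d : ℕ} {D : Setting d} {g : ℝ → (Fin d → ℕ) → ℝ} {B : ℕ} {P : ℝ → (Fin d → ℕ) → ℝ}
  {s τ : ℝ}

/-! ### Variation of constants -/

theorem Mild.add {χ χ' : (Fin d → ℕ) → ℝ} {f b f' b' : ℝ → (Fin d → ℕ) → ℝ}
    (h : D.Mild s τ χ f b) (h' : D.Mild s τ χ' f' b') :
    D.Mild s τ (fun k => χ k + χ' k) (fun r k => f r k + f' r k) (fun t k => b t k + b' t k) := by
  refine ⟨fun k => (h.1 k).add (h'.1 k), fun t ht k => ?_⟩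
  have hs : Ioc s t ⊆ Ioc s τ := Ioc_subset_Ioc_right ht.2
  have e : ∀ r, Real.exp (D.mu k * (t - r)) * (f r k + f' r k)
      = Real.exp (D.mu k * (t - r)) * f r k + Real.exp (D.mu k * (t - r)) * f' r k :=
    fun r => mul_add _ _ _
  simp only [e]
  rw [h.2 t ht k, h'.2 t ht k]
  rw [integral_add (integrableOn_exp_mul k t ((h.1 k).mono_set hs))
    (integrableOn_exp_mul k t ((h'.1 k).mono_set hs))]
  ring

/-- The evolution, set to zero outside the triangle `0 ≤ s < t ≤ τ`. -/
def evolT (D : Setting d) (g P : ℝ → (Fin d → ℕ) → ℝ) (τ t s : ℝ) (k : Fin d → ℕ) : ℝ :=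
  if 0 ≤ s ∧ s < t ∧ t ≤ τ then D.evol g P t s k else 0

theorem evolT_of_mem {t : ℝ} (hs : 0 ≤ s) (hst : s < t) (ht : t ≤ τ) (k : Fin d → ℕ) :
    D.evolT g P τ t s k = D.evol g P t s k := if_pos ⟨hs, hst, ht⟩

theorem evolT_of_ge {t : ℝ} (hst : t ≤ s) (k : Fin d → ℕ) : D.evolT g P τ t s k = 0 :=
  if_neg fun h => absurd h.2.1 (not_lt.2 hst)

theorem measurable_evolT (hg : IsKernel g B) (hP : ∀ k, Measurable fun s => P s k)
    (hPs : ∀ s, D.enrm (-D.p) (P s) ≠ ∞) (k : Fin d → ℕ) :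
    Measurable fun x : ℝ × ℝ => D.evolT g P τ x.2 x.1 k :=
  (measurable_evol hg hP hPs τ k).comp measurable_swap

/-- Tonelli's theorem: the `L¹` bound of the evolution in `t` is uniform in `s`, since the data are
bounded by `R`. -/
theorem integrable_evolT (hg : IsKernel g B) (hP : ∀ k, Measurable fun s => P s k) {R : ℝ≥0}
    (hR : ∀ s, D.enrm (-D.p) (P s) ≤ R) (k : Fin d → ℕ) :
    Integrable (fun x : ℝ × ℝ => D.evolT g P τ x.2 x.1 k)
      ((volume.restrict (Ioc 0 τ)).prod (volume.restrict (Ioc 0 τ))) := by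
  have hPs : ∀ s, D.enrm (-D.p) (P s) ≠ ∞ := fun s =>
    ne_top_of_le_ne_top ENNReal.coe_ne_top (hR s)
  have hm := measurable_evolT (τ := τ) hg hP hPs k
  refine ⟨hm.aestronglyMeasurable, ?_⟩
  obtain ⟨C, hC⟩ := exists_lintegral_evol_le hg D τ 0
  rw [zero_sub] at hC
  rw [HasFiniteIntegral, lintegral_prod _ hm.enorm.aemeasurable, lt_top_iff_ne_top]
  have h1 : ∀ s ∈ Ioc 0 τ, D.wt 0 k * ∫⁻ t in Ioc 0 τ, ‖D.evolT g P τ t s k‖ₑ ≤ (C * R : ℝ≥0) := by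
    intro s hs
    have e : ∫⁻ t in Ioc 0 τ, ‖D.evolT g P τ t s k‖ₑ ≤ ∫⁻ t in Ioc s τ, ‖D.evol g P t s k‖ₑ := by
      rw [← lintegral_indicator measurableSet_Ioc, ← lintegral_indicator measurableSet_Ioc]
      refine lintegral_mono fun t => ?_
      by_cases ht : t ∈ Ioc s τ
      · rw [indicator_of_mem ht, indicator_of_mem (show t ∈ Ioc 0 τ from ⟨hs.1.trans ht.1, ht.2⟩),
          evolT_of_mem hs.1.le ht.1 ht.2]
      · rw [indicator_of_notMem ht]
        by_cases ht' : t ∈ Ioc 0 τ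
        · have : t ≤ s := not_lt.1 fun h => ht ⟨h, ht'.2⟩
          rw [indicator_of_mem ht', evolT_of_ge this, enorm_zero]
        · rw [indicator_of_notMem ht']
    refine (mul_le_mul_right e _).trans ?_
    rw [← lintegral_const_mul' _ _ (D.wt_ne_top 0 k)]
    refine (lintegral_mono fun t => D.wt_mul_enorm_le_enrm 0 _ k).trans ?_
    refine (hC P hP s hs.1.le (hPs s)).trans ?_
    push_cast
    exact mul_le_mul_right (hR s) _
  have h2 : D.wt 0 k * ∫⁻ s in Ioc 0 τ, ∫⁻ t in Ioc 0 τ, ‖D.evolT g P τ t s k‖ₑ ≠ ∞ := by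
    rw [← lintegral_const_mul' _ _ (D.wt_ne_top 0 k)]
    exact ne_top_of_le_ne_top (lintegral_Ioc_const_ne_top (C * R) 0 τ)
      (setLIntegral_mono' measurableSet_Ioc h1)
  intro h3
  rw [h3, ENNReal.mul_top (D.wt_ne_zero 0 k)] at h2
  exact h2 rfl

theorem integrableOn_of_enrm_le (hP : ∀ k, Measurable fun s => P s k) {R : ℝ≥0} {m : ℤ}
    (hR : ∀ s, D.enrm m (P s) ≤ R) (k : Fin d → ℕ) (a c : ℝ) :
    IntegrableOn (fun s => P s k) (Ioc a c) :=
  integrableOn_of_lintegral_enrm (D := D) (m := m) (fun k => (hP k).aestronglyMeasurable)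
    (ne_top_of_le_ne_top (lintegral_Ioc_const_ne_top R a c) (lintegral_mono fun s => hR s)) k

theorem integrable_duhamel_kernel (hg : IsKernel g B) (hP : ∀ k, Measurable fun s => P s k)
    {R : ℝ≥0} (hR : ∀ s, D.enrm (-D.p) (P s) ≤ R)
    {t : ℝ} (ht : t ∈ Ioc 0 τ) (k : Fin d → ℕ) :
    Integrable (fun x : ℝ × ℝ => Real.exp (D.mu k * (t - x.2)) *
      (D.kap k * convSeq (g x.2) (D.evolT g P τ x.2 x.1) k))
      ((volume.restrict (Ioc 0 t)).prod (volume.restrict (Ioc 0 t))) := by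
  have hsub : (volume.restrict (Ioc 0 t)).prod (volume.restrict (Ioc 0 t))
      ≤ (volume.restrict (Ioc 0 τ)).prod (volume.restrict (Ioc 0 τ)) := by
    rw [Measure.prod_restrict, Measure.prod_restrict]
    exact Measure.restrict_mono (prod_mono (Ioc_subset_Ioc_right ht.2)
      (Ioc_subset_Ioc_right ht.2)) le_rfl
  simp only [convSeq_eq_sum (hg.boxSupp _), Finset.mul_sum]
  refine integrable_finsetSum _ fun l _ => ?_
  have hcont : Continuous fun r => Real.exp (D.mu k * (t - r)) * (D.kap k * g r (absIdx l)) :=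
    Continuous.mul (by fun_prop) (continuous_const.mul (hg.continuous _))
  obtain ⟨C, hC⟩ := (isCompact_Icc (a := (0 : ℝ)) (b := t)).exists_bound_of_continuousOn
    hcont.continuousOn
  have h1 := ((integrable_evolT (τ := τ) hg hP hR
    (absIdx ((fun i => (k i : ℤ)) - l))).mono_measure hsub).bdd_mul
    (f := fun x : ℝ × ℝ => Real.exp (D.mu k * (t - x.2)) * (D.kap k * g x.2 (absIdx l))) (c := C)
    (hcont.measurable.comp measurable_snd).aestronglyMeasurable ?_
  · refine h1.congr (Eventually.of_forall fun x => ?_)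
    simp only
    ring
  · rw [Measure.prod_restrict]
    filter_upwards [ae_restrict_mem (measurableSet_Ioc.prod measurableSet_Ioc)] with x hx
    exact hC x.2 ⟨hx.2.1.le, hx.2.2⟩

theorem evol_eq_integral_evolT (hg : IsKernel g B) (hP : ∀ k, Measurable fun s => P s k)
    {R : ℝ≥0} (hR : ∀ s, D.enrm (-D.p) (P s) ≤ R)
    {t : ℝ} (ht : t ∈ Ioc 0 τ) (hs : s ∈ Ioo 0 t) (k : Fin d → ℕ) :
    D.evol g P t s k = Real.exp (D.mu k * (t - s)) * P s k
      + ∫ r in Ioc 0 t, Real.exp (D.mu k * (t - r)) *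
        (D.kap k * convSeq (g r) (D.evolT g P τ r s) k) := by
  have hPs : D.enrm (-D.p) (P s) ≠ ∞ := ne_top_of_le_ne_top ENNReal.coe_ne_top (hR s)
  refine ((mild_evol (τ := τ) hg hP hs.1.le hPs).2 t ⟨hs.2, ht.2⟩ k).trans ?_
  congr 1
  rw [← integral_indicator measurableSet_Ioc, ← integral_indicator measurableSet_Ioc]
  refine integral_congr_ae (Eventually.of_forall fun r => ?_)
  simp only
  by_cases hr : r ∈ Ioc s t
  · rw [indicator_of_mem hr, indicator_of_mem (show r ∈ Ioc 0 t from ⟨hs.1.trans hr.1, hr.2⟩)]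
    have : D.evolT g P τ r s = D.evol g P r s :=
      funext fun k => evolT_of_mem hs.1.le hr.1 (hr.2.trans ht.2) k
    rw [this]
  · rw [indicator_of_notMem hr]
    by_cases hr' : r ∈ Ioc 0 t
    · have h1 : r ≤ s := not_lt.1 fun h => hr ⟨h, hr'.2⟩
      rw [indicator_of_mem hr', convSeq_eq_sum (hg.boxSupp _)]
      simp [evolT_of_ge h1]
    · rw [indicator_of_notMem hr']

theorem integrableOn_evol (hg : IsKernel g B) (hP : ∀ k, Measurable fun s => P s k)
    {R : ℝ≥0} (hR : ∀ s, D.enrm (-D.p) (P s) ≤ R)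
    {t : ℝ} (ht : t ∈ Ioc 0 τ) (k : Fin d → ℕ) :
    IntegrableOn (fun s => D.evol g P t s k) (Ioc 0 t) := by
  have h1 := (integrable_duhamel_kernel hg hP hR ht k).integral_prod_left
  have h2 := integrableOn_exp_mul (D := D) k t (integrableOn_of_enrm_le hP hR k 0 t)
  refine (h2.add h1).congr ?_
  have hne : ∀ᵐ s : ℝ ∂(volume.restrict (Ioc 0 t)), s ≠ t :=
    ae_restrict_of_ae (by simp [ae_iff])
  filter_upwards [hne, ae_restrict_mem measurableSet_Ioc] with s hst hs
  exact (evol_eq_integral_evolT hg hP hR ht ⟨hs.1, lt_of_le_of_ne hs.2 hst⟩ k).symm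

theorem integral_evolT {t r : ℝ} (hr : r ∈ Ioc 0 t) (ht : t ≤ τ) (k : Fin d → ℕ) :
    ∫ s in Ioc 0 t, D.evolT g P τ r s k = ∫ s in Ioc 0 r, D.evol g P r s k := by
  rw [← integral_indicator measurableSet_Ioc, ← integral_indicator measurableSet_Ioc]
  have hne : ∀ᵐ s : ℝ, s ≠ r := by simp [ae_iff]
  refine integral_congr_ae ?_
  filter_upwards [hne] with s hsr
  by_cases hs : s ∈ Ioc 0 r
  · rw [indicator_of_mem hs, indicator_of_mem (show s ∈ Ioc 0 t from ⟨hs.1, hs.2.trans hr.2⟩),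
      evolT_of_mem hs.1.le (lt_of_le_of_ne hs.2 hsr) (hr.2.trans ht)]
  · rw [indicator_of_notMem hs]
    by_cases hs' : s ∈ Ioc 0 t
    · have : r ≤ s := not_lt.1 fun h => hs ⟨hs'.1, h.le⟩
      rw [indicator_of_mem hs', evolT_of_ge this]
    · rw [indicator_of_notMem hs']

/-- Variation of constants: `∫₀ᵗ U(t,s) P(s) ds` is the mild solution with zero initial value. -/
theorem mild_duhamel (hg : IsKernel g B) (hP : ∀ k, Measurable fun s => P s k)
    {R : ℝ≥0} (hR : ∀ s, D.enrm (-D.p) (P s) ≤ R) :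
    D.Mild 0 τ (fun _ => 0)
      (fun r k => D.kap k * convSeq (g r) (fun k => ∫ s in Ioc 0 r, D.evol g P r s k) k + P r k)
      (fun t k => ∫ s in Ioc 0 t, D.evol g P t s k) := by
  have hv : ∀ k, IntegrableOn (fun r => ∫ s in Ioc 0 r, D.evol g P r s k) (Ioc 0 τ) := by
    intro k
    refine ((integrable_evolT (τ := τ) hg hP hR k).integral_prod_right).congr ?_
    filter_upwards [ae_restrict_mem measurableSet_Ioc] with r hr
    exact integral_evolT hr le_rfl k
  have hv' : ∀ {t : ℝ}, t ∈ Ioc 0 τ → ∀ k, IntegrableOn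
      (fun r => Real.exp (D.mu k * (t - r)) *
        (D.kap k * convSeq (g r) (fun k => ∫ s in Ioc 0 r, D.evol g P r s k) k)) (Ioc 0 t) := by
    intro t ht k
    refine integrableOn_exp_mul k t ?_
    exact IntegrableOn.mono_set ((hg.integrableOn_conv hv k).const_mul _)
      (Ioc_subset_Ioc_right ht.2)
  refine ⟨fun k => ((hg.integrableOn_conv hv k).const_mul _).add
    (integrableOn_of_enrm_le hP hR k 0 τ), fun t ht k => ?_⟩
  have h2 := integrableOn_exp_mul (D := D) k t (integrableOn_of_enrm_le hP hR k 0 t)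
  have hker := integrable_duhamel_kernel hg hP hR ht k
  have hne : ∀ᵐ s : ℝ ∂(volume.restrict (Ioc 0 t)), s ≠ t :=
    ae_restrict_of_ae (by simp [ae_iff])
  have e1 : ∫ s in Ioc 0 t, D.evol g P t s k
      = ∫ s in Ioc 0 t, (Real.exp (D.mu k * (t - s)) * P s k
      + ∫ r in Ioc 0 t, Real.exp (D.mu k * (t - r)) *
        (D.kap k * convSeq (g r) (D.evolT g P τ r s) k)) := by
    refine integral_congr_ae ?_
    filter_upwards [hne, ae_restrict_mem measurableSet_Ioc] with s hst hs
    exact evol_eq_integral_evolT hg hP hR ht ⟨hs.1, lt_of_le_of_ne hs.2 hst⟩ k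
  refine e1.trans ?_
  -- After the exchange, the inner integral over `s` acts on `U(r, s) P(s)`. As the convolution is a
  -- finite sum, it passes inside and reproduces the solution at time `r`.
  rw [integral_add h2 hker.integral_prod_left, integral_integral_swap hker, mul_zero, zero_add]
  simp only [mul_add]
  rw [integral_add (hv' ht k) h2, add_comm]
  congr 1
  have hsub : (volume.restrict (Ioc 0 t)).prod (volume.restrict (Ioc 0 t))
      ≤ (volume.restrict (Ioc 0 τ)).prod (volume.restrict (Ioc 0 τ)) := by
    rw [Measure.prod_restrict, Measure.prod_restrict]
    exact Measure.restrict_mono (prod_mono (Ioc_subset_Ioc_right ht.2)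
      (Ioc_subset_Ioc_right ht.2)) le_rfl
  have hae : ∀ᵐ r ∂(volume.restrict (Ioc 0 t)), ∀ j,
      Integrable (fun s => D.evolT g P τ r s j) (volume.restrict (Ioc 0 t)) :=
    ae_all_iff.2 fun j =>
      ((integrable_evolT (τ := τ) hg hP hR j).mono_measure hsub).prod_left_ae
  refine integral_congr_ae ?_
  filter_upwards [hae, ae_restrict_mem measurableSet_Ioc] with r hint hr
  rw [integral_const_mul, integral_const_mul]
  simp only [convSeq_eq_sum (hg.boxSupp _)]
  rw [integral_finsetSum _ fun l _ => (hint _).const_mul _]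
  simp only [integral_const_mul, integral_evolT hr ht.2]

/-! ### Uniqueness for the linear problem -/

/-- The norm of order `-p` is used because solutions starting in `ℓ¹_{ω,-q}` are controlled near `s`
only in that norm. -/
theorem mild_linear_unique (hg : IsKernel g B) {χ : (Fin d → ℕ) → ℝ} {F b b' : ℝ → (Fin d → ℕ) → ℝ}
    (hs : 0 ≤ s) (h : D.Mild s τ χ (fun r k => D.kap k * convSeq (g r) (b r) k + F r k) b)
    (h' : D.Mild s τ χ (fun r k => D.kap k * convSeq (g r) (b' r) k + F r k) b')
    (hb : ∫⁻ t in Ioc s τ, D.enrm (-D.p) (b t) ≠ ∞)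
    (hb' : ∫⁻ t in Ioc s τ, D.enrm (-D.p) (b' t) ≠ ∞) :
    ∀ t ∈ Ioc s τ, ∀ k, b t k = b' t k := by
  obtain ⟨C, hC⟩ := hg.exists_bound D τ (-D.p)
  have hsub := h.sub h'
  simp only [sub_self] at hsub
  have h0 : D.Mild s τ (fun _ => 0)
      (fun r k => D.kap k * convSeq (g r) (fun k => b r k - b' r k) k)
      (fun t k => b t k - b' t k) := by
    refine hsub.congr (fun t _ k => ?_) fun _ _ _ => rfl
    rw [hg.conv_sub]
    ring
  have hz := h0.eq_zero (-D.p)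
    (fun k => ((hg.continuousOn_conv h0.continuousOn k).aestronglyMeasurable
      measurableSet_Ioc).enorm) C (fun t ht => hC t ⟨hs.trans ht.1.le, ht.2⟩ _) ?_
  · intro t ht k
    exact sub_eq_zero.1 (hz t ht k)
  · have hcont : ∀ k, AEMeasurable (fun t => ‖b t k‖ₑ) (volume.restrict (Ioc s τ)) := h.aemeasurable
    refine ne_top_of_le_ne_top (ENNReal.add_ne_top.2 ⟨hb, hb'⟩) ?_
    rw [← lintegral_add_left']
    · exact lintegral_mono fun t => D.enrm_sub_le _ _ _
    · unfold enrm
      exact AEMeasurable.tsum fun k => (hcont k).const_mul _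

end Setting

/-- A function that is continuous on `(s, τ]` with a limit at `s` is bounded on `(s, τ]`. -/
theorem exists_norm_le_of_tendsto {E : Type*} [NormedAddCommGroup E] {s τ : ℝ} {f : ℝ → E} {L : E}
    (hf : ContinuousOn f (Ioc s τ)) (h : Tendsto f (𝓝[>] s) (𝓝 L)) :
    ∃ R : ℝ≥0, ∀ t ∈ Ioc s τ, ‖f t‖ ≤ R := by
  have h1 : ∀ᶠ t in 𝓝[>] s, ‖f t‖ < ‖L‖ + 1 := h.norm.eventually_lt_const (lt_add_one _)
  obtain ⟨u, hu, hu'⟩ := (mem_nhdsGT_iff_exists_Ioo_subset).1 h1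
  obtain ⟨C, hC⟩ := isCompact_Icc.exists_bound_of_continuousOn
    (hf.mono (show Icc u τ ⊆ Ioc s τ from fun t ht => ⟨lt_of_lt_of_le hu ht.1, ht.2⟩))
  refine ⟨(max (‖L‖ + 1) C).toNNReal, fun t ht => ?_⟩
  refine le_trans ?_ (Real.le_coe_toNNReal _)
  rcases lt_or_ge t u with h2 | h2
  · exact (le_of_lt (hu' ⟨ht.1, h2⟩)).trans (le_max_left _ _)
  · exact (hC t ⟨h2, ht.2⟩).trans (le_max_right _ _)

/-! ### The evolution operator `U` -/

namespace Setting

variable {d : ℕ} (D : Setting d)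

theorem norm_incl_le (a : D.Ell) : ‖D.incl a‖ ≤ ‖a‖ :=
  Summable.tsum_le_tsum (fun k => mul_le_mul_of_nonneg_left
    (div_le_self (D.omega k).2.le (one_le_pow₀ (one_le_infNorm k))) (abs_nonneg _))
    (D.incl a).summable a.summable

theorem coe_incl (a : D.Ell) : (D.incl a : (Fin d → ℕ) → ℝ) = (a : (Fin d → ℕ) → ℝ) :=
  funext fun k => D.incl_apply a k

theorem enrm_incl (m : ℤ) (a : D.Ell) :
    D.enrm m (D.incl a : (Fin d → ℕ) → ℝ) = D.enrm m (a : (Fin d → ℕ) → ℝ) :=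
  congrArg (D.enrm m) (D.coe_incl a)

theorem continuous_incl : Continuous D.incl := by
  let f : D.Ell →ₗ[ℝ] D.EllNeg :=
    { toFun := D.incl, map_add' := fun _ _ => rfl, map_smul' := fun _ _ => rfl }
  exact (f.mkContinuous 1 fun a => by rw [one_mul]; exact D.norm_incl_le a).continuous

/-- The convolution kernel of `D𝒩(ā(t))`. -/
def linKer (abar : ℝ → D.Ell) (t : ℝ) : (Fin d → ℕ) → ℝ := D.dNop (abar t)

theorem DN_apply (abar : ℝ → D.Ell) (t : ℝ) (h : D.Ell) (k : Fin d → ℕ) :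
    D.DN (abar t) h k = convSeq (D.linKer abar t) h k := by
  rw [DN_eq]
  rfl

-- The finite Fourier support of `ā` passes to the coefficients of `N'(ā)`. This is where the
-- special form of the approximate solution is used.
variable {D} in
theorem isKernel_linKer {abar : ℝ → D.Ell} (hc : Continuous abar) {A : ℕ}
    (hA : ∀ t, BoxSupp A (abar t : (Fin d → ℕ) → ℝ)) :
    IsKernel (D.linKer abar) (D.N.natDegree * A + 1) :=
  ⟨fun r => D.boxSupp_dNop (hA r), fun k =>
    (Ell1.coord D.omega k).continuous.comp (D.continuous_dNop.comp hc)⟩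

variable {D}

section Evolution

variable {g : ℝ → (Fin d → ℕ) → ℝ} {B : ℕ} {s τ : ℝ}

theorem IsKernel.affine_bound (hg : IsKernel g B) (hs : 0 ≤ s) (b : ℝ → (Fin d → ℕ) → ℝ) (m : ℕ) :
    ∃ C : ℝ≥0, ∀ t ∈ Ioc s τ, D.enrm m (convSeq (g t) (b t)) ≤ C * (1 + D.enrm m (b t)) := by
  obtain ⟨C, hC⟩ := hg.exists_bound D τ m
  exact ⟨C, fun t ht => (hC t ⟨hs.trans ht.1.le, ht.2⟩ _).trans
    (mul_le_mul_right le_add_self _)⟩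

theorem lintegral_mild_linear_ne_top (hg : IsKernel g B) (hs : 0 ≤ s) (m : ℤ)
    {b : ℝ → (Fin d → ℕ) → ℝ} (hb : ∫⁻ t in Ioc s τ, D.enrm m (b t) ≠ ∞) :
    ∫⁻ t in Ioc s τ, D.enrm m (convSeq (g t) (b t)) ≠ ∞ := by
  obtain ⟨C, hC⟩ := hg.exists_bound D τ m
  exact lintegral_affine_ne_top (fun t ht => (hC t ⟨hs.trans ht.1.le, ht.2⟩ _).trans
    (mul_le_mul_right le_add_self _)) hb

/-- A mild solution of the linear problem takes values in `ℓ¹_ω` at positive times. -/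
theorem exists_ell_of_mild (hg : IsKernel g B) (hs : 0 ≤ s) {χ : (Fin d → ℕ) → ℝ}
    {b : ℝ → (Fin d → ℕ) → ℝ}
    (hM : D.Mild s τ χ (fun r k => D.kap k * convSeq (g r) (b r) k) b)
    (hb : ∫⁻ t in Ioc s τ, D.enrm 0 (b t) ≠ ∞) :
    ∃ β : ℝ → D.Ell, ∀ t ∈ Ioc s τ, ∀ k, β t k = b t k := by
  have hfin : ∀ t ∈ Ioc s τ, b t ∈ ell1Submodule D.omega := by
    intro t ht
    have hm : (s + t) / 2 ∈ Ioo s τ := ⟨by linarith [ht.1], by linarith [ht.1, ht.2]⟩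
    obtain ⟨M, hM0, hM1⟩ := hM.smooth_bound (fun m => hg.affine_bound hs b m)
      (hg.continuousOn_conv hM.continuousOn) hb 0 hm
    rw [D.mem_ell_iff]
    refine ne_top_of_le_ne_top hM0 (D.enrm_le_of_abs_le fun k => ?_)
    exact (hM1 t ⟨by linarith [ht.1], ht.2⟩ k).trans (le_abs_self _)
  classical
  refine ⟨fun t => if h : b t ∈ ell1Submodule D.omega then Ell1.mk _ h else 0, fun t ht k => ?_⟩
  exact congrArg (fun a : D.Ell => a k) (dif_pos (hfin t ht))

end Evolution

section U

variable {abar : ℝ → D.Ell} {s τ : ℝ}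

theorem isLinSol_of_mild {B : ℕ} (hg : IsKernel (D.linKer abar) B) (hs : 0 ≤ s) (hsτ : s < τ)
    {χ : D.EllNeg} {β : ℝ → D.Ell}
    (hM : D.Mild s τ χ (fun r k => D.kap k * convSeq (D.linKer abar r) (β r) k) fun t k => β t k)
    (hb : ∫⁻ t in Ioc s τ, D.enrm 0 (β t) ≠ ∞) : D.IsLinSol abar τ s χ β := by
  have hc := hg.continuousOn_conv hM.continuousOn
  obtain ⟨B', h1, -, h3, h4, -⟩ := hM.regularity (fun m => hg.affine_bound hs _ m) hc hb
  refine ⟨h4, fun t ht k => ?_, ?_⟩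
  · have h5 := (h3 t ⟨ht.1, ht.2.le⟩).hasDerivAt
      (Filter.mem_of_superset (Ioo_mem_nhds ht.1 ht.2) Ioo_subset_Ioc_self)
    rw [h5.deriv, h1 t ⟨ht.1, ht.2.le⟩, Q_apply, DN_apply]
  · obtain ⟨M, hM0, hM1⟩ := hM.exists_bound (-D.p)
      (fun k => ((hc k).aestronglyMeasurable measurableSet_Ioc).enorm)
      (D.enrm_ellNeg_ne_top χ) (by
        rw [neg_add_cancel]
        exact lintegral_mild_linear_ne_top hg hs 0 hb)
    refine Ell1.tendsto_of_dominated (B := fun k => |M k|) (D.summable_omegaNeg hM0)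
      (fun k => hM.tendsto hsτ k) ?_
    filter_upwards [Ioc_mem_nhdsGT hsτ] with t ht k
    exact (hM1 t ht k).trans (le_abs_self _)

/-- The limit at `s` bounds the solution in `ℓ¹_{ω,-q}` up to the initial time. This gives the
integrability of the force and the finiteness required for uniqueness. -/
theorem IsLinSol.mild {B : ℕ} (hg : IsKernel (D.linKer abar) B)
    {χ : D.EllNeg} {β : ℝ → D.Ell} (h : D.IsLinSol abar τ s χ β) :
    D.Mild s τ χ (fun r k => D.kap k * convSeq (D.linKer abar r) (β r) k) (fun t k => β t k) ∧
      ∫⁻ t in Ioc s τ, D.enrm (-D.p) (β t) ≠ ∞ := by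
  obtain ⟨⟨h1, -, h2⟩, h3, h4⟩ := h
  obtain ⟨R, hR⟩ := exists_norm_le_of_tendsto (D.continuous_incl.comp_continuousOn h1) h4
  obtain ⟨C, hC⟩ := D.exists_enrm_le_enorm_ellNeg
  have hk : ∀ k, ContinuousOn (fun t => β t k) (Ioc s τ) := fun k =>
    (Ell1.coord D.omega k).continuous.comp_continuousOn h1
  have hfin : ∫⁻ t in Ioc s τ, D.enrm (-D.p) (β t) ≠ ∞ := by
    refine ne_top_of_le_ne_top (lintegral_Ioc_const_ne_top (C * R) s τ)
      (setLIntegral_mono' measurableSet_Ioc fun t ht => ?_)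
    rw [← D.enrm_incl]
    refine (hC (D.incl (β t))).trans ?_
    push_cast
    refine mul_le_mul_right ?_ _
    rw [enorm_le_coe]
    exact hR t ht
  refine ⟨mild_of_hasDerivAt (fun k => ?_) hk (fun k t ht => ?_) fun k => ?_, hfin⟩
  · exact (hg.integrableOn_conv (integrableOn_of_lintegral_enrm
      (fun k => (hk k).aestronglyMeasurable measurableSet_Ioc) hfin) k).const_mul _
  · have h5 : HasDerivAt β (deriv β t) t :=
      (((h2 t ht).contDiffAt (Ioo_mem_nhds ht.1 ht.2)).differentiableAt one_ne_zero).hasDerivAt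
    have h6 := (Ell1.coord D.omega k).hasFDerivAt.comp_hasDerivAt t h5
    have h7 := h3 t ht k
    rw [Q_apply, DN_apply] at h7
    rw [← h7]
    exact h6
  · exact ((Ell1.coord D.omegaNeg k).continuous.tendsto _).comp h4

theorem mild_linear_unique' {B : ℕ} {g : ℝ → (Fin d → ℕ) → ℝ} (hg : IsKernel g B)
    {χ : (Fin d → ℕ) → ℝ} {b b' : ℝ → (Fin d → ℕ) → ℝ} (hs : 0 ≤ s)
    (h : D.Mild s τ χ (fun r k => D.kap k * convSeq (g r) (b r) k) b)
    (h' : D.Mild s τ χ (fun r k => D.kap k * convSeq (g r) (b' r) k) b')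
    (hb : ∫⁻ t in Ioc s τ, D.enrm (-D.p) (b t) ≠ ∞)
    (hb' : ∫⁻ t in Ioc s τ, D.enrm (-D.p) (b' t) ≠ ∞) :
    ∀ t ∈ Ioc s τ, ∀ k, b t k = b' t k :=
  mild_linear_unique (F := fun _ _ => 0) hg hs
    (h.congr (fun _ _ _ => (add_zero _).symm) fun _ _ _ => rfl)
    (h'.congr (fun _ _ _ => (add_zero _).symm) fun _ _ _ => rfl) hb hb'

/-- The evolution operator is the sum of the Picard series. -/
theorem U_eq_evol {B : ℕ} (hg : IsKernel (D.linKer abar) B) (hs : 0 ≤ s) {t : ℝ}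
    (ht : t ∈ Ioc s τ) (χ : D.EllNeg) (k : Fin d → ℕ) :
    D.U abar τ t s χ k = D.evol (D.linKer abar) (fun _ => χ) t s k := by
  have hsτ : s < τ := ht.1.trans_le ht.2
  have hP : ∀ k, Measurable fun _ : ℝ => χ k := fun k => measurable_const
  have hχ := D.enrm_ellNeg_ne_top χ
  have hE := mild_evol (D := D) (τ := τ) hg hP hs hχ
  have hE0 : ∫⁻ t in Ioc s τ, D.enrm 0 (D.evol (D.linKer abar) (fun _ => χ) t s) ≠ ∞ := by
    obtain ⟨C, hC⟩ := exists_lintegral_evol_le hg D τ 0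
    rw [zero_sub] at hC
    exact ne_top_of_le_ne_top (ENNReal.mul_ne_top ENNReal.coe_ne_top hχ) (hC _ hP s hs hχ)
  have hE1 : ∫⁻ t in Ioc s τ, D.enrm (-D.p) (D.evol (D.linKer abar) (fun _ => χ) t s) ≠ ∞ :=
    ne_top_of_le_ne_top hE0 (lintegral_mono fun t => D.enrm_mono (by omega) _)
  obtain ⟨β, hβ⟩ := exists_ell_of_mild hg hs hE hE0
  have hβ' : ∀ t ∈ Ioc s τ, (β t : (Fin d → ℕ) → ℝ) = D.evol (D.linKer abar) (fun _ => χ) t s :=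
    fun t ht => funext (hβ t ht)
  have hβM : D.Mild s τ χ (fun r k => D.kap k * convSeq (D.linKer abar r) (β r) k)
      fun t k => β t k :=
    hE.congr (fun t ht k => by rw [hβ' t ht]) (fun t ht k => (hβ t ht k).symm)
  have hex : ∃ b, D.IsLinSol abar τ s χ b := by
    refine ⟨β, isLinSol_of_mild hg hs hsτ hβM ?_⟩
    rwa [setLIntegral_congr_fun measurableSet_Ioc
      fun t ht => congrArg (D.enrm 0) (hβ' t ht)]
  -- A solution exists, so the default value is not taken; uniqueness makes the choice irrelevant on
  -- `(s, τ]`.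
  rw [U, dif_pos hex]
  obtain ⟨h1, h2⟩ := hex.choose_spec.mild hg
  exact mild_linear_unique' hg hs h1 hE h2 hE1 t ht k

theorem mild_U {B : ℕ} (hg : IsKernel (D.linKer abar) B) (hs : 0 ≤ s) (χ : D.EllNeg) :
    D.Mild s τ χ (fun r k => D.kap k * convSeq (D.linKer abar r) (D.U abar τ r s χ) k)
      (fun t k => D.U abar τ t s χ k) := by
  refine (mild_evol (D := D) (τ := τ) hg (P := fun _ => χ) (fun k => measurable_const) hs
    (D.enrm_ellNeg_ne_top χ)).congr (fun t ht k => ?_) fun t ht k => (U_eq_evol hg hs ht χ k).symm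
  rw [show (D.U abar τ t s χ : (Fin d → ℕ) → ℝ) = _ from funext (U_eq_evol hg hs ht χ)]

theorem lintegral_U_ne_top {B : ℕ} (hg : IsKernel (D.linKer abar) B) (hs : 0 ≤ s) (χ : D.EllNeg)
    {m : ℤ} (hχ : D.enrm (m - D.p) χ ≠ ∞) :
    ∫⁻ t in Ioc s τ, D.enrm m (D.U abar τ t s χ) ≠ ∞ := by
  obtain ⟨C, hC⟩ := exists_lintegral_evol_le hg D τ m
  rw [setLIntegral_congr_fun measurableSet_Ioc
      fun t ht => congrArg (D.enrm m) (funext (U_eq_evol hg hs ht χ))]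
  exact ne_top_of_le_ne_top (ENNReal.mul_ne_top ENNReal.coe_ne_top hχ)
    (hC (fun _ => χ) (fun k => measurable_const) s hs hχ)

theorem lintegral_U_neg_ne_top {B : ℕ} (hg : IsKernel (D.linKer abar) B) (hs : 0 ≤ s)
    (χ : D.EllNeg) : ∫⁻ t in Ioc s τ, D.enrm (-D.p) (D.U abar τ t s χ) ≠ ∞ := by
  refine ne_top_of_le_ne_top (lintegral_U_ne_top (m := 0) hg hs χ ?_)
    (lintegral_mono fun t => D.enrm_mono (by omega) _)
  rw [zero_sub]
  exact D.enrm_ellNeg_ne_top χ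

theorem U_unique {B : ℕ} (hg : IsKernel (D.linKer abar) B) (hs : 0 ≤ s) {χ : D.EllNeg}
    {b : ℝ → (Fin d → ℕ) → ℝ}
    (h : D.Mild s τ χ (fun r k => D.kap k * convSeq (D.linKer abar r) (b r) k) b)
    (hb : ∫⁻ t in Ioc s τ, D.enrm (-D.p) (b t) ≠ ∞) :
    ∀ t ∈ Ioc s τ, ∀ k, D.U abar τ t s χ k = b t k :=
  mild_linear_unique' hg hs (mild_U hg hs χ) h (lintegral_U_neg_ne_top hg hs χ) hb

theorem U_sub {B : ℕ} (hg : IsKernel (D.linKer abar) B) (hs : 0 ≤ s) {t : ℝ}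
    (ht : t ∈ Ioc s τ) (χ χ' : D.EllNeg) :
    D.U abar τ t s (χ - χ') = D.U abar τ t s χ - D.U abar τ t s χ' := by
  have h := (mild_U (τ := τ) hg hs χ).sub (mild_U hg hs χ')
  have hint := fun χ => lintegral_U_neg_ne_top (τ := τ) hg hs χ
  have hm := fun (χ : D.EllNeg) k => (mild_U (τ := τ) hg hs χ).aemeasurable k
  ext k
  refine U_unique hg hs (b := fun t k => D.U abar τ t s χ k - D.U abar τ t s χ' k)
    (h.congr (fun r _ k => ?_) fun _ _ _ => rfl) ?_ t ht k
  · rw [hg.conv_sub]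
    ring
  · refine ne_top_of_le_ne_top (ENNReal.add_ne_top.2 ⟨hint χ, hint χ'⟩) ?_
    rw [← lintegral_add_left']
    · exact lintegral_mono fun t => D.enrm_sub_le _ _ _
    · unfold enrm
      exact AEMeasurable.tsum fun k => (hm χ k).const_mul _

/-- The cocycle property of the evolution operator. -/
theorem U_cocycle {B : ℕ} (hg : IsKernel (D.linKer abar) B) (hs : 0 ≤ s) {r t : ℝ}
    (hr : r ∈ Ioo s τ) (ht : t ∈ Ioc r τ) (χ : D.EllNeg) :
    D.U abar τ t r (D.incl (D.U abar τ r s χ)) = D.U abar τ t s χ := by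
  ext k
  refine U_unique hg (hs.trans hr.1.le) (b := fun t k => D.U abar τ t s χ k)
    ((mild_U hg hs χ).restart ⟨hr.1, hr.2.le⟩) ?_ t ht k
  exact ne_top_of_le_ne_top (lintegral_U_neg_ne_top hg hs χ)
    (lintegral_mono_set (Ioc_subset_Ioc_left hr.1.le))

/-- On `ℓ¹_ω` the initial value of the linear problem is attained in `ℓ¹_ω`. -/
theorem tendsto_U {B : ℕ} (hg : IsKernel (D.linKer abar) B) (hs : 0 ≤ s) (hsτ : s < τ)
    (φ : D.Ell) : Tendsto (fun t => D.U abar τ t s (D.incl φ)) (𝓝[>] s) (𝓝 φ) := by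
  have hM := mild_U (τ := τ) hg hs (D.incl φ)
  have hc := hg.continuousOn_conv hM.continuousOn
  have hfin : D.enrm 0 (D.incl φ) ≠ ∞ := by
    rw [enrm_incl]
    exact D.enrm_zero_ell_ne_top φ
  obtain ⟨M, hM0, hM1⟩ := hM.exists_bound 0
    (fun k => ((hc k).aestronglyMeasurable measurableSet_Ioc).enorm) hfin (by
      rw [zero_add]
      refine lintegral_mild_linear_ne_top hg hs _ (lintegral_U_ne_top hg hs _ ?_)
      rwa [sub_self])
  have hM0' : D.enrm 0 (fun k => |M k|) ≠ ∞ :=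
    ne_top_of_le_ne_top hM0 (D.enrm_le_of_abs_le fun k => by rw [abs_abs])
  refine Ell1.tendsto_of_dominated (B := fun k => |M k|)
    (summable_of_majorant (fun k => abs_nonneg _) hM0') (fun k => hM.tendsto hsτ k) ?_
  filter_upwards [Ioc_mem_nhdsGT hsτ] with t ht k
  exact (hM1 t ht k).trans (le_abs_self _)

/-- The hypothesis covers only positive initial times. Write `U(t, 0) = U(t, r) U(r, 0)` and let `r
→ 0+`; on `ℓ¹_ω` the initial value is attained in norm. -/
theorem norm_U_zero_le {B : ℕ} (hg : IsKernel (D.linKer abar) B) {W : ℝ}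
    (hW : ∀ s t : ℝ, 0 < s → s < t → t ≤ τ → ∀ χ : D.Ell, ‖D.U abar τ t s (D.incl χ)‖ ≤ W * ‖χ‖)
    {t : ℝ} (ht : t ∈ Ioc 0 τ) (φ : D.Ell) : ‖D.U abar τ t 0 (D.incl φ)‖ ≤ W * ‖φ‖ := by
  have h1 : Tendsto (fun r => W * ‖D.U abar τ r 0 (D.incl φ)‖) (𝓝[>] 0) (𝓝 (W * ‖φ‖)) :=
    (tendsto_U hg le_rfl (ht.1.trans_le ht.2) φ).norm.const_mul W
  refine ge_of_tendsto h1 ?_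
  filter_upwards [Ioo_mem_nhdsGT ht.1] with r hr
  rw [← U_cocycle hg le_rfl ⟨hr.1, hr.2.trans_le ht.2⟩ ⟨hr.2, ht.2⟩]
  exact hW r t hr.1 hr.2 ht.2 _

end U

end Setting

theorem integrableOn_sub_rpow {γ : ℝ} (hγ : γ < 1) {a t : ℝ} (hat : a ≤ t) :
    IntegrableOn (fun r => (t - r) ^ (-γ)) (Ioc a t) ∧
      ∫ r in Ioc a t, (t - r) ^ (-γ) = (t - a) ^ (1 - γ) / (1 - γ) := by
  have h1 : IntervalIntegrable (fun x : ℝ => x ^ (-γ)) volume (t - t) (t - a) :=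
    intervalIntegral.intervalIntegrable_rpow' (by linarith)
  have h2 := h1.comp_sub_left t
  rw [sub_sub_cancel, sub_sub_cancel] at h2
  refine ⟨(intervalIntegrable_iff_integrableOn_Ioc_of_le hat).1 h2.symm, ?_⟩
  rw [← intervalIntegral.integral_of_le hat,
    intervalIntegral.integral_comp_sub_left (fun x : ℝ => x ^ (-γ)) t, sub_self,
    integral_rpow (Or.inl (by linarith)), Real.zero_rpow (by linarith), sub_zero]
  congr 1 <;> ring_nf

namespace Setting

variable {d : ℕ} (D : Setting d)

/-! ### The diagonal semigroup -/

/-- The smoothing estimate of the semigroup. -/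
theorem exists_theta_mul_exp_le (X : ℝ) : ∃ K : ℝ≥0, ∀ k, ∀ x ∈ Ioc 0 X,
    |D.kap k| * Real.exp (D.mu k * x) ≤ K * x ^ (-(1 / 2) : ℝ) := by
  have hc := D.cPar_pos
  refine ⟨NNReal.mk (Real.exp (D.Lam * X) * (√X + (√D.cPar)⁻¹)) (by positivity), fun k x hx => ?_⟩
  have hx0 : 0 < √x := Real.sqrt_pos.2 hx.1
  have hθ := D.one_le_theta k
  rw [Real.rpow_neg hx.1.le, ← Real.sqrt_eq_rpow, NNReal.coe_mk]
  have h1 : Real.exp (D.mu k * x)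
      ≤ Real.exp (D.Lam * X) * Real.exp (-(D.cPar * D.theta k ^ (D.p + 1) * x)) := by
    rw [← Real.exp_add]
    refine Real.exp_le_exp.2 ?_
    have h2 := mul_le_mul_of_nonneg_right (D.cPar_mul_le k) hx.1.le
    have h3 := mul_le_mul_of_nonneg_left hx.2 D.Lam_nonneg
    linarith
  -- For `p = 0` use `1 ≤ √X / √x`. For `p = 1` put `y = θ √(c x)` and use `y e^{-y²} ≤ 1`. The
  -- singularity `x^{-1/2}` is integrable.
  have h4 : D.theta k ^ D.p * Real.exp (-(D.cPar * D.theta k ^ (D.p + 1) * x))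
      ≤ (√X + (√D.cPar)⁻¹) * (√x)⁻¹ := by
    rcases Nat.le_one_iff_eq_zero_or_eq_one.1 D.p_le_one with hp | hp
    · rw [hp, pow_zero, one_mul]
      calc Real.exp (-(D.cPar * D.theta k ^ (0 + 1) * x)) ≤ 1 := by
            rw [Real.exp_le_one_iff]
            have : 0 ≤ D.cPar * D.theta k ^ (0 + 1) * x := by
              have := hx.1
              positivity
            linarith
        _ = √x * (√x)⁻¹ := (mul_inv_cancel₀ hx0.ne').symm
        _ ≤ _ := by
            refine mul_le_mul_of_nonneg_right ?_ (by positivity)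
            have : 0 ≤ (√D.cPar)⁻¹ := by positivity
            linarith [Real.sqrt_le_sqrt hx.2]
    · rw [hp, pow_one]
      set y := D.theta k * √D.cPar * √x with hy
      have hy2 : D.cPar * D.theta k ^ (1 + 1) * x = y ^ 2 := by
        rw [hy, mul_pow, mul_pow, Real.sq_sqrt hc.le, Real.sq_sqrt hx.1.le]
        ring
      have h5 : y * Real.exp (-y ^ 2) ≤ 1 := by
        rw [Real.exp_neg, ← div_eq_mul_inv, div_le_one (Real.exp_pos _)]
        nlinarith [Real.add_one_le_exp (y ^ 2), sq_nonneg (y - 1)]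
      have hsc : 0 < √D.cPar := Real.sqrt_pos.2 hc
      rw [hy2]
      calc D.theta k * Real.exp (-y ^ 2)
          = (y * Real.exp (-y ^ 2)) * ((√D.cPar)⁻¹ * (√x)⁻¹) := by
            rw [hy]
            field_simp
        _ ≤ 1 * ((√D.cPar)⁻¹ * (√x)⁻¹) := mul_le_mul_of_nonneg_right h5 (by positivity)
        _ ≤ _ := by
            rw [one_mul]
            refine mul_le_mul_of_nonneg_right ?_ (by positivity)
            linarith [Real.sqrt_nonneg X]
  calc |D.kap k| * Real.exp (D.mu k * x)
      ≤ D.theta k ^ D.p *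
        (Real.exp (D.Lam * X) * Real.exp (-(D.cPar * D.theta k ^ (D.p + 1) * x))) :=
        mul_le_mul (D.abs_kap_le k) h1 (Real.exp_pos _).le (pow_nonneg (D.theta_pos k).le _)
    _ = Real.exp (D.Lam * X) *
        (D.theta k ^ D.p * Real.exp (-(D.cPar * D.theta k ^ (D.p + 1) * x))) := by ring
    _ ≤ Real.exp (D.Lam * X) * ((√X + (√D.cPar)⁻¹) * (√x)⁻¹) :=
        mul_le_mul_of_nonneg_left h4 (Real.exp_pos _).le
    _ = _ := by ring

/-- The semigroup generated by `ℒ` (the identity for negative times). -/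
def heat (x : ℝ) (a : D.Ell) : D.Ell :=
  Ell1.mk (fun k => Real.exp (D.mu k * max x 0) * a k) (by
    refine Summable.of_nonneg_of_le (fun k => mul_nonneg (abs_nonneg _) (D.omega k).2.le)
      (fun k => ?_) (a.summable.mul_left (Real.exp (D.Lam * max x 0)))
    rw [abs_mul, Real.abs_exp, mul_assoc]
    refine mul_le_mul_of_nonneg_right (Real.exp_le_exp.2 ?_)
      (mul_nonneg (abs_nonneg _) (D.omega k).2.le)
    exact mul_le_mul_of_nonneg_right (D.mu_le k) (le_max_right _ _))

theorem heat_apply (x : ℝ) (a : D.Ell) (k : Fin d → ℕ) :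
    D.heat x a k = Real.exp (D.mu k * max x 0) * a k := rfl

theorem heat_apply_of_nonneg {x : ℝ} (hx : 0 ≤ x) (a : D.Ell) (k : Fin d → ℕ) :
    D.heat x a k = Real.exp (D.mu k * x) * a k := by rw [heat_apply, max_eq_left hx]

theorem heat_zero (a : D.Ell) : D.heat 0 a = a := by
  ext k
  simp [heat_apply]

theorem continuous_heat (a : D.Ell) : Continuous fun x => D.heat x a := by
  rw [continuous_iff_continuousAt]
  intro x
  refine ContinuousOn.continuousAt (s := Iic (x + 1)) ?_ (Iic_mem_nhds (lt_add_one x))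
  refine Ell1.continuousOn_of_dominated
    (M := fun k => Real.exp (D.Lam * max (x + 1) 0) * |a k|) ?_ (fun k => ?_) fun t ht k => ?_
  · refine (a.summable.mul_left (Real.exp (D.Lam * max (x + 1) 0))).congr fun k => ?_
    rw [mul_assoc]
  · simp only [heat_apply]
    fun_prop
  · rw [heat_apply, abs_mul, Real.abs_exp]
    refine mul_le_mul_of_nonneg_right (Real.exp_le_exp.2 ?_) (abs_nonneg _)
    exact (mul_le_mul_of_nonneg_right (D.mu_le k) (le_max_right _ _)).trans
      (mul_le_mul_of_nonneg_left (max_le_max_right _ ht) D.Lam_nonneg)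

variable {D} {s τ : ℝ} {χ : (Fin d → ℕ) → ℝ} {h b : ℝ → (Fin d → ℕ) → ℝ}

/-- A bounded force keeps the mild solution close to the semigroup orbit. -/
theorem exists_norm_sub_heat_le (β : ℝ → D.Ell)
    (hh : ∀ k, AEMeasurable (fun r => ‖h r k‖ₑ) (volume.restrict (Ioc s τ))) {H : ℝ≥0}
    (hH : ∀ t ∈ Ioc s τ, D.enrm 0 (h t) ≤ H) :
    ∃ C : ℝ, ∀ (φ : D.Ell) (r : ℝ), s ≤ r →
      D.Mild r τ φ (fun r k => D.kap k * h r k) (fun t k => β t k) →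
      ∀ t ∈ Ioc r τ, ‖β t - D.heat (t - r) φ‖ ≤ C * √(t - r) := by
  obtain ⟨K, hK⟩ := D.exists_theta_mul_exp_le (τ - s)
  -- The `2` comes from `∫ (t - x)^{-1/2} dx = 2 √(t - r)`. The constant depends neither on the
  -- restart time `r` nor on `φ`.
  refine ⟨K * 2 * H, fun φ r hr hMr t ht => ?_⟩
  have htr : 0 < t - r := sub_pos.2 ht.1
  have h0 : D.Mild r τ (fun _ => 0) (fun r k => D.kap k * h r k)
      (fun t k => β t k - Real.exp (D.mu k * (t - r)) * φ k) := by
    refine ⟨hMr.1, fun t ht k => ?_⟩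
    refine (congrArg (· - Real.exp (D.mu k * (t - r)) * φ k) (hMr.2 t ht k)).trans ?_
    ring
  have hsub : Ioc r t ⊆ Ioc s τ := fun x hx => ⟨lt_of_le_of_lt hr hx.1, hx.2.trans ht.2⟩
  have h1 : D.enrm 0 (β t - D.heat (t - r) φ : D.Ell)
      ≤ ∑' k, ∫⁻ x in Ioc r t, ENNReal.ofReal (K * (t - x) ^ (-(1 / 2) : ℝ)) *
          (D.wt 0 k * ‖h x k‖ₑ) := by
    refine ENNReal.tsum_le_tsum fun k => ?_
    have h2 := h0.enorm_le ht k
    rw [enorm_zero, mul_zero, zero_add] at h2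
    rw [Ell1.sub_apply, heat_apply_of_nonneg D htr.le]
    refine (mul_le_mul_right h2 _).trans ?_
    rw [← lintegral_const_mul' _ _ (D.wt_ne_top 0 k)]
    refine lintegral_mono_ae ?_
    have hne : ∀ᵐ x : ℝ ∂(volume.restrict (Ioc r t)), x ≠ t :=
      ae_restrict_of_ae (by simp [ae_iff])
    filter_upwards [hne, ae_restrict_mem measurableSet_Ioc] with x hxt hx
    rw [enorm_mul, mul_left_comm, mul_left_comm (D.wt 0 k), ← mul_assoc]
    refine mul_le_mul_left ?_ _
    rw [← ofReal_norm, ← ENNReal.ofReal_mul (Real.exp_pos _).le, mul_comm]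
    refine ENNReal.ofReal_le_ofReal (hK k (t - x) ⟨?_, ?_⟩)
    · exact sub_pos.2 (lt_of_le_of_ne hx.2 hxt)
    · linarith [hx.1, ht.2]
  obtain ⟨hi, hI⟩ := integrableOn_sub_rpow (γ := 1 / 2) (by norm_num) ht.1.le
  have hnn : ∀ x ∈ Ioc r t, 0 ≤ (t - x) ^ (-(1 / 2) : ℝ) := fun x hx =>
    Real.rpow_nonneg (sub_nonneg.2 hx.2) _
  have h3 : D.enrm 0 (β t - D.heat (t - r) φ : D.Ell)
      ≤ ENNReal.ofReal (K * 2 * H * √(t - r)) := by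
    refine h1.trans ?_
    rw [← lintegral_tsum]
    · simp only [ENNReal.tsum_mul_left]
      calc ∫⁻ x in Ioc r t, ENNReal.ofReal (K * (t - x) ^ (-(1 / 2) : ℝ)) *
            ∑' k, D.wt 0 k * ‖h x k‖ₑ
          ≤ ∫⁻ x in Ioc r t, ENNReal.ofReal (K * (t - x) ^ (-(1 / 2) : ℝ)) * H :=
            setLIntegral_mono' measurableSet_Ioc fun x hx =>
              mul_le_mul_right (hH x (hsub hx)) _
        _ = ENNReal.ofReal (∫ x in Ioc r t, K * (t - x) ^ (-(1 / 2) : ℝ)) * H := by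
            rw [lintegral_mul_const' _ _ ENNReal.coe_ne_top,
              ofReal_integral_eq_lintegral_ofReal (hi.const_mul _)]
            filter_upwards [ae_restrict_mem measurableSet_Ioc] with x hx
            exact mul_nonneg K.coe_nonneg (hnn x hx)
        _ = _ := by
            rw [integral_const_mul, hI, ← ENNReal.ofReal_coe_nnreal,
              ← ENNReal.ofReal_mul (by
                have := Real.rpow_nonneg htr.le (1 - 1 / 2)
                positivity), Real.sqrt_eq_rpow]
            congr 1
            rw [show (1 - 1 / 2 : ℝ) = 1 / 2 by norm_num]
            ring
    · intro k
      refine AEMeasurable.mul (Measurable.aemeasurable (f := fun x : ℝ =>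
        ENNReal.ofReal (K * (t - x) ^ (-(1 / 2) : ℝ))) (by fun_prop)) (AEMeasurable.const_mul ?_ _)
      exact (hh k).mono_measure (Measure.restrict_mono hsub le_rfl)
  rw [enrm_zero_ell] at h3
  exact (ENNReal.ofReal_le_ofReal_iff (by positivity)).1 h3

/-- A mild solution with bounded force is continuous with values in `ℓ¹_ω`. -/
theorem Mild.continuousOn_ell {β : ℝ → D.Ell}
    (hM : D.Mild s τ χ (fun r k => D.kap k * h r k) (fun t k => β t k))
    (hh : ∀ k, AEMeasurable (fun r => ‖h r k‖ₑ) (volume.restrict (Ioc s τ))) {H : ℝ≥0}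
    (hH : ∀ t ∈ Ioc s τ, D.enrm 0 (h t) ≤ H) : ContinuousOn β (Ioc s τ) := by
  obtain ⟨C, hC⟩ := exists_norm_sub_heat_le β hh hH
  intro t₀ ht₀
  -- Near `t₀` the solution is approximated by the continuous semigroup orbit restarted at `t₀ - η`,
  -- with an error of at most `C √(2η)`.
  refine continuousWithinAt_of_locally_uniform_approx_of_continuousWithinAt ht₀ fun u hu => ?_
  obtain ⟨ε, hε, hεu⟩ := Metric.mem_uniformity_dist.1 hu
  have hlim : Tendsto (fun η => C * √(t₀ + η - (t₀ - η))) (𝓝[>] 0) (𝓝 0) := by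
    have : Continuous fun η => C * √(t₀ + η - (t₀ - η)) := by fun_prop
    simpa using (this.tendsto 0).mono_left nhdsWithin_le_nhds
  obtain ⟨η, ⟨h1, h2⟩, h3⟩ := ((hlim.eventually_lt_const hε).and
    (Ioo_mem_nhdsGT (sub_pos.2 ht₀.1))).exists.imp fun η h => (⟨⟨h.2, h.1⟩, h.2.1⟩ :
      ((η ∈ Ioo 0 (t₀ - s)) ∧ _) ∧ 0 < η)
  have hr : t₀ - η ∈ Ioc s τ := ⟨by linarith [h1.2], by linarith [ht₀.2]⟩
  refine ⟨Ioo (t₀ - η) (t₀ + η) ∩ Ioc s τ, inter_mem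
    (mem_nhdsWithin_of_mem_nhds (Ioo_mem_nhds (by linarith) (by linarith))) self_mem_nhdsWithin,
    fun t => D.heat (t - (t₀ - η)) (β (t₀ - η)),
    ((D.continuous_heat _).comp (by fun_prop)).continuousWithinAt, fun t ht => hεu ?_⟩
  have h4 := hC (β (t₀ - η)) (t₀ - η) hr.1.le (hM.restart hr) t ⟨ht.1.1, ht.2.2⟩
  have h0 := (norm_nonneg _).trans h4
  have hC0 : 0 ≤ C := nonneg_of_mul_nonneg_left h0 (Real.sqrt_pos.2 (by linarith [ht.1.1]))
  rw [dist_eq_norm]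
  refine h4.trans_lt (lt_of_le_of_lt (mul_le_mul_of_nonneg_left (Real.sqrt_le_sqrt ?_) hC0) h2)
  linarith [ht.1.2]

/-- A mild solution with bounded force attains its initial value in `ℓ¹_ω`. -/
theorem Mild.tendsto_ell {β : ℝ → D.Ell} {φ : D.Ell} (hsτ : s < τ)
    (hM : D.Mild s τ φ (fun r k => D.kap k * h r k) (fun t k => β t k))
    (hh : ∀ k, AEMeasurable (fun r => ‖h r k‖ₑ) (volume.restrict (Ioc s τ))) {H : ℝ≥0}
    (hH : ∀ t ∈ Ioc s τ, D.enrm 0 (h t) ≤ H) : Tendsto β (𝓝[>] s) (𝓝 φ) := by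
  obtain ⟨C, hC⟩ := exists_norm_sub_heat_le β hh hH
  have h1 : Tendsto (fun t => D.heat (t - s) φ) (𝓝[>] s) (𝓝 φ) := by
    have h2 : Continuous fun t => D.heat (t - s) φ := (D.continuous_heat φ).comp (by fun_prop)
    have h3 := (h2.tendsto s).mono_left (nhdsWithin_le_nhds (s := Ioi s))
    rwa [sub_self, heat_zero] at h3
  have h4 : Tendsto (fun t => β t - D.heat (t - s) φ) (𝓝[>] s) (𝓝 0) := by
    refine squeeze_zero_norm' (a := fun t => C * √(t - s)) ?_ ?_
    · filter_upwards [Ioc_mem_nhdsGT hsτ] with t ht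
      exact hC φ s le_rfl hM t ht
    · have : Continuous fun t => C * √(t - s) := by fun_prop
      simpa using (this.tendsto s).mono_left (nhdsWithin_le_nhds (s := Ioi s))
  simpa using h4.add h1

end Setting

/-! ### The forced linear problem and the operator `DF(ā)⁻¹` -/

namespace Setting

variable {d : ℕ} {D : Setting d}

/-- A forcing term on `(0, τ]`, extended by zero. -/
def mask (D : Setting d) (τ : ℝ) (P : ℝ → D.EllNeg) (s : ℝ) (k : Fin d → ℕ) : ℝ :=
  (Ioc 0 τ).indicator (fun s => P s k) s

theorem mask_of_mem {τ s : ℝ} (hs : s ∈ Ioc 0 τ) (P : ℝ → D.EllNeg) :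
    D.mask τ P s = (P s : (Fin d → ℕ) → ℝ) := funext fun _ => indicator_of_mem hs _

theorem measurable_mask {τ : ℝ} {P : ℝ → D.EllNeg}
    (hP : ∀ k, ContinuousOn (fun s => P s k) (Ioc 0 τ)) (k : Fin d → ℕ) :
    Measurable fun s => D.mask τ P s k := by
  have := (hP k).measurable_piecewise (g := fun _ => 0) continuousOn_const measurableSet_Ioc
  rwa [show (fun _ : ℝ => (0 : ℝ)) = 0 from rfl, piecewise_eq_indicator] at this

theorem enrm_mask_le {τ : ℝ} {P : ℝ → D.EllNeg} {m : ℤ} {R : ℝ≥0}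
    (hR : ∀ s ∈ Ioc 0 τ, D.enrm m (P s) ≤ R) (s : ℝ) : D.enrm m (D.mask τ P s) ≤ R := by
  by_cases hs : s ∈ Ioc 0 τ
  · rw [mask_of_mem hs]
    exact hR s hs
  · have : D.mask τ P s = fun _ => 0 := funext fun _ => indicator_of_notMem hs _
    rw [this, enrm_zero]
    exact zero_le

section Forcing

variable {abar : ℝ → D.Ell} {B : ℕ} {τ : ℝ}

theorem U_eq_evol_mask (hg : IsKernel (D.linKer abar) B) {P : ℝ → D.EllNeg} {s t : ℝ}
    (hs : 0 < s) (ht : t ∈ Ioc s τ) (k : Fin d → ℕ) :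
    D.U abar τ t s (P s) k = D.evol (D.linKer abar) (D.mask τ P) t s k := by
  rw [U_eq_evol hg hs.le ht]
  exact congrFun (D.evol_congr _ (mask_of_mem (P := P) ⟨hs, ht.1.le.trans ht.2⟩).symm t) k

theorem ae_U_eq_evol_mask (hg : IsKernel (D.linKer abar) B) {P : ℝ → D.EllNeg} {t : ℝ}
    (ht : t ≤ τ) (k : Fin d → ℕ) : ∀ᵐ s ∂(volume.restrict (Ioc 0 t)),
      D.evol (D.linKer abar) (D.mask τ P) t s k = D.U abar τ t s (P s) k := by
  have hne : ∀ᵐ s : ℝ ∂(volume.restrict (Ioc 0 t)), s ≠ t :=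
    ae_restrict_of_ae (by simp [ae_iff])
  filter_upwards [hne, ae_restrict_mem measurableSet_Ioc] with s hst hs
  exact (U_eq_evol_mask hg hs.1 ⟨lt_of_le_of_ne hs.2 hst, ht⟩ k).symm

/-- Admissible forcing terms. -/
structure IsForce (D : Setting d) (τ : ℝ) (P : ℝ → D.EllNeg) (R : ℝ≥0) : Prop where
  continuousOn : ∀ k, ContinuousOn (fun s => P s k) (Ioc 0 τ)
  enrm_le : ∀ s ∈ Ioc 0 τ, D.enrm (-D.p) (P s) ≤ R

theorem IsForce.aestronglyMeasurable (hg : IsKernel (D.linKer abar) B) {P : ℝ → D.EllNeg} {R : ℝ≥0}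
    (hP : IsForce D τ P R) {t : ℝ} (ht : t ∈ Ioc 0 τ) :
    AEStronglyMeasurable (fun s => D.U abar τ t s (P s)) (volume.restrict (Ioc 0 t)) :=
  Ell1.aestronglyMeasurable fun k =>
    ((integrableOn_evol hg (measurable_mask hP.continuousOn) (enrm_mask_le hP.enrm_le) ht
      k).aestronglyMeasurable).congr (ae_U_eq_evol_mask hg ht.2 k)

theorem DFinv_apply (hg : IsKernel (D.linKer abar) B) {P : ℝ → D.EllNeg} (φ : D.Ell) {t : ℝ}
    (ht : t ∈ Ioc 0 τ) (hi : IntegrableOn (fun s => D.U abar τ t s (P s)) (Ioc 0 t))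
    (k : Fin d → ℕ) :
    D.DFinv abar τ P φ t k = D.U abar τ t 0 (D.incl φ) k
      + ∫ s in Ioc 0 t, D.evol (D.linKer abar) (D.mask τ P) t s k := by
  rw [DFinv, Ell1.add_apply, intervalIntegral.integral_of_le ht.1.le]
  congr 1
  rw [← Ell1.coord_apply, ← (Ell1.coord D.omega k).integral_comp_comm hi]
  exact integral_congr_ae ((ae_U_eq_evol_mask hg ht.2 k).mono fun s hs => hs.symm)

/-- `DF(ā)⁻¹(P, φ)` is the mild solution of the linear problem. -/
theorem mild_DFinv (hg : IsKernel (D.linKer abar) B) {P : ℝ → D.EllNeg} {R : ℝ≥0}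
    (hP : IsForce D τ P R) (φ : D.Ell)
    (hi : ∀ t ∈ Ioc 0 τ, IntegrableOn (fun s => D.U abar τ t s (P s)) (Ioc 0 t)) :
    D.Mild 0 τ φ (fun r k => D.kap k * convSeq (D.linKer abar r) (D.DFinv abar τ P φ r) k + P r k)
      (fun t k => D.DFinv abar τ P φ t k) := by
  have h1 := mild_U (τ := τ) hg le_rfl (D.incl φ)
  have h2 := mild_duhamel (D := D) (τ := τ) hg (measurable_mask hP.continuousOn)
    (enrm_mask_le hP.enrm_le)
  have h3 := h1.add h2
  simp only [incl_apply, add_zero] at h3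
  refine h3.congr (fun t ht k => ?_) fun t ht k => (DFinv_apply hg φ ht (hi t ht) k).symm
  have e : (D.DFinv abar τ P φ t : (Fin d → ℕ) → ℝ) = _ :=
    funext (DFinv_apply hg φ ht (hi t ht))
  rw [e, mask_of_mem ht, ← add_assoc, ← mul_add]
  simp only [convSeq_eq_sum (hg.boxSupp _), mul_add, Finset.sum_add_distrib]

theorem eq_of_mild_linear {χ : (Fin d → ℕ) → ℝ} {F : ℝ → (Fin d → ℕ) → ℝ}
    (hg : IsKernel (D.linKer abar) B) {β β' : ℝ → D.Ell}
    (h : D.Mild 0 τ χ (fun r k => D.kap k * convSeq (D.linKer abar r) (β r) k + F r k)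
      (fun t k => β t k))
    (h' : D.Mild 0 τ χ (fun r k => D.kap k * convSeq (D.linKer abar r) (β' r) k + F r k)
      (fun t k => β' t k)) {R R' : ℝ} (hR : ∀ t ∈ Ioc 0 τ, ‖β t‖ ≤ R)
    (hR' : ∀ t ∈ Ioc 0 τ, ‖β' t‖ ≤ R') : ∀ t ∈ Ioc 0 τ, β t = β' t := by
  have hfin : ∀ {β : ℝ → D.Ell} {R : ℝ}, (∀ t ∈ Ioc 0 τ, ‖β t‖ ≤ R) →
      ∫⁻ t in Ioc 0 τ, D.enrm (-D.p) (β t) ≠ ∞ := by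
    intro β R hR
    refine ne_top_of_le_ne_top (lintegral_Ioc_const_ne_top R.toNNReal 0 τ)
      (setLIntegral_mono' measurableSet_Ioc fun t ht => ?_)
    refine (D.enrm_mono (show -(D.p : ℤ) ≤ 0 by omega) _).trans ?_
    rw [enrm_zero_ell]
    exact ENNReal.ofReal_le_ofReal (hR t ht)
  intro t ht
  ext k
  exact mild_linear_unique hg le_rfl h h' (hfin hR) (hfin hR') t ht k

variable {γ W Wq : ℝ}

/-- The uniform bounds of the evolution operator. -/
structure EvolBounds (D : Setting d) (abar : ℝ → D.Ell) (τ γ W Wq : ℝ) : Prop where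
  gamma_lt : γ < 1
  W_nonneg : 0 ≤ W
  Wq_nonneg : 0 ≤ Wq
  norm_incl_le : ∀ s t : ℝ, 0 < s → s < t → t ≤ τ → ∀ χ : D.Ell,
    ‖D.U abar τ t s (D.incl χ)‖ ≤ W * ‖χ‖
  norm_Q_le : ∀ s t : ℝ, 0 < s → s < t → t ≤ τ → ∀ ψ : D.Ell,
    (t - s) ^ γ * ‖D.U abar τ t s (D.Q ψ)‖ ≤ Wq * ‖ψ‖

/-- The forcing term `𝒬 ψ - ρ`. -/
def force (D : Setting d) (ψ ρ : ℝ → D.Ell) (s : ℝ) : D.EllNeg := D.Q (ψ s) - D.incl (ρ s)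

theorem force_apply (ψ ρ : ℝ → D.Ell) (s : ℝ) (k : Fin d → ℕ) :
    D.force ψ ρ s k = D.kap k * ψ s k - ρ s k := rfl

/-- Bounded, mode-wise continuous functions on `(0, τ]`. -/
structure IsAdm (D : Setting d) (τ : ℝ) (ψ : ℝ → D.Ell) (R : ℝ) : Prop where
  continuousOn : ∀ k, ContinuousOn (fun s => ψ s k) (Ioc 0 τ)
  norm_le : ∀ s ∈ Ioc 0 τ, ‖ψ s‖ ≤ R

theorem isForce_force {ψ ρ : ℝ → D.Ell} {Rψ Rρ : ℝ} (hψ : IsAdm D τ ψ Rψ) (hρ : IsAdm D τ ρ Rρ) :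
    IsForce D τ (D.force ψ ρ) (Rψ.toNNReal + Rρ.toNNReal) := by
  refine ⟨fun k => ?_, fun s hs => ?_⟩
  · simp only [force_apply]
    exact (continuousOn_const.mul (hψ.continuousOn k)).sub (hρ.continuousOn k)
  · have h1 : (D.force ψ ρ s : (Fin d → ℕ) → ℝ) = fun k => D.kap k * ψ s k - ρ s k := rfl
    rw [h1]
    refine (D.enrm_sub_le _ _ _).trans ?_
    push_cast
    refine add_le_add ?_ ?_
    · have h2 := D.enrm_kap_le 0 (ψ s)
      rw [zero_sub] at h2
      refine h2.trans ?_
      rw [enrm_zero_ell]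
      exact ENNReal.ofReal_le_ofReal (hψ.norm_le s hs)
    · refine (D.enrm_mono (show -(D.p : ℤ) ≤ 0 by omega) _).trans ?_
      rw [enrm_zero_ell]
      exact ENNReal.ofReal_le_ofReal (hρ.norm_le s hs)

theorem EvolBounds.norm_U_force_le (hE : EvolBounds D abar τ γ W Wq)
    (hg : IsKernel (D.linKer abar) B) {ψ ρ : ℝ → D.Ell} {Rψ Rρ : ℝ} (hψ : IsAdm D τ ψ Rψ)
    (hρ : IsAdm D τ ρ Rρ) {s t : ℝ} (hs : 0 < s) (ht : t ∈ Ioc s τ) :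
    ‖D.U abar τ t s (D.force ψ ρ s)‖ ≤ Wq * Rψ * (t - s) ^ (-γ) + W * Rρ := by
  have hsτ : s ∈ Ioc 0 τ := ⟨hs, ht.1.le.trans ht.2⟩
  have hpos : 0 < (t - s) ^ γ := Real.rpow_pos_of_pos (sub_pos.2 ht.1) _
  rw [force, U_sub hg hs.le ht]
  refine (norm_sub_le _ _).trans (add_le_add ?_ ?_)
  · rw [Real.rpow_neg (sub_pos.2 ht.1).le, ← div_eq_mul_inv, le_div_iff₀ hpos, mul_comm]
    exact (hE.norm_Q_le s t hs ht.1 ht.2 _).trans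
      (mul_le_mul_of_nonneg_left (hψ.norm_le s hsτ) hE.Wq_nonneg)
  · exact (hE.norm_incl_le s t hs ht.1 ht.2 _).trans
      (mul_le_mul_of_nonneg_left (hρ.norm_le s hsτ) hE.W_nonneg)

/-- The singularity `(t - s)^{-γ}` of `U(t, s) 𝒬` is integrable because `γ < 1`; its integral is the
source of the factor `τ^(1-γ) / (1-γ)`. -/
theorem EvolBounds.integrableOn_and_norm_le (hE : EvolBounds D abar τ γ W Wq)
    (hg : IsKernel (D.linKer abar) B) {ψ ρ : ℝ → D.Ell} {Rψ Rρ : ℝ} (hψ : IsAdm D τ ψ Rψ)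
    (hρ : IsAdm D τ ρ Rρ) {t : ℝ} (ht : t ∈ Ioc 0 τ) :
    IntegrableOn (fun s => D.U abar τ t s (D.force ψ ρ s)) (Ioc 0 t) ∧
      ‖∫ s in Ioc 0 t, D.U abar τ t s (D.force ψ ρ s)‖
        ≤ Wq * Rψ * (τ ^ (1 - γ) / (1 - γ)) + W * Rρ * τ := by
  have hRψ : 0 ≤ Rψ := (norm_nonneg _).trans (hψ.norm_le t ht)
  have hRρ : 0 ≤ Rρ := (norm_nonneg _).trans (hρ.norm_le t ht)
  obtain ⟨h1, h2⟩ := integrableOn_sub_rpow hE.gamma_lt ht.1.le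
  have h3 : IntegrableOn (fun s => Wq * Rψ * (t - s) ^ (-γ) + W * Rρ) (Ioc 0 t) :=
    (h1.const_mul _).add (integrableOn_const (by simp))
  have hne : ∀ᵐ s : ℝ ∂(volume.restrict (Ioc 0 t)), s ≠ t :=
    ae_restrict_of_ae (by simp [ae_iff])
  have hbd : ∀ᵐ s ∂(volume.restrict (Ioc 0 t)),
      ‖D.U abar τ t s (D.force ψ ρ s)‖ ≤ Wq * Rψ * (t - s) ^ (-γ) + W * Rρ := by
    filter_upwards [hne, ae_restrict_mem measurableSet_Ioc] with s hst hs
    exact hE.norm_U_force_le hg hψ hρ hs.1 ⟨lt_of_le_of_ne hs.2 hst, ht.2⟩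
  refine ⟨h3.mono' ((isForce_force hψ hρ).aestronglyMeasurable hg ht) hbd, ?_⟩
  refine (norm_integral_le_of_norm_le h3 hbd).trans ?_
  rw [integral_add (h1.const_mul _) (integrableOn_const (by simp)), integral_const_mul, h2,
    integral_const, sub_zero]
  simp only [measureReal_restrict_apply_univ, Real.volume_real_Ioc_of_le ht.1.le, sub_zero,
    smul_eq_mul]
  have hγ : 0 < 1 - γ := sub_pos.2 hE.gamma_lt
  refine add_le_add (mul_le_mul_of_nonneg_left (div_le_div_of_nonneg_right
    (Real.rpow_le_rpow ht.1.le ht.2 hγ.le) hγ.le) (mul_nonneg hE.Wq_nonneg hRψ)) ?_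
  rw [mul_comm]
  exact mul_le_mul_of_nonneg_left ht.2 (mul_nonneg hE.W_nonneg hRρ)

/-- This bound has the shape of `p_ε`: `φ` and `ρ` will be the initial and equation defects, and `ψ`
a difference of nonlinear remainders. -/
theorem EvolBounds.norm_DFinv_le (hE : EvolBounds D abar τ γ W Wq)
    (hg : IsKernel (D.linKer abar) B) {ψ ρ : ℝ → D.Ell} {Rψ Rρ : ℝ} (hψ : IsAdm D τ ψ Rψ)
    (hρ : IsAdm D τ ρ Rρ) (φ : D.Ell) {t : ℝ} (ht : t ∈ Ioc 0 τ) :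
    ‖D.DFinv abar τ (D.force ψ ρ) φ t‖
      ≤ W * (‖φ‖ + τ * Rρ) + τ ^ (1 - γ) * Wq / (1 - γ) * Rψ := by
  have h1 := norm_U_zero_le hg hE.norm_incl_le ht φ
  have h2 := (hE.integrableOn_and_norm_le hg hψ hρ ht).2
  rw [DFinv, intervalIntegral.integral_of_le ht.1.le]
  refine (norm_add_le _ _).trans ((add_le_add h1 h2).trans (le_of_eq ?_))
  ring

theorem EvolBounds.mild_DFinv (hE : EvolBounds D abar τ γ W Wq)
    (hg : IsKernel (D.linKer abar) B) {ψ ρ : ℝ → D.Ell} {Rψ Rρ : ℝ} (hψ : IsAdm D τ ψ Rψ)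
    (hρ : IsAdm D τ ρ Rρ) (φ : D.Ell) :
    D.Mild 0 τ φ (fun r k => D.kap k * convSeq (D.linKer abar r)
        (D.DFinv abar τ (D.force ψ ρ) φ r) k + (D.kap k * ψ r k - ρ r k))
      (fun t k => D.DFinv abar τ (D.force ψ ρ) φ t k) :=
  Setting.mild_DFinv hg (isForce_force hψ hρ) φ
    fun _ ht => (hE.integrableOn_and_norm_le hg hψ hρ ht).1

/-- Stability of the linear problem. -/
theorem EvolBounds.norm_sub_le (hE : EvolBounds D abar τ γ W Wq)
    (hg : IsKernel (D.linKer abar) B) {φ φ' : D.Ell} {ψ ψ' ρ ρ' β β' : ℝ → D.Ell}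
    (hM : D.Mild 0 τ φ (fun r k => D.kap k * convSeq (D.linKer abar r) (β r) k
      + (D.kap k * ψ r k - ρ r k)) (fun t k => β t k))
    (hM' : D.Mild 0 τ φ' (fun r k => D.kap k * convSeq (D.linKer abar r) (β' r) k
      + (D.kap k * ψ' r k - ρ' r k)) (fun t k => β' t k)) {R R' Rψ Rρ : ℝ}
    (hR : ∀ t ∈ Ioc 0 τ, ‖β t‖ ≤ R) (hR' : ∀ t ∈ Ioc 0 τ, ‖β' t‖ ≤ R')
    (hψ : IsAdm D τ (fun t => ψ t - ψ' t) Rψ) (hρ : IsAdm D τ (fun t => ρ t - ρ' t) Rρ)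
    {t : ℝ} (ht : t ∈ Ioc 0 τ) :
    ‖β t - β' t‖ ≤ W * (‖φ - φ'‖ + τ * Rρ) + τ ^ (1 - γ) * Wq / (1 - γ) * Rψ := by
  have h1 := hE.mild_DFinv hg hψ hρ (φ - φ')
  have h2 : D.Mild 0 τ (φ - φ' : D.Ell) (fun r k => D.kap k * convSeq (D.linKer abar r)
      (β r - β' r : D.Ell) k + (D.kap k * (ψ r - ψ' r : D.Ell) k - (ρ r - ρ' r : D.Ell) k))
      (fun t k => (β t - β' t : D.Ell) k) := by
    refine (hM.sub hM').congr (fun r _ k => ?_) fun _ _ _ => rfl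
    have h3 := hg.conv_sub r (β r) (β' r) k
    have h4 : (β r - β' r : D.Ell).1 = fun k => β r k - β' r k := rfl
    rw [h4, h3, Ell1.sub_apply, Ell1.sub_apply]
    ring
  -- The difference solves the linear equation with the differences of the data, so by uniqueness it
  -- is given by `DF(ā)⁻¹`.
  rw [eq_of_mild_linear hg h2 h1 (R := R + R')
    (fun t ht => (_root_.norm_sub_le _ _).trans (add_le_add (hR t ht) (hR' t ht)))
    (fun t ht => hE.norm_DFinv_le hg hψ hρ (φ - φ') ht) t ht]
  exact hE.norm_DFinv_le hg hψ hρ (φ - φ') ht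

end Forcing

end Setting

namespace Setting

variable {d : ℕ} {D : Setting d}

/-! ### The approximate solution -/

theorem _root_.ParabolicIVP.Ell1.single_apply {ι : Type} (w : ι → {x : ℝ // 0 < x}) (k l : ι) :
    Ell1.single w k l = Set.indicator {k} 1 l := rfl

theorem approx_apply (τ : ℝ) (n : ℕ) (M : Fin d → ℕ) (c : ℕ → (Fin d → ℕ) → ℝ) (t : ℝ)
    (k : Fin d → ℕ) : D.approx τ n M c t k = if ∀ i, k i < M i then
      c 0 k + 2 * ∑ l ∈ Finset.Ico 1 n,
        c l k * (Polynomial.Chebyshev.T ℝ (l : ℤ)).eval (2 * t / τ - 1)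
      else 0 := rfl

theorem boxSupp_approx (τ : ℝ) (n : ℕ) (M : Fin d → ℕ) (c : ℕ → (Fin d → ℕ) → ℝ) (t : ℝ) :
    BoxSupp (Finset.univ.sup M) (D.approx τ n M c t : (Fin d → ℕ) → ℝ) := by
  intro k i hk
  rw [approx_apply, if_neg]
  intro h
  exact absurd (h i) (not_lt.2 ((Finset.le_sup (Finset.mem_univ i)).trans hk))

theorem contDiff_approx (τ : ℝ) (n : ℕ) (M : Fin d → ℕ) (c : ℕ → (Fin d → ℕ) → ℝ) :
    ContDiff ℝ 1 (D.approx τ n M c) := by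
  -- A finite sum of scalar functions times fixed vectors, so that smoothness reduces to that of
  -- polynomials.
  have h1 : D.approx τ n M c = fun t => ∑ k ∈ Fintype.piFinset fun i => Finset.range (M i),
      D.approx τ n M c t k • Ell1.single D.omega k := by
    funext t
    ext l
    rw [Ell1.sum_apply]
    simp only [Ell1.smul_apply, Ell1.single_apply]
    by_cases hl : ∀ i, l i < M i
    · rw [Finset.sum_eq_single l]
      · rw [indicator_of_mem (mem_singleton l), Pi.one_apply, mul_one]
      · intro k _ hk
        rw [indicator_of_notMem (by simpa using Ne.symm hk), mul_zero]
      · intro h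
        exact absurd (by simpa [Fintype.mem_piFinset] using hl) h
    · rw [approx_apply, if_neg hl, Finset.sum_eq_zero]
      intro k hk
      by_cases hkl : l = k
      · subst hkl
        exact absurd (by simpa [Fintype.mem_piFinset] using hk) hl
      · rw [indicator_of_notMem (by simpa using hkl), mul_zero]
  rw [h1]
  refine ContDiff.sum fun k _ => ContDiff.smul_const ?_ _
  simp only [approx_apply]
  split_ifs
  · refine contDiff_const.add (contDiff_const.mul (ContDiff.sum fun l _ => contDiff_const.mul ?_))
    have h2 := (Polynomial.Chebyshev.T ℝ (l : ℤ)).contDiff_aeval (𝕜 := ℝ) 1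
    simp only [Polynomial.coe_aeval_eq_eval] at h2
    exact h2.comp (by fun_prop)
  · exact contDiff_const

/-! ### The nonlinear mild formulation -/

section Nonlinear

variable {τ : ℝ} {φ : D.Ell}

theorem exists_enrm_Nop_le_of_bounded (R : ℝ≥0) :
    ∃ H : ℝ≥0, ∀ a : D.Ell, ‖a‖ ≤ R → D.enrm 0 (D.Nop a) ≤ H ∧ ‖D.Nop a‖ ≤ H := by
  obtain ⟨C, hC⟩ := D.exists_norm_Nop_sub_le R
  refine ⟨C * R + ‖D.Nop 0‖₊, fun a ha => ?_⟩
  have h1 : ‖D.Nop a‖ ≤ C * R + ‖D.Nop 0‖ := by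
    have h2 := hC a 0 ha (by rw [norm_zero]; exact R.coe_nonneg)
    rw [sub_zero] at h2
    have h3 := norm_le_norm_add_norm_sub (D.Nop 0) (D.Nop a)
    rw [← norm_neg, neg_sub] at h2
    have h4 := mul_le_mul_of_nonneg_left ha C.coe_nonneg
    rw [norm_sub_rev] at h2
    rw [norm_sub_rev] at h3
    linarith
  refine ⟨?_, by push_cast; exact h1⟩
  rw [enrm_zero_ell, ENNReal.ofReal_le_iff_le_toReal ENNReal.coe_ne_top, ENNReal.coe_toReal]
  push_cast
  exact h1

theorem continuousOn_Nop_apply {a : ℝ → D.Ell} {S : Set ℝ} (ha : ContinuousOn a S)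
    (k : Fin d → ℕ) : ContinuousOn (fun t => D.Nop (a t) k) S :=
  (Ell1.coord D.omega k).continuous.comp_continuousOn (D.continuous_Nop.comp_continuousOn ha)

/-- Uniqueness of bounded mild solutions of the nonlinear problem. -/
theorem nonlinear_mild_unique {a a' : ℝ → D.Ell} (ha : ContinuousOn a (Ioc 0 τ))
    (ha' : ContinuousOn a' (Ioc 0 τ)) {R : ℝ≥0} (hR : ∀ t ∈ Ioc 0 τ, ‖a t‖ ≤ R)
    (hR' : ∀ t ∈ Ioc 0 τ, ‖a' t‖ ≤ R)
    (h : D.Mild 0 τ φ (fun r k => D.kap k * D.Nop (a r) k) (fun t k => a t k))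
    (h' : D.Mild 0 τ φ (fun r k => D.kap k * D.Nop (a' r) k) (fun t k => a' t k)) :
    ∀ t ∈ Ioc 0 τ, a t = a' t := by
  obtain ⟨C, hC⟩ := D.exists_norm_Nop_sub_le R
  have h1 : D.Mild 0 τ (fun _ => 0) (fun r k => D.kap k * (D.Nop (a r) - D.Nop (a' r) : D.Ell) k)
      (fun t k => (a t - a' t : D.Ell) k) := by
    have h2 := h.sub h'
    simp only [sub_self] at h2
    refine h2.congr (fun t _ k => ?_) fun _ _ _ => rfl
    rw [Ell1.sub_apply]
    ring
  have h3 := h1.eq_zero 0 (fun k => (((continuousOn_Nop_apply ha k).sub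
    (continuousOn_Nop_apply ha' k)).aestronglyMeasurable measurableSet_Ioc).enorm) C
    (fun t ht => by
      rw [enrm_zero_ell, enrm_zero_ell, ← ENNReal.ofReal_coe_nnreal,
        ← ENNReal.ofReal_mul C.coe_nonneg]
      exact ENNReal.ofReal_le_ofReal (hC _ _ (hR t ht) (hR' t ht))) ?_
  · intro t ht
    ext k
    exact sub_eq_zero.1 (h3 t ht k)
  · refine ne_top_of_le_ne_top (lintegral_Ioc_const_ne_top (R + R) 0 τ)
      (setLIntegral_mono' measurableSet_Ioc fun t ht => ?_)
    rw [enrm_zero_ell, ENNReal.ofReal_le_iff_le_toReal ENNReal.coe_ne_top, ENNReal.coe_toReal]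
    push_cast
    exact (norm_sub_le _ _).trans (add_le_add (hR t ht) (hR' t ht))

/-- Regularity of bounded mild solutions of the nonlinear problem. -/
theorem nonlinear_mild_regularity (hτ : 0 < τ) {a : ℝ → D.Ell} (ha : ContinuousOn a (Ioc 0 τ))
    {R : ℝ≥0} (hR : ∀ t ∈ Ioc 0 τ, ‖a t‖ ≤ R)
    (h : D.Mild 0 τ φ (fun r k => D.kap k * D.Nop (a r) k) (fun t k => a t k)) :
    (∃ B' : ℝ → D.Ell, (∀ t ∈ Ioc 0 τ, ∀ k, B' t k = D.mu k * a t k + D.kap k * D.Nop (a t) k) ∧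
      ContinuousOn B' (Ioc 0 τ) ∧ (∀ t ∈ Ioc 0 τ, HasDerivWithinAt a (B' t) (Ioc 0 τ) t) ∧
      D.MemD 0 τ a ∧ ∀ t ∈ Ioc 0 τ, ∀ m : ℕ, D.enrm m (a t) ≠ ∞) ∧
      Tendsto a (𝓝[>] 0) (𝓝 φ) := by
  have hc := fun k => continuousOn_Nop_apply ha k
  constructor
  · refine h.regularity (fun m => ?_) hc ?_
    · obtain ⟨C, hC⟩ := D.exists_enrm_Nop_le m R
      exact ⟨C, fun t ht => hC _ (enorm_le_coe.2 (hR t ht))⟩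
    · refine ne_top_of_le_ne_top (lintegral_Ioc_const_ne_top R 0 τ)
        (setLIntegral_mono' measurableSet_Ioc fun t ht => ?_)
      rw [← enorm_ell]
      exact enorm_le_coe.2 (hR t ht)
  · obtain ⟨H, hH⟩ := exists_enrm_Nop_le_of_bounded (D := D) R
    exact h.tendsto_ell hτ
      (fun k => ((hc k).aestronglyMeasurable measurableSet_Ioc).enorm)
      fun t ht => (hH _ (hR t ht)).1

theorem nonlinear_mild_contDiffOn (hτ : 0 < τ) {a : ℝ → D.Ell} (ha : ContinuousOn a (Ioc 0 τ))
    {R : ℝ≥0} (hR : ∀ t ∈ Ioc 0 τ, ‖a t‖ ≤ R)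
    (h : D.Mild 0 τ φ (fun r k => D.kap k * D.Nop (a r) k) (fun t k => a t k)) :
    ContDiffOn ℝ 1 a (Ioc 0 τ) ∧ ∀ t ∈ Ioc 0 τ, D.F1 τ a t = 0 := by
  obtain ⟨⟨B', h1, h2, h3, -, -⟩, -⟩ := nonlinear_mild_regularity hτ ha hR h
  refine ⟨contDiffOn_one_of_hasDerivWithinAt (uniqueDiffOn_Ioc 0 τ) h3 h2, fun t ht => ?_⟩
  funext k
  rw [F1, (h3 t ht).derivWithin (uniqueDiffOn_Ioc 0 τ t ht), h1 t ht k, Q_apply]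
  simp

/-- The limit at zero bounds the solution on `(0, τ]`, which makes the nonlinear force integrable in
each mode. -/
theorem nonlinear_mild_of_isZeroOfF {a : ℝ → D.Ell} (h : D.IsZeroOfF τ φ a) :
    D.Mild 0 τ φ (fun r k => D.kap k * D.Nop (a r) k) (fun t k => a t k) := by
  obtain ⟨⟨h1, -, h2⟩, h3, h4⟩ := h
  obtain ⟨R, hR⟩ := exists_norm_le_of_tendsto h1 h4
  obtain ⟨H, hH⟩ := exists_enrm_Nop_le_of_bounded (D := D) R
  refine mild_of_hasDerivAt (fun k => ?_)
    (fun k => (Ell1.coord D.omega k).continuous.comp_continuousOn h1) (fun k t ht => ?_)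
    fun k => ((Ell1.coord D.omega k).continuous.tendsto _).comp h4
  · refine Integrable.const_mul (integrableOn_of_lintegral_enrm (D := D) (m := 0)
      (fun k => (continuousOn_Nop_apply h1 k).aestronglyMeasurable measurableSet_Ioc) ?_ k) _
    exact ne_top_of_le_ne_top (lintegral_Ioc_const_ne_top H 0 τ)
      (setLIntegral_mono' measurableSet_Ioc fun t ht => (hH _ (hR t ht)).1)
  · have hd := ((h2 t ht).contDiffAt (Ioo_mem_nhds ht.1 ht.2)).differentiableAt one_ne_zero
    have h5 := congrFun (h3 t ht) k
    have hS : Ioc 0 τ ∈ 𝓝 t := Filter.mem_of_superset (Ioo_mem_nhds ht.1 ht.2) Ioo_subset_Ioc_self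
    rw [F1, derivWithin_of_mem_nhds hS, Q_apply] at h5
    have h6 := (Ell1.coord D.omega k).hasFDerivAt.comp_hasDerivAt t hd.hasDerivAt
    have h7 : D.mu k * a t k + D.kap k * D.Nop (a t) k = deriv a t k := by
      have : deriv a t k - D.mu k * a t k - D.kap k * D.Nop (a t) k = 0 := h5
      linarith
    rw [h7]
    exact h6

end Nonlinear

/-! ### The Newton-like operator -/

section Newton

variable {abar : ℝ → D.Ell} {B : ℕ} {τ γ W Wq : ℝ} {φ : D.Ell}

/-- The nonlinear remainder `𝒩(a) - D𝒩(ā) a`. -/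
def rem (D : Setting d) (abar a : ℝ → D.Ell) (s : ℝ) : D.Ell :=
  D.Nop (a s) - D.DN (abar s) (a s)

theorem exists_isAdm_rem (hc : Continuous abar) {a : ℝ → D.Ell} (ha : ContinuousOn a (Ioc 0 τ))
    {R : ℝ≥0} (hR : ∀ t ∈ Ioc 0 τ, ‖a t‖ ≤ R) : ∃ R' : ℝ, IsAdm D τ (D.rem abar a) R' := by
  obtain ⟨H, hH⟩ := exists_enrm_Nop_le_of_bounded (D := D) R
  obtain ⟨C, hC⟩ := (isCompact_Icc (a := (0 : ℝ)) (b := τ)).exists_bound_of_continuousOn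
    (D.continuous_dNop.comp hc).continuousOn
  refine ⟨H + C * R, fun k => ?_, fun s hs => ?_⟩
  · refine (Ell1.coord D.omega k).continuous.comp_continuousOn
      ((D.continuous_Nop.comp_continuousOn ha).sub ?_)
    simp only [DN_eq, ← convL_apply]
    exact (D.convL.continuous.comp (D.continuous_dNop.comp hc)).continuousOn.clm_apply ha
  · refine (norm_sub_le _ _).trans (add_le_add (hH _ (hR s hs)).2 ?_)
    rw [DN_eq]
    have h1 := hC s ⟨hs.1.le, hs.2⟩
    exact (D.norm_conv_le _ _).trans (mul_le_mul h1 (hR s hs) (norm_nonneg _)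
      ((norm_nonneg _).trans h1))

theorem isAdm_zero (D : Setting d) (τ : ℝ) : IsAdm D τ (fun _ => 0) 0 :=
  ⟨fun _ => continuousOn_const, fun _ _ => norm_zero.le⟩

theorem ext_apply (a : D.X τ) {t : ℝ} (ht : t ∈ Ioc 0 τ) : D.ext a t = a ⟨t, ht⟩ := dif_pos ht

theorem continuousOn_ext (a : D.X τ) : ContinuousOn (D.ext a) (Ioc 0 τ) := by
  rw [continuousOn_iff_continuous_domRestrict]
  refine a.continuous.congr fun t => ?_
  rw [domRestrict_apply, ext_apply a t.2]

theorem norm_ext_le (a : D.X τ) {t : ℝ} (ht : t ∈ Ioc 0 τ) : ‖D.ext a t‖ ≤ ‖a‖₊ := by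
  rw [ext_apply a ht]
  exact a.norm_coe_le_norm _

theorem newtonRhs_eq (a : D.X τ) :
    D.newtonRhs abar a = D.force (D.rem abar (D.ext a)) fun _ => 0 := by
  funext s
  ext k
  rw [newtonRhs, Ell1.sub_apply, Q_apply, Q_apply, force_apply, rem, Ell1.sub_apply,
    Ell1.zero_apply]
  ring

theorem T_eq (a : D.X τ) (t : ℝ) :
    D.T abar φ a t = D.DFinv abar τ (D.force (D.rem abar (D.ext a)) fun _ => 0) φ t := by
  rw [T, newtonRhs_eq]

theorem EvolBounds.mild_T (hE : EvolBounds D abar τ γ W Wq) (hg : IsKernel (D.linKer abar) B)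
    (hc : Continuous abar) (a : D.X τ) :
    D.Mild 0 τ φ (fun r k => D.kap k * convSeq (D.linKer abar r) (D.T abar φ a r) k
      + (D.kap k * D.rem abar (D.ext a) r k - (0 : D.Ell) k)) (fun t k => D.T abar φ a t k) := by
  obtain ⟨R, hR⟩ := exists_isAdm_rem hc (continuousOn_ext a) fun t ht => norm_ext_le a ht
  simp only [T_eq]
  exact hE.mild_DFinv hg hR (isAdm_zero D τ) φ

theorem EvolBounds.exists_norm_T_le (hE : EvolBounds D abar τ γ W Wq)
    (hg : IsKernel (D.linKer abar) B) (hc : Continuous abar) (a : D.X τ) :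
    ∃ R : ℝ, ∀ t ∈ Ioc 0 τ, ‖D.T abar φ a t‖ ≤ R := by
  obtain ⟨R, hR⟩ := exists_isAdm_rem hc (continuousOn_ext a) fun t ht => norm_ext_le a ht
  simp only [T_eq]
  exact ⟨_, fun t ht => hE.norm_DFinv_le hg hR (isAdm_zero D τ) φ ht⟩

/-- The linearised term and the remainder both have the form `𝒬 h` with `h` bounded in `ℓ¹_ω`, so
`Mild.continuousOn_ell` applies. No continuity of the integral defining `T` in `t` has to be checked
directly. -/
theorem EvolBounds.continuousOn_T (hE : EvolBounds D abar τ γ W Wq)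
    (hg : IsKernel (D.linKer abar) B) (hc : Continuous abar) (a : D.X τ) :
    ContinuousOn (D.T abar φ a) (Ioc 0 τ) := by
  obtain ⟨R, hR⟩ := exists_isAdm_rem hc (continuousOn_ext a) fun t ht => norm_ext_le a ht
  obtain ⟨R', hR'⟩ := hE.exists_norm_T_le (φ := φ) hg hc a
  obtain ⟨C, hC⟩ := hg.exists_bound D τ 0
  have hM := hE.mild_T (φ := φ) hg hc a
  have hM' : D.Mild 0 τ φ (fun r k => D.kap k * (convSeq (D.linKer abar r) (D.T abar φ a r) k
      + D.rem abar (D.ext a) r k)) (fun t k => D.T abar φ a t k) := by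
    refine hM.congr (fun t _ k => ?_) fun _ _ _ => rfl
    rw [Ell1.zero_apply]
    ring
  refine hM'.continuousOn_ell (H := C * R'.toNNReal + R.toNNReal) (fun k => ?_) fun t ht => ?_
  · exact (((hg.continuousOn_conv hM.continuousOn k).add
      (hR.continuousOn k)).aestronglyMeasurable measurableSet_Ioc).enorm
  · refine (D.enrm_add_le _ _ _).trans ?_
    push_cast
    refine add_le_add ((hC t ⟨ht.1.le, ht.2⟩ _).trans (mul_le_mul_right ?_ _)) ?_
    · rw [enrm_zero_ell]
      exact ENNReal.ofReal_le_ofReal (hR' t ht)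
    · rw [enrm_zero_ell]
      exact ENNReal.ofReal_le_ofReal (hR.norm_le t ht)

theorem EvolBounds.intervalIntegrable_T (hE : EvolBounds D abar τ γ W Wq)
    (hg : IsKernel (D.linKer abar) B) (hc : Continuous abar) (a : D.X τ) {t : ℝ}
    (ht : t ∈ Ioc 0 τ) :
    IntervalIntegrable (fun s => D.U abar τ t s (D.newtonRhs abar a s)) volume 0 t := by
  obtain ⟨R, hR⟩ := exists_isAdm_rem hc (continuousOn_ext a) fun t ht => norm_ext_le a ht
  rw [intervalIntegrable_iff_integrableOn_Ioc_of_le ht.1.le, newtonRhs_eq]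
  exact (hE.integrableOn_and_norm_le hg hR (isAdm_zero D τ) ht).1

/-- The Newton-like operator as a self-map of `X`. -/
theorem EvolBounds.exists_TX (hE : EvolBounds D abar τ γ W Wq)
    (hg : IsKernel (D.linKer abar) B) (hc : Continuous abar) (φ : D.Ell) :
    ∃ TX : D.X τ → D.X τ, ∀ a : D.X τ, ∀ t : Ioc 0 τ, TX a t = D.T abar φ a t := by
  refine ⟨fun a => BoundedContinuousFunction.ofNormedAddCommGroup
    (fun t : Ioc 0 τ => D.T abar φ a t)
    (continuousOn_iff_continuous_domRestrict.1 (hE.continuousOn_T hg hc a))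
    (hE.exists_norm_T_le (φ := φ) hg hc a).choose
    fun t => (hE.exists_norm_T_le hg hc a).choose_spec t t.2, fun a t => rfl⟩

/-- A fixed point of the Newton-like operator is a mild solution of the nonlinear problem. -/
theorem EvolBounds.nonlinear_mild_of_fixed (hE : EvolBounds D abar τ γ W Wq)
    (hg : IsKernel (D.linKer abar) B) (hc : Continuous abar) {a : D.X τ}
    (ha : ∀ t : Ioc 0 τ, D.T abar φ a t = a t) :
    D.Mild 0 τ φ (fun r k => D.kap k * D.Nop (D.ext a r) k) (fun t k => D.ext a t k) := by
  have h1 : ∀ t ∈ Ioc 0 τ, D.T abar φ a t = D.ext a t := fun t ht => by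
    rw [ext_apply a ht]
    exact ha ⟨t, ht⟩
  refine (hE.mild_T (φ := φ) hg hc a).congr (fun t ht k => ?_) fun t ht k => by rw [h1 t ht]
  rw [h1 t ht, rem, Ell1.sub_apply, DN_apply, Ell1.zero_apply]
  ring

/-- The approximate solution solves the linear problem up to its defect. -/
theorem exists_mild_approx (hC1 : ContDiff ℝ 1 abar) {δ : ℝ}
    (hδ : ∀ t ∈ Ioc 0 τ, ∃ r : D.Ell, (∀ k, r k = D.F1 τ abar t k) ∧ ‖r‖ ≤ δ) :
    ∃ ρ : ℝ → D.Ell, IsAdm D τ (fun t => 0 - ρ t) δ ∧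
      D.Mild 0 τ (abar 0) (fun r k => D.kap k * convSeq (D.linKer abar r) (abar r) k
        + (D.kap k * D.rem abar abar r k - ρ r k)) (fun t k => abar t k) := by
  choose! r hr hr' using hδ
  have hd : ∀ t, HasDerivAt abar (deriv abar t) t := fun t =>
    (hC1.differentiable one_ne_zero t).hasDerivAt
  have hdc : Continuous (deriv abar) := hC1.continuous_deriv le_rfl
  have hk : ∀ {f : ℝ → D.Ell}, Continuous f → ∀ k, Continuous fun t => f t k := fun hf k =>
    (Ell1.coord D.omega k).continuous.comp hf
  have hr2 : ∀ t ∈ Ioc 0 τ, ∀ k,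
      r t k = deriv abar t k - D.mu k * abar t k - D.kap k * D.Nop (abar t) k := by
    intro t ht k
    rw [hr t ht, F1, (hd t).hasDerivWithinAt.derivWithin (uniqueDiffOn_Ioc 0 τ t ht), Q_apply]
  -- The sign is chosen so that the force reads `𝒬 ψ - ρ`. The form `0 - ρ` anticipates the
  -- comparison with `T(a)`, whose own `ρ` is zero.
  refine ⟨fun t => -r t, ⟨fun k => ?_, fun t ht => ?_⟩, ?_⟩
  · simp only [zero_sub, neg_neg]
    refine ContinuousOn.congr (Continuous.continuousOn ?_) fun t ht => hr2 t ht k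
    exact ((hk hdc k).sub (continuous_const.mul (hk hC1.continuous k))).sub
      (continuous_const.mul (hk (D.continuous_Nop.comp hC1.continuous) k))
  · rw [zero_sub, neg_neg]
    exact hr' t ht
  · have hM : D.Mild 0 τ (abar 0) (fun t k => deriv abar t k - D.mu k * abar t k)
        (fun t k => abar t k) := by
      refine mild_of_hasDerivAt (fun k => ?_) (fun k => (hk hC1.continuous k).continuousOn)
        (fun k t _ => ?_) fun k =>
          ((hk hC1.continuous k).tendsto 0).mono_left nhdsWithin_le_nhds
      · exact ((hk hdc k).sub (continuous_const.mul (hk hC1.continuous k))).integrableOn_Ioc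
      · rw [add_sub_cancel]
        exact (Ell1.coord D.omega k).hasFDerivAt.comp_hasDerivAt t (hd t)
    refine hM.congr (fun t ht k => ?_) fun _ _ _ => rfl
    rw [Ell1.neg_apply, hr2 t ht k, rem, Ell1.sub_apply, DN_apply]
    ring

end Newton

end Setting

/-! ### The contraction argument -/

namespace Setting

variable {d : ℕ} {D : Setting d} {abar : ℝ → D.Ell} {B : ℕ} {τ γ W Wq : ℝ} {φ : D.Ell}

theorem EvolBounds.norm_T_sub_T_le (hE : EvolBounds D abar τ γ W Wq)
    (hg : IsKernel (D.linKer abar) B) (hc : Continuous abar) {a a' : D.X τ} {R : ℝ}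
    (hR : ∀ t ∈ Ioc 0 τ, ‖D.rem abar (D.ext a) t - D.rem abar (D.ext a') t‖ ≤ R)
    {t : ℝ} (ht : t ∈ Ioc 0 τ) :
    ‖D.T abar φ a t - D.T abar φ a' t‖ ≤ τ ^ (1 - γ) * Wq / (1 - γ) * R := by
  obtain ⟨R₁, h₁⟩ := hE.exists_norm_T_le (φ := φ) hg hc a
  obtain ⟨R₂, h₂⟩ := hE.exists_norm_T_le (φ := φ) hg hc a'
  obtain ⟨R₃, h₃⟩ := exists_isAdm_rem hc (continuousOn_ext a) fun t ht => norm_ext_le a ht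
  obtain ⟨R₄, h₄⟩ := exists_isAdm_rem hc (continuousOn_ext a') fun t ht => norm_ext_le a' ht
  have h := hE.norm_sub_le hg (hE.mild_T (φ := φ) hg hc a) (hE.mild_T (φ := φ) hg hc a') h₁ h₂
    (Rψ := R) (Rρ := 0) ⟨fun k => (h₃.continuousOn k).sub (h₄.continuousOn k), hR⟩
    (by simpa using isAdm_zero D τ) ht
  simpa using h

/-- Both functions solve the forced linear equation. They differ in the initial value, the nonlinear
remainder and the defect, and each difference contributes one term. -/
theorem EvolBounds.norm_T_sub_approx_le (hE : EvolBounds D abar τ γ W Wq)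
    (hg : IsKernel (D.linKer abar) B) (hC1 : ContDiff ℝ 1 abar) {δ : ℝ}
    (hδ : ∀ t ∈ Ioc 0 τ, ∃ r : D.Ell, (∀ k, r k = D.F1 τ abar t k) ∧ ‖r‖ ≤ δ)
    {a : D.X τ} {R : ℝ}
    (hR : ∀ t ∈ Ioc 0 τ, ‖D.rem abar (D.ext a) t - D.rem abar abar t‖ ≤ R)
    {t : ℝ} (ht : t ∈ Ioc 0 τ) :
    ‖D.T abar φ a t - abar t‖
      ≤ W * (‖φ - abar 0‖ + τ * δ) + τ ^ (1 - γ) * Wq / (1 - γ) * R := by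
  have hc := hC1.continuous
  obtain ⟨R₁, h₁⟩ := hE.exists_norm_T_le (φ := φ) hg hc a
  obtain ⟨R₂, h₂⟩ := (isCompact_Icc (a := (0 : ℝ)) (b := τ)).exists_bound_of_continuousOn
    hc.continuousOn
  obtain ⟨R₃, h₃⟩ := exists_isAdm_rem hc (continuousOn_ext a) fun t ht => norm_ext_le a ht
  obtain ⟨R₄, h₄⟩ := exists_isAdm_rem (τ := τ) hc hc.continuousOn (R := R₂.toNNReal) fun t ht =>
    (h₂ t ⟨ht.1.le, ht.2⟩).trans (Real.le_coe_toNNReal _)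
  obtain ⟨ρ, hρ, hM⟩ := exists_mild_approx hC1 hδ
  exact hE.norm_sub_le hg (hE.mild_T (φ := φ) hg hc a) hM h₁ (fun t ht => h₂ t ⟨ht.1.le, ht.2⟩)
    ⟨fun k => (h₃.continuousOn k).sub (h₄.continuousOn k), hR⟩ hρ ht

theorem isClosed_ball (ϱ : ℝ) : IsClosed (D.ball (τ := τ) abar ϱ) := by
  have : D.ball (τ := τ) abar ϱ = ⋂ t : Ioc 0 τ, {a : D.X τ | ‖a t - abar t‖ ≤ ϱ} := by
    ext a
    simp [ball]
  rw [this]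
  refine isClosed_iInter fun t => isClosed_le ?_ continuous_const
  exact (((BoundedContinuousFunction.lipschitz_eval_const t).continuous).sub continuous_const).norm

theorem exists_approxX (hc : Continuous abar) (τ : ℝ) :
    ∃ b : D.X τ, ∀ t : Ioc 0 τ, b t = abar t := by
  obtain ⟨R, hR⟩ := (isCompact_Icc (a := (0 : ℝ)) (b := τ)).exists_bound_of_continuousOn
    hc.continuousOn
  exact ⟨BoundedContinuousFunction.ofNormedAddCommGroup (fun t : Ioc 0 τ => abar t)
    (hc.comp continuous_subtype_val) R fun t => hR t ⟨t.2.1.le, t.2.2⟩, fun t => rfl⟩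

/-- The contraction argument. -/
theorem EvolBounds.exists_fixed_point (hE : EvolBounds D abar τ γ W Wq)
    (hg : IsKernel (D.linKer abar) B) (hC1 : ContDiff ℝ 1 abar) (hτ : 0 < τ) {δ ε : ℝ}
    (hδ : ∀ t ∈ Ioc 0 τ, ∃ r : D.Ell, (∀ k, r k = D.F1 τ abar t k) ∧ ‖r‖ ≤ δ)
    (hε : ‖φ - abar 0‖ ≤ ε) (hW0 : 0 < W) {ϱ l : ℝ} (hϱ : 0 < ϱ) (hl : 0 ≤ l)
    (hLip : ∀ a₁ ∈ D.ball (τ := τ) abar ϱ, ∀ a₂ ∈ D.ball (τ := τ) abar ϱ, ∀ t : Ioc 0 τ,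
      ‖D.Nop (a₁ t) - D.Nop (a₂ t) - D.DN (abar t) (a₁ t - a₂ t)‖ ≤ l * ‖a₁ - a₂‖)
    (hp : W * (ε + τ * δ) + τ ^ (1 - γ) * Wq / (1 - γ) * l * ϱ ≤ ϱ)
    {TX : D.X τ → D.X τ} (hTX : ∀ a : D.X τ, ∀ t : Ioc 0 τ, TX a t = D.T abar φ a t) :
    MapsTo TX (D.ball abar ϱ) (D.ball abar ϱ) ∧
      (∃ K : ℝ≥0, K ≤ 1 ∧ (0 < ε + τ * δ → K < 1) ∧ LipschitzOnWith K TX (D.ball abar ϱ)) ∧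
      ∃ a ∈ D.ball (τ := τ) abar ϱ, TX a = a := by
  have hc := hC1.continuous
  obtain ⟨b, hb⟩ := exists_approxX (D := D) hc τ
  have hbb : b ∈ D.ball (τ := τ) abar ϱ := fun t => by rw [hb, sub_self, norm_zero]; exact hϱ.le
  have hε0 : 0 ≤ ε := (norm_nonneg _).trans hε
  have hδ0 : 0 ≤ δ := by
    obtain ⟨r, -, hr⟩ := hδ τ ⟨hτ, le_rfl⟩
    exact (norm_nonneg _).trans hr
  have hrem : ∀ a₁ ∈ D.ball (τ := τ) abar ϱ, ∀ a₂ ∈ D.ball (τ := τ) abar ϱ, ∀ t ∈ Ioc 0 τ,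
      ‖D.rem abar (D.ext a₁) t - D.rem abar (D.ext a₂) t‖ ≤ l * ‖a₁ - a₂‖ := by
    intro a₁ h₁ a₂ h₂ t ht
    have h3 := hLip a₁ h₁ a₂ h₂ ⟨t, ht⟩
    have h4 : D.rem abar (D.ext a₁) t - D.rem abar (D.ext a₂) t
        = D.Nop (a₁ ⟨t, ht⟩) - D.Nop (a₂ ⟨t, ht⟩)
          - D.DN (abar t) (a₁ ⟨t, ht⟩ - a₂ ⟨t, ht⟩) := by
      have h5 : D.DN (abar t) (a₁ ⟨t, ht⟩ - a₂ ⟨t, ht⟩)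
          = D.DN (abar t) (a₁ ⟨t, ht⟩) - D.DN (abar t) (a₂ ⟨t, ht⟩) := map_sub _ _ _
      rw [rem, rem, ext_apply a₁ ht, ext_apply a₂ ht, h5]
      abel
    rwa [h4]
  set κ := τ ^ (1 - γ) * Wq / (1 - γ) with hκ
  have hκ0 : 0 ≤ κ := div_nonneg (mul_nonneg (Real.rpow_nonneg hτ.le _) hE.Wq_nonneg)
    (sub_pos.2 hE.gamma_lt).le
  have hKl : 0 ≤ κ * l := mul_nonneg hκ0 hl
  have hd0 : 0 ≤ ε + τ * δ := add_nonneg hε0 (mul_nonneg hτ.le hδ0)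
  have hcontr : ∀ a₁ ∈ D.ball (τ := τ) abar ϱ, ∀ a₂ ∈ D.ball (τ := τ) abar ϱ,
      ‖TX a₁ - TX a₂‖ ≤ κ * l * ‖a₁ - a₂‖ := by
    intro a₁ h₁ a₂ h₂
    refine (BoundedContinuousFunction.norm_le (mul_nonneg hKl (norm_nonneg _))).2 fun t => ?_
    rw [BoundedContinuousFunction.sub_apply, hTX, hTX, mul_assoc]
    exact hE.norm_T_sub_T_le hg hc (hrem a₁ h₁ a₂ h₂) t.2
  have happ : ∀ a ∈ D.ball (τ := τ) abar ϱ, ∀ t : Ioc 0 τ,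
      ‖TX a t - abar t‖ ≤ W * (ε + τ * δ) + κ * (l * ‖a - b‖) := by
    intro a ha t
    rw [hTX]
    refine (hE.norm_T_sub_approx_le hg hC1 hδ (R := l * ‖a - b‖) (fun t ht => ?_) t.2).trans ?_
    · have h1 := hrem a ha b hbb t ht
      have h2 : D.rem abar (D.ext b) t = D.rem abar abar t := by
        rw [rem, rem, ext_apply b ht, hb]
      rwa [h2] at h1
    · gcongr
  have hnorm : ∀ a ∈ D.ball (τ := τ) abar ϱ, ‖a - b‖ ≤ ϱ := fun a ha =>
    (BoundedContinuousFunction.norm_le hϱ.le).2 fun t => by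
      rw [BoundedContinuousFunction.sub_apply, hb]
      exact ha t
  have hmaps : MapsTo TX (D.ball abar ϱ) (D.ball abar ϱ) := by
    intro a ha t
    refine (happ a ha t).trans (le_trans ?_ hp)
    have := mul_le_mul_of_nonneg_left (hnorm a ha) hKl
    linarith
  -- Divide `p_ε(ϱ) ≤ ϱ` by `ϱ` after dropping `W(ε + τδ) ≥ 0`. The inequality is strict exactly
  -- when this dropped term is known to be positive.
  have hK1 : κ * l ≤ 1 := by
    have h1 : κ * l * ϱ ≤ 1 * ϱ := by
      have := mul_nonneg hW0.le hd0
      linarith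
    exact le_of_mul_le_mul_right h1 hϱ
  have hKlt : 0 < ε + τ * δ → κ * l < 1 := by
    intro h
    have h1 : κ * l * ϱ < 1 * ϱ := by
      have := mul_pos hW0 h
      linarith
    exact lt_of_mul_lt_mul_right h1 hϱ.le
  have hLW : LipschitzOnWith (κ * l).toNNReal TX (D.ball abar ϱ) :=
    LipschitzOnWith.of_dist_le_mul fun a₁ h₁ a₂ h₂ => by
      rw [dist_eq_norm, dist_eq_norm, Real.coe_toNNReal _ hKl]
      exact hcontr a₁ h₁ a₂ h₂
  have hKlt' : 0 < ε + τ * δ → (κ * l).toNNReal < 1 := fun h => by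
    rw [Real.toNNReal_lt_one]
    exact hKlt h
  refine ⟨hmaps, ⟨(κ * l).toNNReal, Real.toNNReal_le_one.2 hK1, hKlt', hLW⟩, ?_⟩
  rcases hd0.eq_or_lt with h0 | h0
  -- With no defect the map need not be a strict contraction, but the estimate at `a = ā` gives
  -- `‖T(ā) - ā‖ ≤ 0`.
  · refine ⟨b, hbb, ?_⟩
    ext1 t
    have h1 := happ b hbb t
    rw [← h0, sub_self, norm_zero, mul_zero, mul_zero, mul_zero, add_zero] at h1
    rw [sub_eq_zero.1 (norm_le_zero_iff.1 h1), hb]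
  · obtain ⟨a, ha, ha', -⟩ := ContractingWith.exists_fixedPoint' (isClosed_ball ϱ).isComplete
      hmaps ⟨hKlt' h0, hLW.mapsToRestrict hmaps⟩ hbb (edist_ne_top _ _)
    exact ⟨a, ha, ha'⟩

end Setting

namespace Setting

variable {d : ℕ} (D : Setting d)

/-! ### Cosine series -/

theorem alpha_le_omega (k : Fin d → ℕ) : alpha k ≤ D.omega k :=
  le_mul_of_one_le_right (one_pos.le.trans (one_le_alpha k)) (one_le_pow₀ D.one_le_nu)

theorem abs_prod_cos_le (k : Fin d → ℕ) (x : EuclideanSpace ℝ (Fin d)) :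
    |∏ i, Real.cos ((k i : ℝ) * D.L i * x i)| ≤ 1 := by
  rw [Finset.abs_prod]
  exact Finset.prod_le_one (fun _ _ => abs_nonneg _) fun _ _ => Real.abs_cos_le_one _

theorem abs_cosSeries_term_le (a : D.Ell) (x : EuclideanSpace ℝ (Fin d)) (k : Fin d → ℕ) :
    ‖alpha k * a k * ∏ i, Real.cos ((k i : ℝ) * D.L i * x i)‖ ≤ |a k| * D.omega k := by
  have h1 := mul_le_mul_of_nonneg_left (D.abs_prod_cos_le k x) (abs_nonneg (alpha k * a k))
  rw [Real.norm_eq_abs, abs_mul]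
  refine h1.trans ?_
  rw [mul_one, abs_mul, abs_of_nonneg (one_pos.le.trans (one_le_alpha k)), mul_comm]
  exact mul_le_mul_of_nonneg_left (D.alpha_le_omega k) (abs_nonneg _)

theorem summable_cosSeries (a : D.Ell) (x : EuclideanSpace ℝ (Fin d)) :
    Summable fun k => alpha k * a k * ∏ i, Real.cos ((k i : ℝ) * D.L i * x i) :=
  Summable.of_norm_bounded a.summable (D.abs_cosSeries_term_le a x)

/-- Point evaluation of the cosine series. -/
def evalL (x : EuclideanSpace ℝ (Fin d)) : D.Ell →L[ℝ] ℝ :=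
  LinearMap.mkContinuous
    { toFun := fun a => D.cosSeries a x
      map_add' := fun a b => by
        rw [cosSeries, cosSeries, cosSeries,
          ← (D.summable_cosSeries a x).tsum_add (D.summable_cosSeries b x)]
        refine tsum_congr fun k => ?_
        rw [Ell1.add_apply]
        ring
      map_smul' := fun c a => by
        rw [cosSeries, cosSeries, smul_eq_mul, ← tsum_mul_left]
        refine tsum_congr fun k => ?_
        rw [Ell1.smul_apply, RingHom.id_apply]
        ring } 1 fun a => by
    rw [one_mul]
    exact tsum_of_norm_bounded a.summable.hasSum (D.abs_cosSeries_term_le a x)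

theorem evalL_apply (x : EuclideanSpace ℝ (Fin d)) (a : D.Ell) :
    D.evalL x a = D.cosSeries a x := rfl

theorem norm_cosSeries_le (a : D.Ell) (x : EuclideanSpace ℝ (Fin d)) : ‖D.cosSeries a x‖ ≤ ‖a‖ :=
  tsum_of_norm_bounded a.summable.hasSum (D.abs_cosSeries_term_le a x)

theorem cosSeries_sub (a b : D.Ell) (x : EuclideanSpace ℝ (Fin d)) :
    D.cosSeries (a - b) x = D.cosSeries a x - D.cosSeries b x := (D.evalL x).map_sub a b

theorem cosSeries_neg (a : D.Ell) (x : EuclideanSpace ℝ (Fin d)) :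
    D.cosSeries a (-x) = D.cosSeries a x := by
  simp [cosSeries]

theorem cosSeries_periodic (a : D.Ell) (x : EuclideanSpace ℝ (Fin d)) (i : Fin d) :
    D.cosSeries a (x + EuclideanSpace.single i (2 * Real.pi / D.L i)) = D.cosSeries a x := by
  refine tsum_congr fun k => congrArg _ (Finset.prod_congr rfl fun l _ => ?_)
  rw [PiLp.add_apply, PiLp.single_apply]
  split_ifs with h
  · subst h
    have h1 : (k l : ℝ) * D.L l * (x l + 2 * Real.pi / D.L l)
        = k l * D.L l * x l + k l * (2 * Real.pi) := by
      have := (D.L_pos l).ne'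
      field_simp
    rw [h1, Real.cos_add_nat_mul_two_pi]
  · rw [add_zero]

/-- The frequency of the mode `j`. -/
def freq (j : Fin d → ℤ) : EuclideanSpace ℝ (Fin d) := WithLp.toLp 2 fun i => (j i : ℝ) * D.L i

/-- The phase `∑ j_i L_i x_i`. -/
def phase (j : Fin d → ℤ) : EuclideanSpace ℝ (Fin d) →L[ℝ] ℝ := innerSL ℝ (D.freq j)

theorem phase_apply (j : Fin d → ℤ) (x : EuclideanSpace ℝ (Fin d)) :
    D.phase j x = ∑ i, (j i : ℝ) * D.L i * x i := by
  rw [phase, innerSL_apply_apply, PiLp.inner_apply]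
  refine Finset.sum_congr rfl fun i _ => ?_
  simp [freq, mul_comm]

theorem phase_add (j l : Fin d → ℤ) (x : EuclideanSpace ℝ (Fin d)) :
    D.phase (j + l) x = D.phase j x + D.phase l x := by
  simp only [phase_apply, Pi.add_apply, Int.cast_add, add_mul, Finset.sum_add_distrib]

/-- Here `‖freq‖² = θ - 1`, so `√θ` would do. The cruder bound `θ` keeps integer powers and costs
nothing, since all weighted norms will be finite. -/
theorem norm_phase_le (j : Fin d → ℤ) : ‖D.phase j‖ ≤ D.theta (absIdx j) := by
  rw [phase, innerSL_apply_norm]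
  have h1 : ‖D.freq j‖ ^ 2 = D.theta (absIdx j) - 1 := by
    rw [EuclideanSpace.norm_sq_eq, theta_absIdx, add_sub_cancel_left]
    refine Finset.sum_congr rfl fun i _ => ?_
    rw [Real.norm_eq_abs, sq_abs, freq]
  nlinarith [sq_nonneg (‖D.freq j‖ - 1), norm_nonneg (D.freq j)]

/-- The exponential of the phase. -/
def expMode (j : Fin d → ℤ) (x : EuclideanSpace ℝ (Fin d)) : ℂ :=
  Complex.exp ((D.phase j x : ℝ) * Complex.I)

theorem norm_expMode (j : Fin d → ℤ) (x : EuclideanSpace ℝ (Fin d)) : ‖D.expMode j x‖ = 1 :=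
  Complex.norm_exp_ofReal_mul_I _

theorem expMode_add (j l : Fin d → ℤ) (x : EuclideanSpace ℝ (Fin d)) :
    D.expMode (j + l) x = D.expMode j x * D.expMode l x := by
  rw [expMode, expMode, expMode, ← Complex.exp_add, phase_add]
  push_cast
  ring_nf

theorem sum_pair_exp (k : ℕ) (y : ℝ) :
    ∑ j ∈ ({(k : ℤ), -(k : ℤ)} : Finset ℤ), Complex.exp (((j : ℝ) * y : ℝ) * Complex.I)
      = ((if k = 0 then 1 else 2 : ℝ) : ℂ) * (Real.cos (k * y) : ℝ) := by
  split_ifs with h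
  · simp [h]
  · rw [Finset.sum_pair (by omega)]
    push_cast
    rw [Complex.two_cos]
    ring_nf

/-- The sum over sign choices factorises; each nonzero `k_i` gives `e^{iy} + e^{-iy} = 2 cos y`, and
the twos make up `α_k`. -/
theorem sum_absFiber_expMode (k : Fin d → ℕ) (x : EuclideanSpace ℝ (Fin d)) :
    ∑ j ∈ absFiber k, D.expMode j x
      = ((alpha k * ∏ i, Real.cos ((k i : ℝ) * D.L i * x i) : ℝ) : ℂ) := by
  have h1 : ∀ j, D.expMode j x
      = ∏ i, Complex.exp ((((j i : ℤ) : ℝ) * (D.L i * x i) : ℝ) * Complex.I) := by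
    intro j
    rw [expMode, ← Complex.exp_sum, ← Finset.sum_mul, phase_apply]
    push_cast
    simp only [mul_assoc]
  simp only [h1]
  rw [absFiber, ← Finset.prod_univ_sum
    (fun i => ({(k i : ℤ), -(k i : ℤ)} : Finset ℤ))
    (fun i (j : ℤ) => Complex.exp (((j : ℝ) * (D.L i * x i) : ℝ) * Complex.I))]
  simp only [sum_pair_exp]
  rw [Finset.prod_mul_distrib, alpha]
  push_cast
  simp only [mul_assoc]

theorem summable_expMode (a : D.Ell) (x : EuclideanSpace ℝ (Fin d)) :
    Summable fun j => ‖(a (absIdx j) : ℂ) * D.expMode j x‖ := by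
  refine (D.summable_absIdx a).congr fun j => ?_
  rw [norm_mul, norm_expMode, mul_one, Complex.norm_real, Real.norm_eq_abs]

/-- The cosine series as an exponential series. -/
theorem ofReal_cosSeries (a : D.Ell) (x : EuclideanSpace ℝ (Fin d)) :
    (D.cosSeries a x : ℂ) = ∑' j : Fin d → ℤ, (a (absIdx j) : ℂ) * D.expMode j x := by
  have h1 := (D.summable_expMode a x).of_norm.hasSum.tsum_fiberwise absIdx
  rw [← h1.tsum_eq, cosSeries, Complex.ofReal_tsum]
  refine tsum_congr fun k => ?_
  rw [coe_absFiber, Finset.tsum_subtype' (absFiber k)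
    (fun j => (a (absIdx j) : ℂ) * D.expMode j x),
    Finset.sum_congr rfl (fun j hj => by rw [mem_absFiber.1 hj]), ← Finset.mul_sum,
    sum_absFiber_expMode]
  push_cast
  ring

/-- The product of two absolutely convergent exponential series over `ℤ^d`, regrouped by the total
frequency. This turns `𝒩` into the pointwise nonlinearity. -/
theorem cosSeries_conv (a b : D.Ell) (x : EuclideanSpace ℝ (Fin d)) :
    D.cosSeries (D.conv a b) x = D.cosSeries a x * D.cosSeries b x := by
  have key : (D.cosSeries (D.conv a b) x : ℂ) = D.cosSeries a x * D.cosSeries b x := by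
    have ha := D.summable_expMode a x
    have hb := D.summable_expMode b x
    let e : (Fin d → ℤ) × (Fin d → ℤ) ≃ (Fin d → ℤ) × (Fin d → ℤ) :=
      { toFun := fun z => (z.2, z.1 - z.2)
        invFun := fun z => (z.1 + z.2, z.1)
        left_inv := fun z => by simp
        right_inv := fun z => by simp }
    have hs := summable_mul_of_summable_norm ha hb
    rw [ofReal_cosSeries, ofReal_cosSeries, ofReal_cosSeries,
      tsum_mul_tsum_of_summable_norm ha hb, ← e.tsum_eq]
    refine Eq.trans ?_ (e.summable_iff.2 hs).tsum_prod.symm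
    refine tsum_congr fun j => ?_
    rw [conv_apply, convSeq_absIdx, Complex.ofReal_tsum, ← tsum_mul_right]
    refine tsum_congr fun l => ?_
    have h1 : D.expMode j x = D.expMode l x * D.expMode (j - l) x := by
      rw [← expMode_add, add_sub_cancel]
    change _ = (a (absIdx l) : ℂ) * D.expMode l x * ((b (absIdx (j - l)) : ℂ) * D.expMode (j - l) x)
    rw [h1]
    push_cast
    ring
  exact_mod_cast key

theorem cosSeries_unit (x : EuclideanSpace ℝ (Fin d)) : D.cosSeries D.unit x = 1 := by
  have h0 : ∀ k, D.unit k = if k = 0 then (1 : ℝ) else 0 := fun _ => rfl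
  rw [cosSeries, tsum_eq_single 0]
  · simp [h0, alpha]
  · intro k hk
    rw [h0, if_neg hk]
    ring

theorem cosSeries_convPow (a : D.Ell) (n : ℕ) (x : EuclideanSpace ℝ (Fin d)) :
    D.cosSeries (D.convPow a n) x = D.cosSeries a x ^ n := by
  induction n with
  | zero => exact (D.cosSeries_unit x).trans (pow_zero _).symm
  | succ n ih => rw [convPow_succ, cosSeries_conv, ih, pow_succ']

theorem cosSeries_Nop (a : D.Ell) (x : EuclideanSpace ℝ (Fin d)) :
    D.cosSeries (D.Nop a) x = D.N.eval (D.cosSeries a x) := by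
  rw [← evalL_apply, Nop, Polynomial.sum, map_sum, Polynomial.eval_eq_sum, Polynomial.sum]
  refine Finset.sum_congr rfl fun n _ => ?_
  rw [map_smul, evalL_apply, cosSeries_convPow, smul_eq_mul]

theorem cosSeries_eq_tsum_cos (a : D.Ell) (x : EuclideanSpace ℝ (Fin d)) :
    D.cosSeries a x = ∑' j : Fin d → ℤ, a (absIdx j) * Real.cos (D.phase j x) := by
  have h1 := congrArg Complex.re (D.ofReal_cosSeries a x)
  rw [Complex.ofReal_re, Complex.re_tsum (D.summable_expMode a x).of_norm] at h1
  rw [h1]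
  refine tsum_congr fun j => ?_
  rw [Complex.re_ofReal_mul, expMode, Complex.exp_ofReal_mul_I_re]

/-! ### Smoothness and the Laplacian -/

theorem summable_absIdx_theta (a : D.Ell) {m : ℕ} (h : D.enrm m a ≠ ∞) :
    Summable fun j : Fin d → ℤ => |a (absIdx j)| * D.theta (absIdx j) ^ m := by
  rw [enrm_eq] at h
  have h1 := ENNReal.summable_toReal h
  refine Summable.of_nonneg_of_le
    (fun j => mul_nonneg (abs_nonneg _) (pow_nonneg (D.theta_pos _).le _)) (fun j => ?_) h1
  have hθ := pow_nonneg (D.theta_pos (absIdx j)).le m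
  rw [zwt, zpow_natCast, ENNReal.toReal_mul, ENNReal.toReal_ofReal
    (mul_nonneg (D.zWeight_nonneg j) hθ), toReal_enorm, Real.norm_eq_abs, mul_comm]
  exact mul_le_mul_of_nonneg_right (le_mul_of_one_le_left hθ (D.one_le_zWeight j)) (abs_nonneg _)

theorem iteratedFDeriv_mode (c : ℝ) (j : Fin d → ℤ) (m : ℕ) (x : EuclideanSpace ℝ (Fin d)) :
    iteratedFDeriv ℝ m (fun x => c * Real.cos (D.phase j x)) x
      = c • (iteratedFDeriv ℝ m Real.cos (D.phase j x)).compContinuousLinearMap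
        fun _ => D.phase j := by
  have h1 : (fun x => c * Real.cos (D.phase j x)) = c • (Real.cos ∘ D.phase j) := rfl
  rw [h1, iteratedFDeriv_const_smul_apply
    ((Real.contDiff_cos.comp (D.phase j).contDiff).contDiffAt),
    (D.phase j).iteratedFDeriv_comp_right (n := m) Real.contDiff_cos x le_rfl]

theorem norm_iteratedFDeriv_mode_le (c : ℝ) (j : Fin d → ℤ) (m : ℕ)
    (x : EuclideanSpace ℝ (Fin d)) :
    ‖iteratedFDeriv ℝ m (fun x => c * Real.cos (D.phase j x)) x‖
      ≤ |c| * D.theta (absIdx j) ^ m := by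
  rw [iteratedFDeriv_mode, norm_smul, Real.norm_eq_abs]
  refine mul_le_mul_of_nonneg_left ?_ (abs_nonneg _)
  refine (ContinuousMultilinearMap.norm_compContinuousLinearMap_le _ _).trans ?_
  rw [Finset.prod_const, Finset.card_univ, Fintype.card_fin, norm_iteratedFDeriv_eq_norm_iteratedDeriv]
  have h1 : ‖iteratedDeriv m Real.cos (D.phase j x)‖ ≤ 1 := Real.abs_iteratedDeriv_cos_le_one _ _
  calc _ ≤ 1 * D.theta (absIdx j) ^ m := mul_le_mul h1
        (pow_le_pow_left₀ (norm_nonneg _) (D.norm_phase_le j) m)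
        (pow_nonneg (norm_nonneg _) _) zero_le_one
    _ = _ := one_mul _

theorem contDiff_mode (c : ℝ) (j : Fin d → ℤ) (m : WithTop ℕ∞) :
    ContDiff ℝ m fun x => c * Real.cos (D.phase j x) :=
  contDiff_const.mul (Real.contDiff_cos.comp (D.phase j).contDiff)

theorem cosSeries_eq_fun (a : D.Ell) :
    D.cosSeries a = fun x => ∑' j : Fin d → ℤ, a (absIdx j) * Real.cos (D.phase j x) :=
  funext (D.cosSeries_eq_tsum_cos a)

theorem summable_absIdx_theta_of_le (a : D.Ell) {m k : ℕ} (h : D.enrm m a ≠ ∞)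
    (hk : (k : ℕ∞) ≤ m) : Summable fun j : Fin d → ℤ => |a (absIdx j)| * D.theta (absIdx j) ^ k :=
  D.summable_absIdx_theta a (ne_top_of_le_ne_top h (D.enrm_mono (by exact_mod_cast hk) _))

theorem contDiff_cosSeries (a : D.Ell) {m : ℕ} (h : D.enrm m a ≠ ∞) :
    ContDiff ℝ m (D.cosSeries a) := by
  rw [cosSeries_eq_fun]
  exact contDiff_tsum (N := (m : ℕ∞)) (fun j => D.contDiff_mode _ j _)
    (fun k hk => D.summable_absIdx_theta_of_le a h hk)
    fun k j x _ => D.norm_iteratedFDeriv_mode_le _ j k x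

theorem mem_kLsq_mul (a : D.Ell) (h : D.enrm 1 a ≠ ∞) :
    (fun k => -D.kLsq k * a k) ∈ ell1Submodule D.omega := by
  have h1 := D.summable_of_enrm_ne_top h
  refine Summable.of_nonneg_of_le (fun k => mul_nonneg (abs_nonneg _) (D.omega k).2.le)
    (fun k => ?_) h1
  rw [abs_mul, abs_neg, abs_of_nonneg (D.kLsq_nonneg k), zpow_one]
  have h2 : D.kLsq k ≤ D.theta k := by
    rw [theta]
    linarith
  calc D.kLsq k * |a k| * D.omega k ≤ D.theta k * |a k| * D.omega k := by
        have := (D.omega k).2.le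
        gcongr
    _ = _ := by ring

/-- The Laplacian of a cosine series. -/
theorem laplacian_cosSeries (a b : D.Ell) (h : D.enrm 2 a ≠ ∞) (hb : ∀ k, b k = -D.kLsq k * a k) :
    (Laplacian.laplacian (D.cosSeries a) : EuclideanSpace ℝ (Fin d) → ℝ) = D.cosSeries b := by
  funext x
  have h2 : ∀ k : ℕ, (k : ℕ∞) ≤ (2 : ℕ) →
      Summable fun j : Fin d → ℤ => |a (absIdx j)| * D.theta (absIdx j) ^ k :=
    fun k hk => D.summable_absIdx_theta_of_le a (m := 2) h hk
  rw [InnerProductSpace.laplacian_eq_iteratedFDeriv_orthonormalBasis _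
    (EuclideanSpace.basisFun (Fin d) ℝ)]
  simp only
  have e1 : iteratedFDeriv ℝ 2 (D.cosSeries a) x = ∑' j : Fin d → ℤ,
      iteratedFDeriv ℝ 2 (fun x => a (absIdx j) * Real.cos (D.phase j x)) x := by
    rw [cosSeries_eq_fun]
    exact iteratedFDeriv_tsum_apply (N := ((2 : ℕ) : ℕ∞)) (fun j => D.contDiff_mode _ j _) h2
      (fun k j x _ => D.norm_iteratedFDeriv_mode_le _ j k x) le_rfl x
  have hsum : Summable fun j : Fin d → ℤ =>
      iteratedFDeriv ℝ 2 (fun x => a (absIdx j) * Real.cos (D.phase j x)) x :=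
    Summable.of_norm_bounded (h2 2 le_rfl) fun j => D.norm_iteratedFDeriv_mode_le _ j 2 x
  have e2 : ∀ (v : EuclideanSpace ℝ (Fin d)) (j : Fin d → ℤ),
      iteratedFDeriv ℝ 2 (fun x => a (absIdx j) * Real.cos (D.phase j x)) x ![v, v]
        = -(D.phase j v ^ 2 * (a (absIdx j) * Real.cos (D.phase j x))) := by
    intro v j
    rw [iteratedFDeriv_mode, smul_apply,
      ContinuousMultilinearMap.compContinuousLinearMap_apply,
      iteratedFDeriv_apply_eq_iteratedDeriv_mul_prod, Fin.prod_univ_two]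
    have h3 : iteratedDeriv 2 Real.cos = -Real.cos := by
      rw [iteratedDeriv_succ, iteratedDeriv_one, Real.deriv_cos']
      funext y
      simp
    rw [h3]
    simp only [smul_eq_mul, Pi.neg_apply, Matrix.cons_val_zero, Matrix.cons_val_one]
    ring
  have e3 : ∀ v : EuclideanSpace ℝ (Fin d), iteratedFDeriv ℝ 2 (D.cosSeries a) x ![v, v]
      = ∑' j : Fin d → ℤ, -(D.phase j v ^ 2 * (a (absIdx j) * Real.cos (D.phase j x))) := by
    intro v
    rw [e1]
    refine ((ContinuousMultilinearMap.apply ℝ (fun _ : Fin 2 => EuclideanSpace ℝ (Fin d)) ℝ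
      ![v, v]).map_tsum hsum).trans ?_
    exact tsum_congr fun j => e2 v j
  have hsum' : ∀ v : EuclideanSpace ℝ (Fin d), Summable fun j : Fin d → ℤ =>
      -(D.phase j v ^ 2 * (a (absIdx j) * Real.cos (D.phase j x))) := fun v =>
    ((ContinuousMultilinearMap.apply ℝ (fun _ : Fin 2 => EuclideanSpace ℝ (Fin d)) ℝ
      ![v, v]).summable hsum).congr fun j => e2 v j
  simp only [e3]
  -- Summing over the standard basis inside the series gives `∑ (j_i L_i)²`, which is `(kL)²` for `k
  -- = |j|`.
  rw [← Summable.tsum_finsetSum fun i _ => hsum' _, cosSeries_eq_tsum_cos]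
  refine tsum_congr fun j => ?_
  have h4 : ∀ i, D.phase j (EuclideanSpace.basisFun (Fin d) ℝ i) = j i * D.L i := by
    intro i
    rw [phase_apply, Finset.sum_eq_single i]
    · simp
    · intro l _ hl
      simp [hl]
    · simp
  have h5 : D.kLsq (absIdx j) = ∑ i, ((j i : ℝ) * D.L i) ^ 2 := by
    have := D.theta_absIdx j
    rw [theta] at this
    linarith
  simp only [h4]
  rw [Finset.sum_neg_distrib, ← Finset.sum_mul, hb, h5]
  ring

end Setting

/-! ### From sequences to classical solutions -/

namespace Setting

variable {d : ℕ} {D : Setting d}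

theorem enrm_kLsq_mul_le (m : ℕ) (a : (Fin d → ℕ) → ℝ) :
    D.enrm m (fun k => -D.kLsq k * a k) ≤ D.enrm (m + 1 : ℕ) a := by
  refine ENNReal.tsum_le_tsum fun k => ?_
  rw [Nat.cast_succ, wt_add, mul_assoc, enorm_mul, zpow_one]
  refine mul_le_mul_right (mul_le_mul_left ?_ _) _
  rw [← ofReal_norm, norm_neg, Real.norm_of_nonneg (D.kLsq_nonneg k)]
  refine ENNReal.ofReal_le_ofReal ?_
  rw [theta]
  linarith

/-- The Laplacian of a smooth sequence. -/
theorem exists_laplacian (a : D.Ell) (h : ∀ m : ℕ, D.enrm m a ≠ ∞) :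
    ∃ b : D.Ell, (∀ k, b k = -D.kLsq k * a k) ∧ (∀ m : ℕ, D.enrm m b ≠ ∞) ∧
      (Laplacian.laplacian (D.cosSeries a) : EuclideanSpace ℝ (Fin d) → ℝ) = D.cosSeries b := by
  refine ⟨Ell1.mk _ (D.mem_kLsq_mul a (h 1)), fun k => rfl, fun m => ?_, ?_⟩
  · exact ne_top_of_le_ne_top (h (m + 1)) (enrm_kLsq_mul_le m a)
  · exact D.laplacian_cosSeries a _ (h 2) fun k => rfl

theorem exists_laplacian_iterate (f : D.Ell) (h : ∀ m : ℕ, D.enrm m f ≠ ∞) :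
    ∃ g : D.Ell, (∀ k, g k = D.kap k * f k) ∧
      (fun f : EuclideanSpace ℝ (Fin d) → ℝ =>
        (Laplacian.laplacian f : EuclideanSpace ℝ (Fin d) → ℝ))^[D.p] (D.cosSeries f)
        = D.cosSeries g := by
  rcases Nat.le_one_iff_eq_zero_or_eq_one.1 D.p_le_one with hp | hp
  · refine ⟨f, fun k => ?_, ?_⟩
    · rw [kap, hp, pow_zero, one_mul]
    · rw [hp, Function.iterate_zero, id]
  · obtain ⟨g, hg, -, hg'⟩ := exists_laplacian f h
    refine ⟨g, fun k => ?_, ?_⟩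
    · rw [kap, hp, pow_one, hg]
    · rw [hp, Function.iterate_one]
      exact hg'

/-- A smooth solution in the sequence space yields a classical solution. -/
theorem isIVPSolution_cosSeries {τ : ℝ} {φ : D.Ell} {a B' : ℝ → D.Ell}
    (hB' : ∀ t ∈ Ioc 0 τ, ∀ k, B' t k = D.mu k * a t k + D.kap k * D.Nop (a t) k)
    (hd : ∀ t ∈ Ioc 0 τ, HasDerivWithinAt a (B' t) (Ioc 0 τ) t)
    (hm : ∀ t ∈ Ioc 0 τ, ∀ m : ℕ, D.enrm m (a t) ≠ ∞) (h0 : Tendsto a (𝓝[>] 0) (𝓝 φ)) :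
    D.IsIVPSolution τ (D.cosSeries φ) (fun t => D.cosSeries (a t)) where
  contDiff_two t ht := D.contDiff_cosSeries (a t) (m := 2) (hm t ht 2)
  contDiff_four _ t ht := D.contDiff_cosSeries (a t) (m := 4) (hm t ht 4)
  periodic t _ x i := D.cosSeries_periodic (a t) x i
  even t _ x := D.cosSeries_neg (a t) x
  equation t ht x := by
    obtain ⟨b, hb, hbm, hΔ⟩ := exists_laplacian (a t) (hm t ht)
    obtain ⟨c, hc, -, hΔΔ⟩ := exists_laplacian b hbm
    have hN : ∀ m : ℕ, D.enrm m (D.Nop (a t)) ≠ ∞ := by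
      intro m
      obtain ⟨C, hC⟩ := D.exists_enrm_Nop_le m ‖a t‖₊
      exact ne_top_of_le_ne_top (ENNReal.mul_ne_top ENNReal.coe_ne_top
        (ENNReal.add_ne_top.2 ⟨ENNReal.one_ne_top, hm t ht m⟩)) (hC (a t) le_rfl)
    obtain ⟨g, hg, hΔN⟩ := exists_laplacian_iterate (D.Nop (a t)) hN
    have h1 : (fun y => D.N.eval (D.cosSeries (a t) y)) = D.cosSeries (D.Nop (a t)) :=
      funext fun y => (D.cosSeries_Nop (a t) y).symm
    -- The right-hand side is regrouped into sequences whose cosine series are the terms of the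
    -- differential equation; `b` and `c` belong to `Δu` and `Δ²u`.
    have h2 : B' t = D.lam0 • a t + D.lam1 • b + D.lam2 • c + g := by
      ext k
      rw [hB' t ht k]
      simp only [Ell1.add_apply, Ell1.smul_apply]
      rw [hc, hb, hg, mu]
      ring
    -- Point evaluation is a bounded functional on `ℓ¹_ω`, so the time derivative passes through the
    -- cosine series.
    have h3 := (D.evalL x).hasFDerivAt.comp_hasDerivWithinAt t (hd t ht)
    rw [h2, map_add, map_add, map_add, map_smul, map_smul, map_smul] at h3
    simp only [smul_eq_mul, evalL_apply] at h3
    rw [h1, hΔN, hΔ, hΔΔ]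
    exact h3
  initial := by
    rw [Metric.tendstoUniformly_iff]
    intro ε hε
    filter_upwards [Metric.tendsto_nhds.1 h0 ε hε] with t ht x
    rw [dist_comm, dist_eq_norm, ← cosSeries_sub]
    rw [dist_eq_norm] at ht
    exact (D.norm_cosSeries_le _ x).trans_lt ht

end Setting
end ParabolicIVP

end

end

/-! ### The local existence theorem -/

theorem theorem3p6 {d : ℕ} (hd : 1 ≤ d) (D : Setting d)
    (τ : ℝ) (hτ : 0 < τ) (φ : D.Ell)
    -- the Chebyshev–Fourier approximation
    (n : ℕ) (M : Fin d → ℕ) (c : ℕ → (Fin d → ℕ) → ℝ)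
    (abar : ℝ → D.Ell) (habar : abar = D.approx τ n M c)
    -- the uniform bounds of the evolution operator on `0 < s < t ≤ τ`
    (γ : ℝ) (hγ0 : 0 ≤ γ) (hγ1 : γ < 1) (W Wq : ℝ) (hW0 : 0 < W) (hWq0 : 0 < Wq)
    (hW : ∀ s t : ℝ, 0 < s → s < t → t ≤ τ → ∀ χ : D.Ell,
      ‖D.U abar τ t s (D.incl χ)‖ ≤ W * ‖χ‖)
    (hWq : ∀ s t : ℝ, 0 < s → s < t → t ≤ τ → ∀ ψ : D.Ell,
      (t - s) ^ γ * ‖D.U abar τ t s (D.Q ψ)‖ ≤ Wq * ‖ψ‖)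
    -- the defect bounds
    (δ ε : ℝ)
    (hδ : ∀ t ∈ Set.Ioc 0 τ, ∃ r : D.Ell, (∀ k, r k = D.F1 τ abar t k) ∧ ‖r‖ ≤ δ)
    (hε : ‖φ - abar 0‖ ≤ ε)
    -- the Lipschitz-type bound of the nonlinearity
    (Lip : ℝ → ℝ) (hLip_mono : MonotoneOn Lip (Set.Ioi 0)) (hLip_pos : ∀ ϱ > 0, 0 < Lip ϱ)
    (hLip : ∀ ϱ > 0, ∀ a₁ ∈ D.ball (τ := τ) abar ϱ, ∀ a₂ ∈ D.ball (τ := τ) abar ϱ,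
      ∀ t : Set.Ioc 0 τ,
        ‖D.Nop (a₁ t) - D.Nop (a₂ t) - D.DN (abar t) (a₁ t - a₂ t)‖ ≤ Lip ϱ * ‖a₁ - a₂‖)
    (ϱ₀ : ℝ) (hϱ₀ : 0 < ϱ₀)
    (hp : W * (ε + τ * δ) + τ ^ (1 - γ) * Wq / (1 - γ) * Lip ϱ₀ * ϱ₀ ≤ ϱ₀) :
    -- the integral in the definition of `T` converges for every `a ∈ X`
    (∀ a : D.X τ, ∀ t ∈ Set.Ioc 0 τ,
      IntervalIntegrable (fun s => D.U abar τ t s (D.newtonRhs abar a s))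
        MeasureTheory.volume 0 t) ∧
    -- `T` maps `X` into `X` and contracts the ball
    ∃ TX : D.X τ → D.X τ, (∀ a : D.X τ, ∀ t : Set.Ioc 0 τ, TX a t = D.T abar φ a t) ∧
      Set.MapsTo TX (D.ball abar ϱ₀) (D.ball abar ϱ₀) ∧
      (∃ K : NNReal, K ≤ 1 ∧ (0 < ε + τ * δ → K < 1) ∧
        LipschitzOnWith K TX (D.ball abar ϱ₀)) ∧
      -- the unique fixed point is the unique zero of `F` in the ball
      ∃ atil ∈ D.ball (τ := τ) abar ϱ₀, TX atil = atil ∧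
        (∀ a ∈ D.ball abar ϱ₀, TX a = a → a = atil) ∧
        D.IsZeroOfF τ φ (D.ext atil) ∧
        (∀ a ∈ D.ball abar ϱ₀, D.IsZeroOfF τ φ (D.ext a) → a = atil) ∧
        -- the regularity and the equation hold up to the end point `τ`
        ContDiffOn ℝ 1 (D.ext atil) (Set.Ioc 0 τ) ∧
        (∀ t ∈ Set.Ioc 0 τ, D.F1 τ (D.ext atil) t = 0) ∧
        -- its cosine series solves the initial value problem on `J`
        D.IsIVPSolution τ (D.cosSeries φ) (fun t => D.cosSeries (D.ext atil t)) := by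
  subst habar
  set abar := D.approx τ n M c
  have hC1 : ContDiff ℝ 1 abar := Setting.contDiff_approx τ n M c
  have hc := hC1.continuous
  have hg := Setting.isKernel_linKer hc (Setting.boxSupp_approx (D := D) τ n M c)
  have hE : D.EvolBounds abar τ γ W Wq := ⟨hγ1, hW0.le, hWq0.le, hW, hWq⟩
  obtain ⟨TX, hTX⟩ := hE.exists_TX hg hc φ
  obtain ⟨hmaps, hK, atil, hball, hfix⟩ := hE.exists_fixed_point hg hC1 hτ hδ hε hW0 hϱ₀
    (hLip_pos ϱ₀ hϱ₀).le (hLip ϱ₀ hϱ₀) hp hTX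
  have hmild : ∀ a : D.X τ, TX a = a → D.Mild 0 τ φ (fun r k => D.kap k * D.Nop (D.ext a r) k)
      (fun t k => D.ext a t k) := fun a ha => hE.nonlinear_mild_of_fixed hg hc fun t => by
    rw [← hTX, ha]
  -- Uniqueness among all mild solutions in `X`, not only in the ball. It serves both for fixed
  -- points of `T` and for zeros of `F`, and does not need a strict contraction.
  have huniq : ∀ a : D.X τ, D.Mild 0 τ φ (fun r k => D.kap k * D.Nop (D.ext a r) k)
      (fun t k => D.ext a t k) → a = atil := by
    intro a ha
    ext1 t
    have h1 := Setting.nonlinear_mild_unique (Setting.continuousOn_ext a)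
      (Setting.continuousOn_ext atil) (R := max ‖a‖₊ ‖atil‖₊)
      (fun t ht => (Setting.norm_ext_le a ht).trans (le_max_left _ _))
      (fun t ht => (Setting.norm_ext_le atil ht).trans (le_max_right _ _)) ha (hmild atil hfix)
      t t.2
    rwa [Setting.ext_apply a t.2, Setting.ext_apply atil t.2] at h1
  have hbd : ∀ t ∈ Set.Ioc 0 τ, ‖D.ext atil t‖ ≤ ‖atil‖₊ := fun t ht => Setting.norm_ext_le atil ht
  obtain ⟨⟨B', hB', -, hd', hmem, hsm⟩, hlim⟩ := Setting.nonlinear_mild_regularity hτ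
    (Setting.continuousOn_ext atil) hbd (hmild atil hfix)
  obtain ⟨hreg, hF⟩ := Setting.nonlinear_mild_contDiffOn hτ
    (Setting.continuousOn_ext atil) hbd (hmild atil hfix)
  exact ⟨fun a t ht => hE.intervalIntegrable_T hg hc a ht, TX, hTX, hmaps, hK, atil, hball, hfix,
    fun a _ ha => huniq a (hmild a ha),
    ⟨hmem, fun t ht => hF t (Set.Ioo_subset_Ioc_self ht), hlim⟩,
    fun a _ ha => huniq a (Setting.nonlinear_mild_of_isZeroOfF ha), hreg, hF,
    Setting.isIVPSolution_cosSeries hB' hd' hsm hlim⟩
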